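/- Let $d\ge 2$, let $O$ be a compact connected orientable surface (possibly with boundary), and let $Y$ be a sphere or a torus. Let $Y^d$ be $Y$ with $d+1$ open discs (with disjoint closures) removed, with boundary circles $b_0,\dots,b_d$, and fix orientation-reversing homeomorphisms $\mu_i:b_0\to b_i$ ($1\le i\le d$). Let $O_1$ be $O$ with an open disc removed from its interior, let $O_2$ be obtained by gluing a copy of $Y^d$ along $b_0$ to the new boundary circle of $O_1$ by a fixed orientation-reversing homeomorphism, and continue inductively, gluing a copy of $Y^d$ along its $b_0$ by means of $\mu_i$ to each circle $b_i$, $1\le i\le d$, of each copy added in the previous step. The union is the Cantor surface $\mathcal C=\mathcal C_d(O,Y)$; the copies of $Y^d$ are its blocks, and each block $B$ has its canonical identification $\iota_B:B\to Y^d$. A suited subsurface is a connected union of $O_1$ and finitely many blocks; its suited boundary components are those that are not boundary components of $O$. Let $\mathrm{Map}_\partial(Y^d,b_0)$ be the group of self-homeomorphisms $h$ of $Y^d$ that are the identity on $b_0$ and permute $b_1,\dots,b_d$ compatibly with the parametrizations given by the $\mu_i$ (that is, $h\circ\mu_i=\mu_{\sigma(i)}$ for a permutation $\sigma$), modulo isotopies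 fixing $\partial Y^d$ pointwise, and let $H$ be a subgroup of it. An $H$-block homeomorphism is a homeomorphism $f:\mathcal C\to\mathcal C$ for which there is a suited subsurface $Z$ such that $f(Z)$ is suited, $f$ maps the blocks outside $Z$ to blocks, and for each suited boundary component $a$ of $Z$ there is a label $h_a\in H$ such that, for every block $B$ in the component of $\mathcal C\setminus Z$ adjacent to $a$, the map $\iota_{f(B)}\circ f\circ\iota_B^{-1}$ represents $h_a$. Let $\mathfrak B_d(H)$ be the set of isotopy classes of $H$-block homeomorphisms fixing $\partial\mathcal C$ pointwise, modulo isotopies fixing $\partial\mathcal C$ pointwise, and $\mathfrak B_d=\mathfrak B_d(\{1\})$. For $h\in H$, there is exactly one mapping class $\iota(h)$ of $\mathcal C$ that is represented by a homeomorphism fixing $\partial\mathcal C$ pointwise which is the identity on $O_2$ and is labeled outside $O_2$ by $h$ at the first suited boundary component of $O_2$ and by $1$ at the others; the map $\iota$ is a group homomorphism on $H$; and $\mathfrak B_d(H)$ is the subgroup of the mapping class group of $\mathcal C$ generated by $\iota(H)$ and $\mathfrak B_d$. -/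

import Mathlib

open scoped Manifold

noncomputable section

namespace CantorSurface

/-! ### Isotopies and mapping class groups -/

section Isotopy

variable {X : Type*} [TopologicalSpace X]

/-- `g` is isotopic to the identity through self-homeomorphisms of `X` that fix the set `A`
pointwise. -/
def IsotopicToId (A : Set X) (g : X ≃ₜ X) : Prop :=
  ∃ F : unitInterval → (X ≃ₜ X), Continuous (fun p : unitInterval × X => F p.1 p.2) ∧
    F 0 = 1 ∧ F 1 = g ∧ ∀ t, ∀ x ∈ A, F t x = x

/-- The group of self-homeomorphisms of `X` that are isotopic to the identity relative to `A`. -/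
def isotopyTrivial (A : Set X) : Subgroup (X ≃ₜ X) where
  carrier := {g | IsotopicToId A g}
  one_mem' := ⟨fun _ => 1, continuous_snd, rfl, rfl, fun _ _ _ => rfl⟩
  mul_mem' := by
    rintro a b ⟨F, hF, hF0, hF1, hFA⟩ ⟨G, hG, hG0, hG1, hGA⟩
    refine ⟨fun t => F t * G t, ?_, by simp [hF0, hG0], by simp [hF1, hG1], ?_⟩
    · exact hF.comp (continuous_fst.prodMk hG)
    · intro t x hx
      change F t (G t x) = x
      rw [hGA t x hx, hFA t x hx]
  inv_mem' := by
    rintro a ⟨F, hF, hF0, hF1, hFA⟩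
    refine ⟨fun t => a⁻¹ * F (unitInterval.symm t), ?_, by simp [hF1], by simp [hF0], ?_⟩
    · exact (a⁻¹ : X ≃ₜ X).continuous.comp (hF.comp
        ((unitInterval.continuous_symm.comp continuous_fst).prodMk continuous_snd))
    · intro t x hx
      change a.symm (F (unitInterval.symm t) x) = x
      rw [hFA _ x hx, Homeomorph.symm_apply_eq, ← hF1, hFA 1 x hx]

/-- Relative isotopy classes can be multiplied in any group of homeomorphisms preserving `A`. -/
theorem isotopyTrivial_normal (A : Set X) (G : Subgroup (X ≃ₜ X))
    (hG : ∀ g ∈ G, ∀ x ∈ A, g x ∈ A) : ((isotopyTrivial A).subgroupOf G).Normal := by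
  refine ⟨?_⟩
  rintro ⟨a, ha⟩ haT ⟨g, hg⟩
  rw [Subgroup.mem_subgroupOf] at haT ⊢
  obtain ⟨F, hF, hF0, hF1, hFA⟩ := haT
  refine ⟨fun t => g * F t * g⁻¹, ?_, by simp [hF0], by simp [hF1], ?_⟩
  · exact g.continuous.comp
      (hF.comp (continuous_fst.prodMk ((g⁻¹ : X ≃ₜ X).continuous.comp continuous_snd)))
  · intro t x hx
    change g (F t (g⁻¹ x)) = x
    rw [hFA t _ (hG g⁻¹ (G.inv_mem hg) x hx)]
    exact g.apply_symm_apply x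

end Isotopy

/-! ### The pieces: `O₁` and the block `Y^d` -/

/-- A homeomorphism of the unit circle reverses the orientation: it has a decreasing lift. -/
def ReversesOrientation (φ : Circle ≃ₜ Circle) : Prop :=
  ∃ F : ℝ → ℝ, Continuous F ∧ StrictAnti F ∧ ∀ t, φ (Circle.exp t) = Circle.exp (F t)

/-- The choices made in the construction of a Cantor surface.

The open disc removed from `O` is the image of the unit disc under a coordinate chart `chartO`.
The `d + 1` open discs removed from `Y` are the images, under a coordinate chart `chartY`, of the
discs of radius `1/4` about `0, 1, …, d`; every family of `d + 1` disjoint closed discs in a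
connected surface arises so for a suitable chart.  The boundary circle `b_i` of `Y^d` is
identified with the unit circle by `z ↦ chartY (i + z / 4)`.  All the `b_i` have thereby the same
sense with respect to the orientation of `Y^d`, so that orientation-reversing homeomorphisms
`μ_i : b_0 → b_i` correspond to orientation-reversing homeomorphisms `glue i` of the unit circle.
For the gluing of the first block to `O`, no sense has to be prescribed: any homeomorphism is
orientation-reversing for one of the two orientations of `O`. -/
structure Datum (d : ℕ) (O Y : Type*) [TopologicalSpace O] [TopologicalSpace Y] where
  chartO : ℂ → O
  isOpenEmbedding_chartO : Topology.IsOpenEmbedding chartO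
  chartY : ℂ → Y
  isOpenEmbedding_chartY : Topology.IsOpenEmbedding chartY
  glueRoot : Circle ≃ₜ Circle
  glue : Fin d → (Circle ≃ₜ Circle)
  reversesOrientation_glue : ∀ i, ReversesOrientation (glue i)

variable {d : ℕ} {O Y : Type*} [TopologicalSpace O] [TopologicalSpace Y]

namespace Datum

variable (D : Datum d O Y)

/-- `O₁`: the surface `O` with an open disc removed. -/
def O₁ : Set O := {x | x ∉ D.chartO '' Metric.ball 0 1}

/-- The boundary circle of `O₁` created by removing the disc. -/
def rootCircle (z : Circle) : D.O₁ :=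
  ⟨D.chartO z, by
    rintro ⟨u, hu, huz⟩
    rw [D.isOpenEmbedding_chartO.injective huz, mem_ball_zero_iff, Circle.norm_coe] at hu
    exact lt_irrefl _ hu⟩

/-- `Y^d`: the surface `Y` with `d + 1` open discs removed. -/
def Block : Set Y :=
  {y | ∀ i : Fin (d + 1), y ∉ D.chartY '' Metric.ball ((i : ℕ) : ℂ) (1 / 4)}

/-- The boundary circle `b_i` of `Y^d`. -/
def circle (i : Fin (d + 1)) (z : Circle) : D.Block :=
  ⟨D.chartY ((i : ℕ) + z / 4), by
    rintro j ⟨u, hu, huz⟩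
    rw [D.isOpenEmbedding_chartY.injective huz, Metric.mem_ball, dist_eq_norm] at hu
    have hz : ‖((z : ℂ) / 4)‖ = 1 / 4 := by
      rw [norm_div, Circle.norm_coe]
      norm_num
    by_cases hij : i = j
    · subst hij
      rw [add_sub_cancel_left, hz] at hu
      exact lt_irrefl _ hu
    · have h1 : (1 : ℝ) ≤ ‖(((i : ℕ) : ℂ) - ((j : ℕ) : ℂ))‖ := by
        have h2 : (((i : ℕ) : ℤ) - ((j : ℕ) : ℤ)) ≠ 0 := by
          intro h
          exact hij (Fin.ext (by omega))
        have h3 : (1 : ℝ) ≤ |((((i : ℕ) : ℤ) - ((j : ℕ) : ℤ) : ℤ) : ℝ)| := by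
          exact_mod_cast Int.one_le_abs h2
        have h4 : (((i : ℕ) : ℂ) - ((j : ℕ) : ℂ))
            = ((((((i : ℕ) : ℤ) - ((j : ℕ) : ℤ) : ℤ) : ℝ)) : ℂ) := by
          push_cast
          rfl
        rw [h4, Complex.norm_real]
        exact h3
      have h5 : ‖(((i : ℕ) : ℂ) - ((j : ℕ) : ℂ))‖
          ≤ ‖((i : ℕ) : ℂ) + (z : ℂ) / 4 - ((j : ℕ) : ℂ)‖ + ‖((z : ℂ) / 4)‖ := by
        have h6 : (((i : ℕ) : ℂ) - ((j : ℕ) : ℂ))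
            = (((i : ℕ) : ℂ) + (z : ℂ) / 4 - ((j : ℕ) : ℂ)) - (z : ℂ) / 4 := by ring
        calc ‖(((i : ℕ) : ℂ) - ((j : ℕ) : ℂ))‖
            = ‖(((i : ℕ) : ℂ) + (z : ℂ) / 4 - ((j : ℕ) : ℂ)) - (z : ℂ) / 4‖ := by rw [← h6]
          _ ≤ _ := norm_sub_le _ _
      linarith⟩

/-- The gluing map `μ_i : b_0 → b_i`, where `b_0` is identified with the unit circle. -/
def μ (i : Fin d) (z : Circle) : D.Block := D.circle i.succ (D.glue i z)

/-- The boundary of `Y^d`. -/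
def blockBoundary : Set D.Block := {y | ∃ i z, y = D.circle i z}

/-- The self-homeomorphisms of `Y^d` that fix `b_0` pointwise and respect the parametrizations of
the other boundary circles. The circles `b_1, …, b_d` are parametrized by means of the `μ_i`, so
that a homeomorphism taking `b_i` to `b_j` has to carry `μ_i` to `μ_j`.
As `b_0` is fixed pointwise, such a homeomorphism preserves the orientation. -/
def homeoBlock : Subgroup (D.Block ≃ₜ D.Block) where
  carrier := {h | (∀ z, h (D.circle 0 z) = D.circle 0 z) ∧
    ∃ σ : Equiv.Perm (Fin d), ∀ i z, h (D.μ i z) = D.μ (σ i) z}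
  one_mem' := ⟨fun _ => rfl, 1, fun _ _ => rfl⟩
  mul_mem' := by
    rintro a b ⟨ha, σ, hσ⟩ ⟨hb, τ, hτ⟩
    refine ⟨fun z => ?_, σ * τ, fun i z => ?_⟩
    · change a (b _) = _
      rw [hb, ha]
    · change a (b _) = _
      rw [hτ, hσ]
      rfl
  inv_mem' := by
    rintro a ⟨ha, σ, hσ⟩
    refine ⟨fun z => ?_, σ⁻¹, fun i z => ?_⟩
    · change a.symm _ = _
      rw [Homeomorph.symm_apply_eq, ha]
    · change a.symm _ = _
      rw [Homeomorph.symm_apply_eq, hσ]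
      exact congrArg (fun j => D.μ j z) (σ.apply_symm_apply i).symm

instance normal_isotopyTrivial_block :
    ((isotopyTrivial D.blockBoundary).subgroupOf D.homeoBlock).Normal := by
  refine isotopyTrivial_normal _ _ ?_
  rintro h ⟨h0, σ, hσ⟩ x ⟨i, z, rfl⟩
  induction i using Fin.cases with
  | zero => exact ⟨0, z, h0 z⟩
  | succ i =>
    refine ⟨(σ i).succ, D.glue (σ i) ((D.glue i).symm z), ?_⟩
    have := hσ i ((D.glue i).symm z)
    simpa [μ] using this

/-- `Map_∂(Y^d, b_0)`: isotopy classes of homeomorphisms of the block that fix `b_0` pointwise and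
respect the boundary parametrizations, modulo isotopies that fix the boundary pointwise. -/
abbrev BlockMap : Type _ :=
  D.homeoBlock ⧸ (isotopyTrivial D.blockBoundary).subgroupOf D.homeoBlock

/-! ### The Cantor surface -/

/-- The identifications: blocks are indexed by words in `{0, …, d-1}`, the block `i :: w` being
glued along its top boundary `b_0` to the boundary circle `b_{i+1}` of the block `w`, and the
block of the empty word being glued along its top boundary to `O₁`. -/
inductive Glued : (D.O₁ ⊕ (Σ _ : List (Fin d), D.Block)) →
    (D.O₁ ⊕ (Σ _ : List (Fin d), D.Block)) → Prop
  | root (z : Circle) :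
      Glued (Sum.inl (D.rootCircle (D.glueRoot z))) (Sum.inr ⟨[], D.circle 0 z⟩)
  | child (w : List (Fin d)) (i : Fin d) (z : Circle) :
      Glued (Sum.inr ⟨w, D.μ i z⟩) (Sum.inr ⟨i :: w, D.circle 0 z⟩)

/-- The Cantor surface `𝒞_d(O, Y)`, with the quotient topology. -/
abbrev Surface : Type _ := Quot D.Glued

/-- The inclusion of `O₁`. -/
def inO (x : D.O₁) : D.Surface := Quot.mk _ (Sum.inl x)

/-- The canonical identification of `Y^d` with the block of the word `w`
(the inverse of the fixed homeomorphism from that block to `Y^d`). -/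
def inB (w : List (Fin d)) (y : D.Block) : D.Surface := Quot.mk _ (Sum.inr ⟨w, y⟩)

/-- The block of the word `w`, as a subset of the Cantor surface. -/
def block (w : List (Fin d)) : Set D.Surface := Set.range (D.inB w)

/-- A suited subsurface: a connected union of `O₁` and finitely many blocks. -/
def IsSuited (Z : Set D.Surface) : Prop :=
  IsConnected Z ∧ ∃ S : Finset (List (Fin d)), Z = Set.range D.inO ∪ ⋃ w ∈ S, D.block w

/-- `O₂`: the union of `O₁` and the first block. -/
def O₂ : Set D.Surface := Set.range D.inO ∪ D.block []

/-- The top boundary of the block `v` is a suited boundary component of the suited subsurface `Z`: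
`v` is not in `Z`, but the piece to which `v` is glued is in `Z`. Every suited boundary component
of `Z` is of this form for exactly one `v`, and the blocks in the component of the complement of
`Z` adjacent to it are those indexed by the words that end in `v` (the descendants of `v`). -/
def IsSuitedBoundary (Z : Set D.Surface) : List (Fin d) → Prop
  | [] => ¬ D.block [] ⊆ Z
  | i :: u => D.block u ⊆ Z ∧ ¬ D.block (i :: u) ⊆ Z

/-- `Z` is a defining surface for `f`: both `Z` and `f(Z)` are suited, and `f` sends the
blocks outside `Z` to blocks. -/
def IsDefiningSurface (f : D.Surface ≃ₜ D.Surface) (Z : Set D.Surface) : Prop :=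
  D.IsSuited Z ∧ D.IsSuited (f '' Z) ∧
    ∀ w, ¬ D.block w ⊆ Z → ∃ w', f '' D.block w = D.block w'

/-- `f` sends the block `w` to a block, and acts there like `h` under the identifications of the
two blocks with `Y^d`. -/
def ActsLike (f : D.Surface ≃ₜ D.Surface) (w : List (Fin d)) (h : D.BlockMap) : Prop :=
  ∃ (w' : List (Fin d)) (k : D.homeoBlock), (QuotientGroup.mk k : D.BlockMap) = h ∧
    ∀ y, f (D.inB w y) = D.inB w' (k.1 y)

/-- `f` is labeled outside its defining surface `Z` by `ℓ`: for every suited boundary component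
(the top of a block `v`) of `Z`, `f` acts like `ℓ v` on all the blocks of the adjacent
complementary component. -/
def IsLabeledBy (f : D.Surface ≃ₜ D.Surface) (Z : Set D.Surface)
    (ℓ : List (Fin d) → D.BlockMap) : Prop :=
  D.IsDefiningSurface f Z ∧
    ∀ v, D.IsSuitedBoundary Z v → ∀ w, v <:+ w → D.ActsLike f w (ℓ v)

/-- `H`-block homeomorphisms. Such a homeomorphism preserves the orientation, because the
elements of `H` do. -/
def IsHBlock (H : Subgroup D.BlockMap) (f : D.Surface ≃ₜ D.Surface) : Prop :=
  ∃ Z ℓ, D.IsLabeledBy f Z ℓ ∧ ∀ v, D.IsSuitedBoundary Z v → ℓ v ∈ H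

section MappingClassGroup

variable [ChartedSpace (EuclideanHalfSpace 2) O]

/-- The boundary of the Cantor surface: the original boundary components of `O`. -/
def boundary : Set D.Surface := {p | ∃ x : D.O₁, (x : O) ∈ (𝓡∂ 2).boundary O ∧ p = D.inO x}

/-- The self-homeomorphisms of the Cantor surface that fix its boundary pointwise. -/
def homeoSurface : Subgroup (D.Surface ≃ₜ D.Surface) where
  carrier := {f | ∀ x ∈ D.boundary, f x = x}
  one_mem' := fun _ _ => rfl
  mul_mem' := by
    intro a b ha hb x hx
    change a (b x) = x
    rw [hb x hx, ha x hx]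
  inv_mem' := by
    intro a ha x hx
    change a.symm x = x
    rw [Homeomorph.symm_apply_eq, ha x hx]

instance normal_isotopyTrivial_surface :
    ((isotopyTrivial D.boundary).subgroupOf D.homeoSurface).Normal := by
  refine isotopyTrivial_normal _ _ ?_
  intro g hg x hx
  rw [hg x hx]
  exact hx

/-- The group of isotopy classes, relative to the boundary, of homeomorphisms of the Cantor
surface that fix the boundary pointwise. -/
abbrev SurfaceMap : Type _ :=
  D.homeoSurface ⧸ (isotopyTrivial D.boundary).subgroupOf D.homeoSurface

/-- The block mapping class group `𝔅_d(H)` with local group `H`, as a set of mapping classes: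
the isotopy classes of `H`-block homeomorphisms. -/
def blockMappingClasses (H : Subgroup D.BlockMap) : Set D.SurfaceMap :=
  {φ | ∃ f : D.homeoSurface, D.IsHBlock H f.1 ∧ QuotientGroup.mk f = φ}

/-- `φ = [O₂, (id, (h, 1, …, 1)), O₂]`: the mapping class `φ` is represented by a homeomorphism
that is the identity on `O₂` and is labeled outside `O₂` by `(h, 1, …, 1)`, the label `h` being that
of the top of the block `[0]`, which is the first suited boundary component of `O₂`. -/
def IsFirstLabelClass (h : D.BlockMap) (φ : D.SurfaceMap) : Prop :=
  ∃ f : D.homeoSurface, QuotientGroup.mk f = φ ∧ (∀ x ∈ D.O₂, f.1 x = x) ∧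
    D.IsLabeledBy f.1 D.O₂ (fun v => if v.map Fin.val = [0] then h else 1)

end MappingClassGroup

end Datum

end CantorSurface

end

noncomputable section

namespace CantorSurface

namespace Datum

variable {d : ℕ} {O Y : Type*} [TopologicalSpace O] [TopologicalSpace Y] (D : Datum d O Y)

/-! ### Points of the Cantor surface -/

/-! Blocks are indexed by words, so the Cantor surface has a rooted `d`-ary tree of blocks, and a
family `κ` of block homeomorphisms gives a homeomorphism `portrait κ` acting on the block of `w` by
`κ w` and permuting blocks accordingly. The map ι is `subtreeHom [0]`: the family is constantly `k`
below the word `[0]` and trivial elsewhere. Since isotopies relative to the boundary of a block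
never permute its circles, they can be run on all blocks at once (`isotopicToId_portrait`). Hence a
portrait's class depends only on the classes of its values. This makes ι well defined, and it gives
uniqueness, because every homeomorphism with the prescribed labels is itself a portrait
(`isFirstLabelClass_iff`).

For generation, enlarging defining surfaces to balls of a common level shows that the block mapping
classes form a group (`blockGroup`), which contains both generating sets. Conversely, an `H`-block
homeomorphism defined on a ball has finitely many labels. Composing with elements supported on
single subtrees removes them one at a time and leaves an element with trivial labels
(`mk_mem_of_isBlockOn_ball`). It remains to obtain the elements supported on the subtree of an
arbitrary nonempty word from those at `[0]`. A block homeomorphism with trivial labels that carries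
one subtree rigidly to another conjugates the corresponding elements into each other
(`conj_portrait`), so such a `RigidMove` from `[0]` to every nonempty word is wanted.

Two kinds of move suffice (`rigidMove_of_generators`). Siblings are exchanged by a homeomorphism of
their parent block that swaps two lower circles and preserves parametrizations
(`rigidMove_siblings`). The level is changed by carrying `1 :: w` to `0 :: 0 :: w`
(`rigidMove_levels`): a disc with two holes lies across the circle between the block of `w` and its
first child, one hole being the second lower circle of the parent and the other the first lower
circle of the child, and a half turn of the disc exchanges the holes. For explicit formulas the
gluing maps are first straightened to complex conjugation (`exists_straightening`, where reversal of
orientation enters). Cayley transforms then fit the charts of the two blocks together along the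
imaginary axis, and the half turn becomes `s ↦ -s`. -/

theorem one_le_norm_natCast_sub {i j : ℕ} (h : i ≠ j) : (1 : ℝ) ≤ ‖(i : ℂ) - (j : ℂ)‖ := by
  have h2 : ((i : ℤ) - (j : ℤ)) ≠ 0 := by omega
  have h3 : (1 : ℝ) ≤ |(((i : ℤ) - (j : ℤ) : ℤ) : ℝ)| := by exact_mod_cast Int.one_le_abs h2
  have h4 : ((i : ℂ) - (j : ℂ)) = ((((i : ℤ) - (j : ℤ) : ℤ) : ℝ) : ℂ) := by push_cast; rfl
  rw [h4, Complex.norm_real]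
  exact h3

theorem circle_inj {i j : Fin (d + 1)} {z z' : Circle} (h : D.circle i z = D.circle j z') :
    i = j ∧ z = z' := by
  have h1 : ((i : ℕ) : ℂ) + z / 4 = (j : ℕ) + z' / 4 :=
    D.isOpenEmbedding_chartY.injective (congrArg Subtype.val h)
  have hij : i = j := by
    by_contra hne
    have h2 := one_le_norm_natCast_sub (i := i) (j := j) (fun h => hne (Fin.ext h))
    have h3 : ((i : ℕ) : ℂ) - (j : ℕ) = (z' : ℂ) / 4 - z / 4 := by linear_combination h1
    have h4 := norm_sub_le ((z' : ℂ) / 4) (z / 4)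
    rw [← h3, norm_div, norm_div, Circle.norm_coe, Circle.norm_coe] at h4
    norm_num at h4
    linarith
  subst hij
  refine ⟨rfl, Circle.ext ?_⟩
  linear_combination 4 * h1

theorem μ_inj {i j : Fin d} {z z' : Circle} (h : D.μ i z = D.μ j z') : i = j ∧ z = z' := by
  obtain ⟨h1, h2⟩ := D.circle_inj h
  have h3 := Fin.succ_injective _ h1
  subst h3
  exact ⟨rfl, (D.glue i).injective h2⟩

theorem μ_ne_circle_zero (i : Fin d) (z z' : Circle) : D.μ i z ≠ D.circle 0 z' :=
  fun h => Fin.succ_ne_zero i (D.circle_inj h).1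

theorem rootCircle_inj {z z' : Circle} (h : D.rootCircle z = D.rootCircle z') : z = z' :=
  Circle.ext (D.isOpenEmbedding_chartO.injective (congrArg Subtype.val h))

theorem norm_half_sub_natCast (j : ℕ) : (1 / 2 : ℝ) ≤ ‖(1 / 2 : ℂ) - j‖ := by
  have h4 : (1 / 2 : ℂ) - j = ((1 / 2 - j : ℝ) : ℂ) := by push_cast; ring
  rw [h4, Complex.norm_real, Real.norm_eq_abs]
  rcases Nat.eq_zero_or_pos j with h | h
  · subst h; norm_num
  · have : (1 : ℝ) ≤ j := by exact_mod_cast h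
    rw [abs_of_nonpos (by linarith)]
    linarith

/-- A point of the block that is not on its boundary. -/
def basePoint : D.Block :=
  ⟨D.chartY (1 / 2), by
    rintro j ⟨u, hu, huz⟩
    rw [D.isOpenEmbedding_chartY.injective huz, Metric.mem_ball, dist_eq_norm] at hu
    have := norm_half_sub_natCast j
    linarith⟩

theorem basePoint_ne_circle (i : Fin (d + 1)) (z : Circle) : D.basePoint ≠ D.circle i z := by
  intro h
  have h1 : (1 / 2 : ℂ) = (i : ℕ) + z / 4 :=
    D.isOpenEmbedding_chartY.injective (congrArg Subtype.val h)
  have h2 : (1 / 2 : ℂ) - (i : ℕ) = z / 4 := by linear_combination h1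
  have h3 := norm_half_sub_natCast i
  rw [h2, norm_div, Circle.norm_coe] at h3
  norm_num at h3

/-! ### The gluing relation and its quotient. -/

variable {D}

theorem Glued.left_unique {a a' b} (h : D.Glued a b) (h' : D.Glued a' b) : a = a' := by
  generalize hb : b = b' at h'
  cases h with
  | root z =>
    cases h' with
    | root z' =>
      have : z = z' := by
        simp only [Sum.inr.injEq, Sigma.mk.injEq, heq_eq_eq, true_and] at hb
        exact (D.circle_inj hb).2
      rw [this]
    | child w i z' => simp at hb
  | child w i z =>
    cases h' with
    | root z' => simp at hb
    | child w' i' z' =>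
      simp only [Sum.inr.injEq, Sigma.mk.injEq, List.cons.injEq, heq_eq_eq] at hb
      obtain ⟨⟨rfl, rfl⟩, h⟩ := hb
      rw [(D.circle_inj h).2]

theorem Glued.right_unique {a b b'} (h : D.Glued a b) (h' : D.Glued a b') : b = b' := by
  generalize hb : a = a' at h'
  cases h with
  | root z =>
    cases h' with
    | root z' =>
      simp only [Sum.inl.injEq] at hb
      rw [D.glueRoot.injective (D.rootCircle_inj hb)]
    | child w i z' => simp at hb
  | child w i z =>
    cases h' with
    | root z' => simp at hb
    | child w' i' z' =>
      simp only [Sum.inr.injEq, Sigma.mk.injEq, heq_eq_eq] at hb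
      obtain ⟨rfl, h⟩ := hb
      obtain ⟨rfl, rfl⟩ := D.μ_inj h
      rfl

theorem Glued.not_trans {a b c} (h : D.Glued a b) (h' : D.Glued b c) : False := by
  generalize hb : b = b' at h'
  cases h with
  | root z =>
    cases h' with
    | root z' => simp at hb
    | child w i z' =>
      simp only [Sum.inr.injEq, Sigma.mk.injEq, heq_eq_eq] at hb
      exact D.μ_ne_circle_zero _ _ _ hb.2.symm
  | child w i z =>
    cases h' with
    | root z' => simp at hb
    | child w' i' z' =>
      simp only [Sum.inr.injEq, Sigma.mk.injEq, heq_eq_eq] at hb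
      exact D.μ_ne_circle_zero _ _ _ hb.2.symm

/-- The gluing relation is a partial bijection, and two gluings never compose because top circles
are disjoint from lower ones. Every chain in the generated equivalence therefore collapses to length
at most one. -/
theorem mk_eq_mk {a b : D.O₁ ⊕ (Σ _ : List (Fin d), D.Block)}
    (h : (Quot.mk D.Glued a) = Quot.mk D.Glued b) : a = b ∨ D.Glued a b ∨ D.Glued b a := by
  have h1 := Quot.eqvGen_exact h
  clear h
  induction h1 with
  | rel x y h => exact Or.inr (Or.inl h)
  | refl x => exact Or.inl rfl
  | symm x y _ ih =>
    rcases ih with h | h | h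
    · exact Or.inl h.symm
    · exact Or.inr (Or.inr h)
    · exact Or.inr (Or.inl h)
  | trans x y z _ _ ih1 ih2 =>
    rcases ih1 with rfl | h | h
    · exact ih2
    · rcases ih2 with rfl | h' | h'
      · exact Or.inr (Or.inl h)
      · exact (h.not_trans h').elim
      · exact Or.inl (h.left_unique h')
    · rcases ih2 with rfl | h' | h'
      · exact Or.inr (Or.inr h)
      · exact Or.inl (h.right_unique h')
      · exact (h'.not_trans h).elim

variable (D)

theorem inB_μ (w : List (Fin d)) (i : Fin d) (z : Circle) :
    D.inB w (D.μ i z) = D.inB (i :: w) (D.circle 0 z) := Quot.sound (.child w i z)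

theorem inO_rootCircle (z : Circle) :
    D.inO (D.rootCircle (D.glueRoot z)) = D.inB [] (D.circle 0 z) := Quot.sound (.root z)

variable {D}

theorem inB_eq_inB {w w' : List (Fin d)} {y y' : D.Block} (h : D.inB w y = D.inB w' y') :
    (w = w' ∧ y = y') ∨ (∃ i z, w' = i :: w ∧ y = D.μ i z ∧ y' = D.circle 0 z) ∨
      (∃ i z, w = i :: w' ∧ y' = D.μ i z ∧ y = D.circle 0 z) := by
  rcases mk_eq_mk h with h | h | h
  · simp only [Sum.inr.injEq, Sigma.mk.injEq, heq_eq_eq] at h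
    exact Or.inl h
  · generalize ha : (Sum.inr ⟨w, y⟩ : D.O₁ ⊕ (Σ _ : List (Fin d), D.Block)) = a at h
    generalize hb : (Sum.inr ⟨w', y'⟩ : D.O₁ ⊕ (Σ _ : List (Fin d), D.Block)) = b at h
    cases h with
    | root z => simp at ha
    | child v i z =>
      simp only [Sum.inr.injEq, Sigma.mk.injEq, heq_eq_eq] at ha hb
      obtain ⟨rfl, rfl⟩ := ha
      exact Or.inr (Or.inl ⟨i, z, hb.1, rfl, hb.2⟩)
  · generalize ha : (Sum.inr ⟨w, y⟩ : D.O₁ ⊕ (Σ _ : List (Fin d), D.Block)) = a at h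
    generalize hb : (Sum.inr ⟨w', y'⟩ : D.O₁ ⊕ (Σ _ : List (Fin d), D.Block)) = b at h
    cases h with
    | root z => simp at hb
    | child v i z =>
      simp only [Sum.inr.injEq, Sigma.mk.injEq, heq_eq_eq] at ha hb
      obtain ⟨rfl, rfl⟩ := hb
      exact Or.inr (Or.inr ⟨i, z, ha.1, rfl, ha.2⟩)

theorem inO_eq_inB {w : List (Fin d)} {x : D.O₁} {y : D.Block} (h : D.inO x = D.inB w y) :
    w = [] ∧ ∃ z, y = D.circle 0 z := by
  rcases mk_eq_mk h with h | h | h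
  · simp at h
  · generalize ha : (Sum.inl x : D.O₁ ⊕ (Σ _ : List (Fin d), D.Block)) = a at h
    generalize hb : (Sum.inr ⟨w, y⟩ : D.O₁ ⊕ (Σ _ : List (Fin d), D.Block)) = b at h
    cases h with
    | root z =>
      simp only [Sum.inr.injEq, Sigma.mk.injEq, heq_eq_eq] at hb
      exact ⟨hb.1, z, hb.2⟩
    | child v i z => simp at ha
  · generalize ha : (Sum.inl x : D.O₁ ⊕ (Σ _ : List (Fin d), D.Block)) = a at h
    generalize hb : (Sum.inr ⟨w, y⟩ : D.O₁ ⊕ (Σ _ : List (Fin d), D.Block)) = b at h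
    cases h with
    | root z => simp at ha
    | child v i z => simp at ha

/-- The base point is on no boundary circle, so no gluing identifies it with another point. It
serves as a marker from which the index of a block, and the index set of a union of blocks, can be
read off. -/
theorem inB_basePoint_mem_block {w w' : List (Fin d)} (h : D.inB w D.basePoint ∈ D.block w') :
    w' = w := by
  obtain ⟨y, hy⟩ := h
  rcases inB_eq_inB hy with h | ⟨i, z, -, -, h⟩ | ⟨i, z, -, h, -⟩
  · exact h.1
  · exact (D.basePoint_ne_circle _ _ h).elim
  · exact (D.basePoint_ne_circle _ _ h).elim

theorem inB_basePoint_not_mem_range_inO (w : List (Fin d)) :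
    D.inB w D.basePoint ∉ Set.range D.inO := by
  rintro ⟨x, hx⟩
  obtain ⟨-, z, h⟩ := inO_eq_inB hx
  exact D.basePoint_ne_circle _ _ h

theorem inB_mem_block (w : List (Fin d)) (y : D.Block) : D.inB w y ∈ D.block w := ⟨y, rfl⟩

/-! ### Unions of pieces and maps defined on pieces. -/

variable (D)

/-- The union of `O₁` and the blocks of a set of words. -/
def union (S : Set (List (Fin d))) : Set D.Surface := Set.range D.inO ∪ ⋃ w ∈ S, D.block w

variable {D}

theorem inB_basePoint_mem_union {S : Set (List (Fin d))} {w : List (Fin d)} :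
    D.inB w D.basePoint ∈ D.union S ↔ w ∈ S := by
  constructor
  · rintro (h | h)
    · exact (inB_basePoint_not_mem_range_inO w h).elim
    · simp only [Set.mem_iUnion] at h
      obtain ⟨_, hw', h⟩ := h
      rwa [← inB_basePoint_mem_block h]
  · intro h
    exact Or.inr (Set.mem_biUnion h (inB_mem_block _ _))

theorem block_subset_union {S : Set (List (Fin d))} {w : List (Fin d)} :
    D.block w ⊆ D.union S ↔ w ∈ S := by
  constructor
  · intro h
    exact inB_basePoint_mem_union.1 (h (inB_mem_block _ _))
  · intro h
    exact Set.subset_union_of_subset_right (Set.subset_biUnion_of_mem (u := D.block) h) _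

theorem IsSuited.exists_eq_union {Z : Set D.Surface} (h : D.IsSuited Z) :
    ∃ S : Finset (List (Fin d)), Z = D.union S := by
  obtain ⟨-, S, hS⟩ := h
  exact ⟨S, by simpa [union] using hS⟩

theorem isSuited_union {S : Set (List (Fin d))} (hS : S.Finite) (h : IsConnected (D.union S)) :
    D.IsSuited (D.union S) := by
  refine ⟨h, hS.toFinset, by simp [union]⟩

theorem surface_induction {p : D.Surface → Prop} (hO : ∀ x, p (D.inO x))
    (hB : ∀ w y, p (D.inB w y)) (x : D.Surface) : p x := by
  induction x using Quot.ind with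
  | _ x =>
    rcases x with x | ⟨w, y⟩
    · exact hO x
    · exact hB w y

variable (D)

theorem continuous_inO : Continuous D.inO := continuous_quot_mk.comp continuous_inl

theorem continuous_inB (w : List (Fin d)) : Continuous (D.inB w) :=
  continuous_quot_mk.comp (continuous_inr.comp continuous_sigmaMk)

variable {D} {X : Type*}

/-- A map out of the Cantor surface, given on the pieces. -/
def lift (a : D.O₁ → X) (b : List (Fin d) → D.Block → X)
    (hr : ∀ z, a (D.rootCircle (D.glueRoot z)) = b [] (D.circle 0 z))
    (hc : ∀ w i z, b w (D.μ i z) = b (i :: w) (D.circle 0 z)) : D.Surface → X :=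
  Quot.lift (Sum.elim a fun p => b p.1 p.2) (by
    rintro _ _ (z | ⟨w, i, z⟩)
    · exact hr z
    · exact hc w i z)

theorem continuous_iff_pieces [TopologicalSpace X] {f : D.Surface → X} :
    Continuous f ↔ Continuous (fun x => f (D.inO x)) ∧ ∀ w, Continuous fun y => f (D.inB w y) := by
  constructor
  · intro h
    exact ⟨h.comp D.continuous_inO, fun w => h.comp (D.continuous_inB w)⟩
  · rintro ⟨h1, h2⟩
    refine isQuotientMap_quot_mk.continuous_iff.2 (continuous_sum_dom.2 ⟨h1, ?_⟩)
    exact continuous_sigma_iff.2 h2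

/-- A self-homeomorphism of the Cantor surface that is the identity on `O₁`, given on the blocks
together with its inverse. -/
def homeoOfBlocks (b c : List (Fin d) → D.Block → D.Surface)
    (hb : ∀ w, Continuous (b w)) (hc : ∀ w, Continuous (c w))
    (hbr : ∀ z, D.inB [] (D.circle 0 z) = b [] (D.circle 0 z))
    (hbc : ∀ w i z, b w (D.μ i z) = b (i :: w) (D.circle 0 z))
    (hcr : ∀ z, D.inB [] (D.circle 0 z) = c [] (D.circle 0 z))
    (hcc : ∀ w i z, c w (D.μ i z) = c (i :: w) (D.circle 0 z))
    (hcb : ∀ w y, lift D.inO c (fun z => (D.inO_rootCircle z).trans (hcr z)) hcc (b w y)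
      = D.inB w y)
    (hbc' : ∀ w y, lift D.inO b (fun z => (D.inO_rootCircle z).trans (hbr z)) hbc (c w y)
      = D.inB w y) : D.Surface ≃ₜ D.Surface where
  toFun := lift D.inO b (fun z => (D.inO_rootCircle z).trans (hbr z)) hbc
  invFun := lift D.inO c (fun z => (D.inO_rootCircle z).trans (hcr z)) hcc
  left_inv := surface_induction (fun _ => rfl) hcb
  right_inv := surface_induction (fun _ => rfl) hbc'
  continuous_toFun := continuous_iff_pieces.2 ⟨D.continuous_inO, hb⟩
  continuous_invFun := continuous_iff_pieces.2 ⟨D.continuous_inO, hc⟩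

end Datum

namespace Datum

variable {d : ℕ} {O Y : Type*} [TopologicalSpace O] [TopologicalSpace Y] (D : Datum d O Y)

/-! ### Homeomorphisms acting blockwise -/

/-- The permutation of the lower boundary circles induced by a homeomorphism of the block. -/
def permHom : D.homeoBlock →* Equiv.Perm (Fin d) :=
  -- The permutation is taken by choice, but disjointness of the circles makes it unique; this gives
  -- multiplicativity.
  have key : ∀ k : D.homeoBlock, ∀ z, ∀ i, k.1 (D.μ i z) = D.μ (k.2.2.choose i) z :=
    fun k z i => k.2.2.choose_spec i z
  { toFun := fun k => k.2.2.choose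
    map_one' := by
      ext i
      exact congrArg Fin.val (D.μ_inj (key 1 1 i)).1.symm
    map_mul' := by
      intro k l
      ext i
      have h := key (k * l) 1 i
      change k.1 (l.1 _) = _ at h
      rw [key l, key k] at h
      exact congrArg Fin.val (D.μ_inj h).1.symm }

variable {D}

theorem homeoBlock_circle_zero (k : D.homeoBlock) (z : Circle) :
    k.1 (D.circle 0 z) = D.circle 0 z := k.2.1 z

theorem homeoBlock_μ (k : D.homeoBlock) (i : Fin d) (z : Circle) :
    k.1 (D.μ i z) = D.μ (D.permHom k i) z := k.2.2.choose_spec i z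

theorem permHom_apply_eq {k : D.homeoBlock} {i j : Fin d} {z z' : Circle}
    (h : k.1 (D.μ i z) = D.μ j z') : D.permHom k i = j := by
  rw [homeoBlock_μ] at h
  exact (D.μ_inj h).1

variable (D) in
theorem circle_mem_blockBoundary (i : Fin (d + 1)) (z : Circle) :
    D.circle i z ∈ D.blockBoundary := ⟨i, z, rfl⟩

theorem mem_homeoBlock_of_fixes {g : D.Block ≃ₜ D.Block} (h : ∀ x ∈ D.blockBoundary, g x = x) :
    g ∈ D.homeoBlock :=
  ⟨fun z => h _ (D.circle_mem_blockBoundary _ _), 1,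
    fun _ _ => h _ (D.circle_mem_blockBoundary _ _)⟩

theorem permHom_eq_one_of_fixes {k : D.homeoBlock} (h : ∀ x ∈ D.blockBoundary, k.1 x = x) :
    D.permHom k = 1 :=
  Equiv.ext fun i => permHom_apply_eq (z := 1) (h _ (D.circle_mem_blockBoundary _ _))

theorem IsotopicToId.fixes {X : Type*} [TopologicalSpace X] {A : Set X} {g : X ≃ₜ X}
    (h : IsotopicToId A g) : ∀ x ∈ A, g x = x := by
  obtain ⟨F, -, -, rfl, h⟩ := h
  exact h 1

/-- The action on words of a family of homeomorphisms of the block. -/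
def act (κ : List (Fin d) → D.homeoBlock) : List (Fin d) → List (Fin d)
  | [] => []
  | i :: w => D.permHom (κ w) i :: act κ w

/-- The inverse of the action on words of a family of homeomorphisms of the block. -/
def actInv (κ : List (Fin d) → D.homeoBlock) : List (Fin d) → List (Fin d)
  | [] => []
  | i :: w => (D.permHom (κ (actInv κ w)))⁻¹ i :: actInv κ w

theorem actInv_act (κ : List (Fin d) → D.homeoBlock) (w : List (Fin d)) :
    actInv κ (act κ w) = w := by
  induction w with
  | nil => rfl
  | cons i w ih => simp [act, actInv, ih]

theorem act_actInv (κ : List (Fin d) → D.homeoBlock) (w : List (Fin d)) :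
    act κ (actInv κ w) = w := by
  induction w with
  | nil => rfl
  | cons i w ih => simp [act, actInv, ih]

theorem act_one {κ : List (Fin d) → D.homeoBlock} (h : ∀ w, D.permHom (κ w) = 1)
    (w : List (Fin d)) : act κ w = w := by
  induction w with
  | nil => rfl
  | cons i w ih => simp [act, ih, h]

/-- Cocycle rule: after `κ'` has moved the blocks, `κ` must be read at the moved word. -/
theorem act_mul (κ κ' : List (Fin d) → D.homeoBlock) (w : List (Fin d)) :
    act (fun v => κ (act κ' v) * κ' v) w = act κ (act κ' w) := by
  induction w with
  | nil => rfl
  | cons i w ih => simp [act, ih]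

theorem length_act (κ : List (Fin d) → D.homeoBlock) (w : List (Fin d)) :
    (act κ w).length = w.length := by
  induction w with
  | nil => rfl
  | cons i w ih => simp [act, ih]

/-- The homeomorphism of the Cantor surface that acts on the block of the word `w` by `κ w`. -/
def portrait (κ : List (Fin d) → D.homeoBlock) : D.Surface ≃ₜ D.Surface :=
  homeoOfBlocks (fun w y => D.inB (act κ w) ((κ w).1 y))
    (fun w y => D.inB (actInv κ w) ((κ (actInv κ w)).1.symm y))
    (fun w => (D.continuous_inB _).comp (κ w).1.continuous)
    (fun w => (D.continuous_inB _).comp (κ (actInv κ w)).1.symm.continuous)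
    (fun z => by rw [homeoBlock_circle_zero]; rfl)
    (fun w i z => by rw [homeoBlock_circle_zero, homeoBlock_μ, inB_μ]; rfl)
    (fun z => by
      rw [(Homeomorph.symm_apply_eq _).2 (homeoBlock_circle_zero _ z).symm]; rfl)
    (fun w i z => by
      rw [(Homeomorph.symm_apply_eq _).2 (homeoBlock_circle_zero _ z).symm]
      have : (κ (actInv κ w)).1.symm (D.μ i z)
          = D.μ ((D.permHom (κ (actInv κ w)))⁻¹ i) z := by
        rw [Homeomorph.symm_apply_eq, homeoBlock_μ]
        simp
      rw [this, inB_μ]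
      rfl)
    (fun w y => by
      change D.inB (actInv κ (act κ w)) ((κ (actInv κ (act κ w))).1.symm ((κ w).1 y)) = _
      rw [actInv_act, Homeomorph.symm_apply_apply])
    (fun w y => by
      change D.inB (act κ (actInv κ w)) ((κ (actInv κ w)).1 ((κ (actInv κ w)).1.symm y)) = _
      rw [act_actInv, Homeomorph.apply_symm_apply])

@[simp] theorem portrait_inO (κ : List (Fin d) → D.homeoBlock) (x : D.O₁) :
    portrait κ (D.inO x) = D.inO x := rfl

@[simp] theorem portrait_inB (κ : List (Fin d) → D.homeoBlock) (w : List (Fin d)) (y : D.Block) :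
    portrait κ (D.inB w y) = D.inB (act κ w) ((κ w).1 y) := rfl

theorem portrait_mul (κ κ' : List (Fin d) → D.homeoBlock) :
    portrait (fun v => κ (act κ' v) * κ' v) = portrait κ * portrait κ' := by
  ext x
  induction x using surface_induction with
  | hO x => rfl
  | hB w y =>
    change D.inB _ _ = D.inB _ _
    rw [act_mul]
    rfl

/-- Each stage of the given isotopies fixes the boundary of the block, hence induces the trivial
permutation. All blocks stay in place, and the infinitely many isotopies run simultaneously. -/
theorem isotopicToId_portrait {A : Set D.Surface} (hA : A ⊆ Set.range D.inO)
    {κ : List (Fin d) → D.homeoBlock} (h : ∀ w, (κ w).1 ∈ isotopyTrivial D.blockBoundary) :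
    IsotopicToId A (portrait κ) := by
  choose F hF hF0 hF1 hFA using h
  let k : unitInterval → List (Fin d) → D.homeoBlock :=
    fun t w => ⟨F w t, mem_homeoBlock_of_fixes (hFA w t)⟩
  have hk : ∀ t w, act (k t) w = w := fun t w =>
    act_one (fun w => permHom_eq_one_of_fixes (k := k t w) (hFA w t)) w
  have hB : ∀ t w y, portrait (k t) (D.inB w y) = D.inB w (F w t y) := fun t w y => by
    rw [portrait_inB, hk]
  have hc : ∀ x, Continuous fun t => portrait (k t) x := by
    intro x
    induction x using surface_induction with
    | hO x => exact continuous_const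
    | hB w y =>
      simp only [hB]
      exact (D.continuous_inB w).comp ((hF w).comp (Continuous.prodMk_left y))
  -- The quotient topology tests maps out of the surface, not out of its product with the interval.
  -- So each point is sent to its track, continuity into the path space is checked on the pieces,
  -- and the result is uncurried.
  let G : D.Surface → C(unitInterval, D.Surface) := fun x => ⟨fun t => portrait (k t) x, hc x⟩
  have hG : Continuous G := by
    refine continuous_iff_pieces.2 ⟨?_, fun w => ?_⟩
    · exact ContinuousMap.continuous_of_continuous_uncurry _
        (D.continuous_inO.comp continuous_fst)
    · refine ContinuousMap.continuous_of_continuous_uncurry _ ?_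
      have : Continuous fun p : D.Block × unitInterval => D.inB w (F w p.2 p.1) :=
        (D.continuous_inB w).comp ((hF w).comp (continuous_snd.prodMk continuous_fst))
      exact this.congr fun p => (hB p.2 w p.1).symm
  refine ⟨fun t => portrait (k t), ?_, ?_, ?_, ?_⟩
  · have h1 := ContinuousMap.continuous_uncurry_of_continuous ⟨G, hG⟩
    exact h1.comp (continuous_snd.prodMk continuous_fst)
  · ext x
    induction x using surface_induction with
    | hO x => rfl
    | hB w y => rw [hB, hF0]; rfl
  · ext x
    induction x using surface_induction with
    | hO x => rfl
    | hB w y =>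
      rw [hB, hF1, portrait_inB, act_one]
      intro w
      refine permHom_eq_one_of_fixes fun x hx => ?_
      rw [← hF1]
      exact hFA w 1 x hx
  · intro t x hx
    obtain ⟨x, rfl⟩ := hA hx
    rfl

theorem permHom_eq_of_mk_eq {k l : D.homeoBlock}
    (h : (QuotientGroup.mk k : D.BlockMap) = QuotientGroup.mk l) : D.permHom k = D.permHom l := by
  rw [QuotientGroup.eq, Subgroup.mem_subgroupOf] at h
  have := permHom_eq_one_of_fixes (k := k⁻¹ * l) (IsotopicToId.fixes h)
  rw [map_mul, map_inv, inv_mul_eq_one] at this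
  exact this

variable [ChartedSpace (EuclideanHalfSpace 2) O]

theorem boundary_subset_range_inO : D.boundary ⊆ Set.range D.inO := by
  rintro _ ⟨x, -, rfl⟩
  exact ⟨x, rfl⟩

variable (D) in
/-- Homeomorphisms that are the identity on `O₁` fix the boundary. -/
def surfaceHomeo (f : D.Surface ≃ₜ D.Surface) (hf : ∀ x, f (D.inO x) = D.inO x) :
    D.homeoSurface :=
  ⟨f, fun x hx => by obtain ⟨x, rfl⟩ := boundary_subset_range_inO hx; exact hf x⟩

/-- The mapping class of a homeomorphism that acts blockwise. -/
def portraitClass (κ : List (Fin d) → D.homeoBlock) : D.SurfaceMap :=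
  QuotientGroup.mk (D.surfaceHomeo (portrait κ) fun _ => rfl)

/-- Equal classes induce equal permutations, so the two portraits move blocks alike and differ by a
portrait with isotopically trivial values. Representatives may thus be changed on all blocks at
once. -/
theorem portraitClass_congr {κ κ' : List (Fin d) → D.homeoBlock}
    (h : ∀ w, (QuotientGroup.mk (κ w) : D.BlockMap) = QuotientGroup.mk (κ' w)) :
    portraitClass κ = portraitClass κ' := by
  refine QuotientGroup.eq.2 ?_
  rw [Subgroup.mem_subgroupOf]
  have h1 : portrait κ' = portrait κ * portrait (fun w => (κ w)⁻¹ * κ' w) := by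
    rw [← portrait_mul]
    congr 1
    funext w
    rw [act_one]
    · simp
    · intro w
      rw [map_mul, map_inv, permHom_eq_of_mk_eq (h w), inv_mul_cancel]
  change (portrait κ)⁻¹ * portrait κ' ∈ _
  rw [h1, inv_mul_cancel_left]
  refine isotopicToId_portrait boundary_subset_range_inO fun w => ?_
  have := QuotientGroup.eq.1 (h w)
  rwa [Subgroup.mem_subgroupOf] at this

end Datum
/-! ### Connectedness -/

/-- Removing from a connected set a subset that has a neighbourhood in which its complement is
connected leaves a connected set. -/
theorem isPreconnected_diff {X : Type*} [TopologicalSpace X] {S B C N : Set X}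
    (hS : IsPreconnected S) (hBC : B ⊆ C) (hCN : C ⊆ N) (hNS : N ⊆ S) (hC : IsClosed C)
    (hN : IsOpen N) (hNB : IsPreconnected (N \ B)) : IsPreconnected (S \ B) := by
  -- If the collar `N \ B` lies on the side `u`, a separation of `S \ B` by `u` and `v` extends to
  -- one of `S` by `u ∪ N` and `v \ C`.
  have key : ∀ u v : Set X, IsOpen u → IsOpen v → S \ B ⊆ u ∪ v → S \ B ∩ (u ∩ v) = ∅ →
      N \ B ⊆ u → S \ B ⊆ u ∨ S \ B ⊆ v := by
    intro u v hu hv huv hdis hNu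
    have h1 : S ⊆ (u ∪ N) ∪ (v \ C) := by
      intro x hx
      by_cases hxN : x ∈ N
      · exact Or.inl (Or.inr hxN)
      · rcases huv ⟨hx, fun h => hxN (hCN (hBC h))⟩ with h | h
        · exact Or.inl (Or.inl h)
        · exact Or.inr ⟨h, fun h => hxN (hCN h)⟩
    have h2 : S ∩ ((u ∪ N) ∩ (v \ C)) = ∅ := by
      rw [Set.eq_empty_iff_forall_notMem] at hdis ⊢
      rintro x ⟨hx, hx1, hx2, hx3⟩
      have hxB : x ∉ B := fun h => hx3 (hBC h)
      rcases hx1 with h | h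
      · exact hdis x ⟨⟨hx, hxB⟩, h, hx2⟩
      · exact hdis x ⟨⟨hx, hxB⟩, hNu ⟨h, hxB⟩, hx2⟩
    rcases isPreconnected_iff_subset_of_disjoint.1 hS _ _ (hu.union hN) (hv.sdiff hC) h1 h2
      with h | h
    · left
      rintro x ⟨hx, hxB⟩
      rcases h hx with h | h
      · exact h
      · exact hNu ⟨h, hxB⟩
    · right
      rintro x ⟨hx, -⟩
      exact (h hx).1
  rw [isPreconnected_iff_subset_of_disjoint]
  intro u v hu hv huv hdis
  have hsub : N \ B ⊆ S \ B := Set.sdiff_subset_sdiff_left hNS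
  rcases isPreconnected_iff_subset_of_disjoint.1 hNB u v hu hv (hsub.trans huv)
    (Set.subset_empty_iff.1 (hdis ▸ Set.inter_subset_inter_left _ hsub)) with h | h
  · exact key u v hu hv huv hdis h
  · rw [Set.union_comm] at huv
    rw [Set.inter_comm u] at hdis
    exact (key v u hv hu huv hdis h).symm

theorem isPreconnected_annulus (c : ℂ) {r R : ℝ} (hr : 0 < r) :
    IsPreconnected (Metric.ball c R \ Metric.ball c r) := by
  have h : Metric.ball c R \ Metric.ball c r
      = (fun p : ℝ × ℝ => c + p.1 * Complex.exp (p.2 * Complex.I)) '' (Set.Ico r R ×ˢ Set.univ) := by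
    ext z
    simp only [Set.mem_sdiff, Metric.mem_ball, dist_eq_norm, not_lt, Set.mem_image, Set.mem_prod,
      Set.mem_Ico, Set.mem_univ, and_true, Prod.exists]
    constructor
    · rintro ⟨h1, h2⟩
      exact ⟨‖z - c‖, Complex.arg (z - c), ⟨h2, h1⟩, by
        rw [Complex.norm_mul_exp_arg_mul_I]; ring⟩
    · rintro ⟨ρ, t, ⟨h1, h2⟩, rfl⟩
      rw [add_sub_cancel_left, norm_mul, Complex.norm_exp_ofReal_mul_I, mul_one,
        Complex.norm_real, Real.norm_of_nonneg (hr.le.trans h1)]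
      exact ⟨h2, h1⟩
  rw [h]
  refine IsPreconnected.image (isPreconnected_Ico.prod isPreconnected_univ) _ ?_
  exact Continuous.continuousOn (by fun_prop)

/-- Removing a disc in a chart from a connected set leaves a connected set. -/
theorem isPreconnected_diff_chart {X : Type*} [TopologicalSpace X] [T2Space X] {e : ℂ → X}
    (he : Topology.IsOpenEmbedding e) {S : Set X} (hS : IsPreconnected S) (c : ℂ) {r R : ℝ}
    (hr : 0 < r) (hR : r < R) (hN : e '' Metric.ball c R ⊆ S) :
    IsPreconnected (S \ e '' Metric.ball c r) := by
  refine isPreconnected_diff hS (C := e '' Metric.closedBall c r) (N := e '' Metric.ball c R)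
    (Set.image_mono Metric.ball_subset_closedBall)
    (Set.image_mono (Metric.closedBall_subset_ball hR)) hN
    ((isCompact_closedBall c r).image he.continuous).isClosed
    (he.isOpenMap _ Metric.isOpen_ball) ?_
  rw [← Set.image_sdiff he.injective]
  exact (isPreconnected_annulus c hr).image _ he.continuous.continuousOn

namespace Datum

variable {d : ℕ} {O Y : Type*} [TopologicalSpace O] [TopologicalSpace Y] (D : Datum d O Y)

theorem isPreconnected_O₁ [T2Space O] [PreconnectedSpace O] : IsPreconnected D.O₁ := by
  have h := isPreconnected_diff_chart D.isOpenEmbedding_chartO isPreconnected_univ 0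
    (r := 1) (R := 2) one_pos one_lt_two (Set.subset_univ _)
  rwa [← Set.compl_eq_univ_sdiff] at h

theorem isPreconnected_Block [T2Space Y] [PreconnectedSpace Y] : IsPreconnected D.Block := by
  have key : ∀ n : ℕ, IsPreconnected
      {y | ∀ i < n, y ∉ D.chartY '' Metric.ball (i : ℂ) (1 / 4)} := by
    intro n
    induction n with
    | zero => simpa using isPreconnected_univ
    | succ n ih =>
      -- Centres are at distance at least 1, so the disc of radius 1/2 about `n` misses the discs of
      -- radius 1/4 already removed.
      have h := isPreconnected_diff_chart D.isOpenEmbedding_chartY ih n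
        (r := 1 / 4) (R := 1 / 2) (by norm_num) (by norm_num) (by
          rintro _ ⟨z, hz, rfl⟩ i hi ⟨u, hu, huz⟩
          rw [D.isOpenEmbedding_chartY.injective huz] at hu
          have h1 := one_le_norm_natCast_sub hi.ne
          rw [Metric.mem_ball] at hz hu
          rw [← dist_eq_norm] at h1
          have := dist_triangle_left (i : ℂ) n z
          linarith)
      convert h using 1
      ext y
      simp only [Set.mem_ofPred_eq, Set.mem_sdiff]
      constructor
      · intro h
        exact ⟨fun i hi => h i (hi.trans n.lt_succ_self), h n n.lt_succ_self⟩
      · rintro ⟨h1, h2⟩ i hi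
        rcases (Nat.lt_succ_iff_lt_or_eq.1 hi) with h | h
        · exact h1 i h
        · exact h ▸ h2
  convert key (d + 1) using 1
  ext y
  exact ⟨fun h i hi => h ⟨i, hi⟩, fun h i => h i i.2⟩

theorem nonempty_O₁ : Nonempty D.O₁ := ⟨D.rootCircle 1⟩

theorem isPreconnected_range_inO [T2Space O] [PreconnectedSpace O] :
    IsPreconnected (Set.range D.inO) := by
  have := isPreconnected_iff_preconnectedSpace.1 D.isPreconnected_O₁
  exact isPreconnected_range D.continuous_inO

theorem isPreconnected_block [T2Space Y] [PreconnectedSpace Y] (w : List (Fin d)) :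
    IsPreconnected (D.block w) := by
  have := isPreconnected_iff_preconnectedSpace.1 D.isPreconnected_Block
  exact isPreconnected_range (D.continuous_inB w)

variable {D}

theorem union_union (S T : Set (List (Fin d))) : D.union (S ∪ T) = D.union S ∪ D.union T := by
  simp only [union, Set.biUnion_union]
  rw [Set.union_union_distrib_left]

theorem union_mono {S T : Set (List (Fin d))} (h : S ⊆ T) : D.union S ⊆ D.union T := by
  rw [← Set.union_eq_self_of_subset_left h, union_union]
  exact Set.subset_union_left

theorem union_singleton (w : List (Fin d)) : D.union {w} = Set.range D.inO ∪ D.block w := by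
  simp [union]

theorem union_insert (w : List (Fin d)) (S : Set (List (Fin d))) :
    D.union (insert w S) = D.union S ∪ D.block w := by
  simp only [union, Set.biUnion_insert]
  rw [Set.union_comm (D.block w), Set.union_assoc]

/-- The suffixes of a word index a chain of blocks leading to `O₁`, with consecutive members meeting
in a gluing circle. The hypothesis keeps the chain of each word of `S` inside `S`. -/
theorem isConnected_union [T2Space O] [PreconnectedSpace O] [T2Space Y] [PreconnectedSpace Y]
    {S : Set (List (Fin d))} (hS : ∀ i w, i :: w ∈ S → w ∈ S) : IsConnected (D.union S) := by
  have h1 : ∀ w, IsPreconnected (D.union {v | v <:+ w}) := by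
    intro w
    induction w with
    | nil =>
      have : {v : List (Fin d) | v <:+ []} = {[]} := by ext; simp
      rw [this, union_singleton]
      exact D.isPreconnected_range_inO.union (D.inB [] (D.circle 0 1))
        ⟨_, D.inO_rootCircle 1⟩ ⟨_, rfl⟩ (D.isPreconnected_block _)
    | cons i w ih =>
      have : {v : List (Fin d) | v <:+ i :: w} = insert (i :: w) {v | v <:+ w} := by
        ext; simp [List.suffix_cons_iff]
      rw [this, union_insert]
      refine ih.union (D.inB w (D.μ i 1)) ?_ ⟨_, (D.inB_μ w i 1).symm⟩ (D.isPreconnected_block _)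
      exact block_subset_union.2 (List.suffix_refl w) ⟨_, rfl⟩
  have hS' : ∀ w ∈ S, ∀ v, v <:+ w → v ∈ S := by
    rintro w hw v ⟨u, rfl⟩
    induction u with
    | nil => exact hw
    | cons i u ih => exact ih (hS _ _ hw)
  obtain ⟨x⟩ := D.nonempty_O₁
  refine ⟨⟨D.inO x, Or.inl ⟨x, rfl⟩⟩, isPreconnected_of_forall (D.inO x) ?_⟩
  rintro y (hy | hy)
  · exact ⟨_, Set.subset_union_left, ⟨x, rfl⟩, hy, D.isPreconnected_range_inO⟩
  · simp only [Set.mem_iUnion] at hy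
    obtain ⟨w, hw, hy⟩ := hy
    exact ⟨_, union_mono (hS' w hw), Or.inl ⟨x, rfl⟩,
      block_subset_union.2 (List.suffix_refl w) hy, h1 w⟩

/-! ### Exhaustion by levels. -/

variable (D) in
/-- The union of `O₁` and the blocks of level less than `n`. -/
def ball (n : ℕ) : Set D.Surface := D.union {w | w.length < n}

theorem block_subset_ball {n : ℕ} {w : List (Fin d)} : D.block w ⊆ D.ball n ↔ w.length < n :=
  block_subset_union

theorem isSuited_ball [T2Space O] [PreconnectedSpace O] [T2Space Y] [PreconnectedSpace Y]
    (n : ℕ) : D.IsSuited (D.ball n) :=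
  isSuited_union (List.finite_length_lt _ n) (isConnected_union fun _ _ h =>
    lt_trans (Nat.lt_succ_self _) h)

theorem O₂_eq_ball : D.O₂ = D.ball 1 := by
  have : {w : List (Fin d) | w.length < 1} = {[]} := by ext; simp
  rw [ball, this, union_singleton]
  rfl

theorem IsSuited.exists_subset_ball {Z : Set D.Surface} (h : D.IsSuited Z) :
    ∃ n, ∀ m, n ≤ m → Z ⊆ D.ball m := by
  obtain ⟨S, rfl⟩ := h.exists_eq_union
  refine ⟨S.sup List.length + 1, fun m hm => union_mono fun w hw => ?_⟩
  exact lt_of_lt_of_le (Nat.lt_succ_of_le (Finset.le_sup (f := List.length) hw)) hm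

theorem isSuitedBoundary_ball {n : ℕ} {v : List (Fin d)} :
    D.IsSuitedBoundary (D.ball n) v ↔ v.length = n := by
  cases v with
  | nil =>
    simp only [IsSuitedBoundary, block_subset_ball, List.length_nil]
    omega
  | cons i u =>
    simp only [IsSuitedBoundary, block_subset_ball, List.length_cons]
    omega

end Datum

namespace Datum

variable {d : ℕ} {O Y : Type*} [TopologicalSpace O] [TopologicalSpace Y] {D : Datum d O Y}

/-! ### The group of block homeomorphisms -/

/-- The circle between a block and its child is mapped both to a lower circle of the parent's target
and to the top circle of the child's target. Only one block is glued to that lower circle. -/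
theorem child_target {f : D.Surface ≃ₜ D.Surface} {w w' w'' : List (Fin d)} {i : Fin d}
    {k k' : D.homeoBlock} (h : ∀ y, f (D.inB w y) = D.inB w' (k.1 y))
    (h' : ∀ y, f (D.inB (i :: w) y) = D.inB w'' (k'.1 y)) : w'' = D.permHom k i :: w' := by
  have h1 : D.inB w' (D.μ (D.permHom k i) 1) = D.inB w'' (D.circle 0 1) := by
    rw [← homeoBlock_μ, ← h, ← homeoBlock_circle_zero k', ← h', inB_μ]
  rcases inB_eq_inB h1 with ⟨-, h2⟩ | ⟨j, z, rfl, h2, -⟩ | ⟨j, z, -, h2, -⟩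
  · exact (D.μ_ne_circle_zero _ _ _ h2).elim
  · rw [(D.μ_inj h2).1]
  · exact (D.μ_ne_circle_zero _ _ _ h2.symm).elim

variable (D) in
/-- The permutation of the lower boundary circles induced by a mapping class of the block. -/
def labelPerm : D.BlockMap →* Equiv.Perm (Fin d) :=
  QuotientGroup.lift _ D.permHom fun k hk =>
    permHom_eq_one_of_fixes (IsotopicToId.fixes (Subgroup.mem_subgroupOf.1 hk))

@[simp] theorem labelPerm_mk (k : D.homeoBlock) :
    D.labelPerm (QuotientGroup.mk k) = D.permHom k := rfl

/-- `f` sends the subtree of blocks below the top of `v` to that below the top of `v'`, and acts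
on each of its blocks like `h`. -/
def ActsOnSubtree (f : D.Surface ≃ₜ D.Surface) (v v' : List (Fin d)) (h : D.BlockMap) : Prop :=
  ∀ u : List (Fin d), ∃ k : D.homeoBlock, (QuotientGroup.mk k : D.BlockMap) = h ∧
    ∀ y, f (D.inB (u ++ v) y) = D.inB (u.map (D.labelPerm h) ++ v') (k.1 y)

theorem ActsOnSubtree.actsLike {f : D.Surface ≃ₜ D.Surface} {v v' : List (Fin d)}
    {h : D.BlockMap} (hf : ActsOnSubtree f v v' h) {w : List (Fin d)} (hw : v <:+ w) :
    D.ActsLike f w h := by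
  obtain ⟨u, rfl⟩ := hw
  obtain ⟨k, hk, hk'⟩ := hf u
  exact ⟨_, k, hk, hk'⟩

/-- Representatives may vary from block to block, but the permutation depends only on the label, so
`child_target` propagates the target of `v` to all its descendants. -/
theorem exists_actsOnSubtree {f : D.Surface ≃ₜ D.Surface} {v : List (Fin d)} {h : D.BlockMap}
    (hf : ∀ w, v <:+ w → D.ActsLike f w h) : ∃ v', ActsOnSubtree f v v' h := by
  obtain ⟨v', k, hk, hkf⟩ := hf v (List.suffix_refl v)
  refine ⟨v', fun u => ?_⟩
  induction u with
  | nil => exact ⟨k, hk, hkf⟩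
  | cons i u ih =>
    obtain ⟨k', rfl, hkf'⟩ := ih
    obtain ⟨w'', k'', hk'', hkf''⟩ := hf (i :: (u ++ v)) ⟨i :: u, rfl⟩
    have h1 := child_target hkf' hkf''
    subst h1
    exact ⟨k'', hk'', hkf''⟩

theorem ActsOnSubtree.append {f : D.Surface ≃ₜ D.Surface} {v v' : List (Fin d)}
    {h : D.BlockMap} (hf : ActsOnSubtree f v v' h) (x : List (Fin d)) :
    ActsOnSubtree f (x ++ v) (x.map (D.labelPerm h) ++ v') h := by
  intro u
  obtain ⟨k, hk, hkf⟩ := hf (u ++ x)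
  refine ⟨k, hk, ?_⟩
  simpa using hkf

theorem ActsOnSubtree.mul {f g : D.Surface ≃ₜ D.Surface} {v v' v'' : List (Fin d)}
    {h h' : D.BlockMap} (hf : ActsOnSubtree f v' v'' h') (hg : ActsOnSubtree g v v' h) :
    ActsOnSubtree (f * g) v v'' (h' * h) := by
  intro u
  obtain ⟨k, rfl, hkg⟩ := hg u
  obtain ⟨k', rfl, hkf⟩ := hf (u.map (D.permHom k))
  refine ⟨k' * k, rfl, fun y => ?_⟩
  change f (g _) = _
  rw [hkg]
  simp only [labelPerm_mk]
  rw [hkf, map_mul]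
  simp only [labelPerm_mk, List.map_map]
  rfl

theorem ActsOnSubtree.inv {f : D.Surface ≃ₜ D.Surface} {v v' : List (Fin d)} {h : D.BlockMap}
    (hf : ActsOnSubtree f v v' h) : ActsOnSubtree f⁻¹ v' v h⁻¹ := by
  intro u
  obtain ⟨k, hk, hkf⟩ := hf (u.map (D.labelPerm h⁻¹))
  refine ⟨k⁻¹, by rw [← hk]; rfl, fun y => ?_⟩
  change f.symm _ = _
  rw [Homeomorph.symm_apply_eq, hkf]
  have h1 : k.1 ((k⁻¹).1 y) = y := k.1.apply_symm_apply y
  have h2 : (u.map (D.labelPerm h⁻¹)).map (D.labelPerm h) = u := by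
    rw [List.map_map]
    convert List.map_id u
    ext i
    simp
  rw [h1, h2]

theorem ActsOnSubtree.image_block {f : D.Surface ≃ₜ D.Surface} {v v' : List (Fin d)}
    {h : D.BlockMap} (hf : ActsOnSubtree f v v' h) : f '' D.block v = D.block v' := by
  obtain ⟨k, -, hkf⟩ := hf []
  ext x
  constructor
  · rintro ⟨_, ⟨y, rfl⟩, rfl⟩
    exact ⟨k.1 y, (hkf y).symm⟩
  · rintro ⟨y, rfl⟩
    refine ⟨D.inB v (k.1.symm y), ⟨_, rfl⟩, ?_⟩
    have := hkf (k.1.symm y)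
    rw [Homeomorph.apply_symm_apply] at this
    exact this

theorem ActsOnSubtree.of_eq {f : D.Surface ≃ₜ D.Surface} {v v' : List (Fin d)}
    (hf : ∀ u y, f (D.inB (u ++ v) y) = D.inB (u ++ v') y) : ActsOnSubtree f v v' 1 :=
  fun u => ⟨1, rfl, fun y => by
    rw [hf, map_one]
    simp⟩

theorem exists_isSuitedBoundary {Z : Set D.Surface} {w : List (Fin d)} (h : ¬ D.block w ⊆ Z) :
    ∃ v, v <:+ w ∧ D.IsSuitedBoundary Z v := by
  induction w with
  | nil => exact ⟨[], List.suffix_refl _, h⟩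
  | cons i u ih =>
    by_cases hu : D.block u ⊆ Z
    · exact ⟨i :: u, List.suffix_refl _, hu, h⟩
    · obtain ⟨v, hv, hv'⟩ := ih hu
      exact ⟨v, hv.trans (List.suffix_cons i u), hv'⟩

theorem IsSuitedBoundary.not_subset {Z : Set D.Surface} {v : List (Fin d)}
    (h : D.IsSuitedBoundary Z v) : ¬ D.block v ⊆ Z := by
  cases v with
  | nil => exact h
  | cons i u => exact h.2

/-- `f` is an `H`-block homeomorphism with defining surface `Z`. -/
structure IsBlockOn (H : Subgroup D.BlockMap) (f : D.Surface ≃ₜ D.Surface) (Z : Set D.Surface) :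
    Prop where
  suited : D.IsSuited Z
  suited_image : D.IsSuited (f '' Z)
  acts : ∀ v, ¬ D.block v ⊆ Z → ∃ v', ∃ h ∈ H, ActsOnSubtree f v v' h

/-- A label at a suited boundary component is inherited by every word below it. Asking for labels at
all words outside `Z` lets the defining surface change without tracking its boundary components. -/
theorem isHBlock_iff {H : Subgroup D.BlockMap} {f : D.Surface ≃ₜ D.Surface} :
    D.IsHBlock H f ↔ ∃ Z, IsBlockOn H f Z := by
  constructor
  · rintro ⟨Z, ℓ, ⟨⟨h1, h2, -⟩, h4⟩, hℓ⟩
    refine ⟨Z, h1, h2, fun w hw => ?_⟩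
    obtain ⟨v, ⟨x, rfl⟩, hv⟩ := exists_isSuitedBoundary hw
    obtain ⟨v', hv'⟩ := exists_actsOnSubtree (h4 v hv)
    exact ⟨_, _, hℓ v hv, hv'.append x⟩
  · rintro ⟨Z, h1, h2, h3⟩
    choose! t ℓ hℓ ht using h3
    refine ⟨Z, ℓ, ⟨⟨h1, h2, fun w hw => ⟨_, (ht w hw).image_block⟩⟩, fun v hv w hw => ?_⟩,
      fun v hv => hℓ v hv.not_subset⟩
    exact (ht v hv.not_subset).actsLike hw

/-- Only finitely many blocks are added, and each has a block as its image; connectedness of the new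
image comes from that of `Z'`. -/
theorem IsBlockOn.enlarge {H : Subgroup D.BlockMap} {f : D.Surface ≃ₜ D.Surface}
    {Z Z' : Set D.Surface} (h : IsBlockOn H f Z) (hZ' : D.IsSuited Z') (hZ : Z ⊆ Z') :
    IsBlockOn H f Z' := by
  refine ⟨hZ', ?_, fun v hv => h.acts v fun h' => hv (h'.trans hZ)⟩
  obtain ⟨S, hS⟩ := h.suited.exists_eq_union
  obtain ⟨S', rfl⟩ := hZ'.exists_eq_union
  obtain ⟨T, hT⟩ := h.suited_image.exists_eq_union
  have h1 := h.acts
  choose! t ℓ hℓ ht using h1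
  have h2 : D.union S' = Z ∪ ⋃ w ∈ {w | w ∈ S' ∧ ¬ D.block w ⊆ Z}, D.block w := by
    apply Set.Subset.antisymm
    · rintro x (hx | hx)
      · rw [hS]
        exact Or.inl (Or.inl hx)
      · simp only [Set.mem_iUnion] at hx
        obtain ⟨w, hw, hx⟩ := hx
        by_cases hwZ : D.block w ⊆ Z
        · exact Or.inl (hwZ hx)
        · exact Or.inr (Set.mem_biUnion (⟨hw, hwZ⟩ : w ∈ {w | w ∈ S' ∧ ¬ D.block w ⊆ Z}) hx)
    · refine Set.union_subset hZ (Set.iUnion₂_subset fun w hw => ?_)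
      exact block_subset_union.2 hw.1
  have h3 : f '' D.union S' = D.union (T ∪ t '' {w | w ∈ S' ∧ ¬ D.block w ⊆ Z}) := by
    rw [h2, Set.image_union, hT, Set.image_iUnion₂]
    have : (⋃ w, ⋃ (_ : w ∈ {w | w ∈ S' ∧ ¬ D.block w ⊆ Z}), f '' D.block w)
        = ⋃ w ∈ {w | w ∈ S' ∧ ¬ D.block w ⊆ Z}, D.block (t w) :=
      Set.iUnion₂_congr fun w hw => (ht w hw.2).image_block
    rw [this]
    simp only [union, Set.biUnion_union, Set.biUnion_image]
    rw [Set.union_assoc]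
  rw [h3]
  refine isSuited_union (T.finite_toSet.union
    (Set.Finite.image _ (S'.finite_toSet.subset fun w hw => hw.1))) ?_
  rw [← h3]
  exact hZ'.1.image _ f.continuous.continuousOn

theorem IsBlockOn.inv {H : Subgroup D.BlockMap} {f : D.Surface ≃ₜ D.Surface} {Z : Set D.Surface}
    (h : IsBlockOn H f Z) : IsBlockOn H f⁻¹ (f '' Z) := by
  have h0 : (f⁻¹ : D.Surface ≃ₜ D.Surface) '' (f '' Z) = Z := by
    rw [Set.image_image]
    convert Set.image_id Z with x
    exact f.symm_apply_apply x
  refine ⟨h.suited_image, by rw [h0]; exact h.suited, fun v' hv' => ?_⟩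
  obtain ⟨S, rfl⟩ := h.suited.exists_eq_union
  obtain ⟨T, hT⟩ := h.suited_image.exists_eq_union
  have h1 : D.inB v' D.basePoint ∉ f '' D.union S := by
    rw [hT, inB_basePoint_mem_union, ← block_subset_union (D := D), ← hT]
    exact hv'
  -- The preimage of the marker point of `v'` locates a block outside `Z`. Its image is a block
  -- containing this marker, hence the block of `v'`.
  have h2 : ∃ w, ¬ D.block w ⊆ D.union S ∧ f.symm (D.inB v' D.basePoint) ∈ D.block w := by
    have h3 : f.symm (D.inB v' D.basePoint) ∉ D.union S := fun h =>
      h1 ⟨_, h, f.apply_symm_apply _⟩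
    generalize f.symm (D.inB v' D.basePoint) = x at h3
    induction x using surface_induction with
    | hO x => exact (h3 (Or.inl ⟨x, rfl⟩)).elim
    | hB w y => exact ⟨w, fun h => h3 (h ⟨y, rfl⟩), ⟨y, rfl⟩⟩
  obtain ⟨w, hw, hw'⟩ := h2
  obtain ⟨v'', ℓ, hℓ, ht⟩ := h.acts w hw
  have h4 : D.inB v' D.basePoint ∈ D.block v'' := by
    rw [← ht.image_block]
    exact ⟨_, hw', f.apply_symm_apply _⟩
  have h5 := inB_basePoint_mem_block h4
  subst h5
  exact ⟨w, ℓ⁻¹, H.inv_mem hℓ, ht.inv⟩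

theorem IsBlockOn.mul {H : Subgroup D.BlockMap} {f g : D.Surface ≃ₜ D.Surface}
    {Z : Set D.Surface} (hf : IsBlockOn H f (g '' Z)) (hg : IsBlockOn H g Z) :
    IsBlockOn H (f * g) Z := by
  refine ⟨hg.suited, ?_, fun v hv => ?_⟩
  · have := hf.suited_image
    rw [Set.image_image] at this
    exact this
  · obtain ⟨v', h, hh, hv'⟩ := hg.acts v hv
    obtain ⟨v'', h', hh', hv''⟩ := hf.acts v' (by
      rw [← hv'.image_block, Set.image_subset_image_iff g.injective]
      exact hv)
    exact ⟨v'', _, H.mul_mem hh' hh, hv''.mul hv'⟩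

theorem IsHBlock.inv {H : Subgroup D.BlockMap} {f : D.Surface ≃ₜ D.Surface}
    (h : D.IsHBlock H f) : D.IsHBlock H f⁻¹ := by
  obtain ⟨Z, hZ⟩ := isHBlock_iff.1 h
  exact isHBlock_iff.2 ⟨_, hZ.inv⟩

section Connected

variable [T2Space O] [PreconnectedSpace O] [T2Space Y] [PreconnectedSpace Y]

theorem IsBlockOn.one (H : Subgroup D.BlockMap) (n : ℕ) :
    IsBlockOn H (1 : D.Surface ≃ₜ D.Surface) (D.ball n) := by
  refine ⟨isSuited_ball n, ?_, fun v _ => ⟨v, 1, H.one_mem, .of_eq fun _ _ => rfl⟩⟩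
  convert isSuited_ball (D := D) n
  exact Set.image_id _

theorem IsHBlock.exists_ball {H : Subgroup D.BlockMap} {f : D.Surface ≃ₜ D.Surface}
    (h : D.IsHBlock H f) : ∃ n, ∀ m, n ≤ m → IsBlockOn H f (D.ball m) := by
  obtain ⟨Z, hZ⟩ := isHBlock_iff.1 h
  obtain ⟨n, hn⟩ := hZ.suited.exists_subset_ball
  exact ⟨n, fun m hm => hZ.enlarge (isSuited_ball m) (hn m hm)⟩

/-- A large ball `B` is a defining surface for both `f` and `g⁻¹`. Then `g⁻¹(B)` is one for `g`, and
its image under `g` is one for `f`. -/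
theorem IsHBlock.mul {H : Subgroup D.BlockMap} {f g : D.Surface ≃ₜ D.Surface}
    (hf : D.IsHBlock H f) (hg : D.IsHBlock H g) : D.IsHBlock H (f * g) := by
  obtain ⟨n, hn⟩ := hf.exists_ball
  obtain ⟨m, hm⟩ := hg.inv.exists_ball
  have h1 := (hm (max n m) (le_max_right _ _)).inv
  rw [inv_inv] at h1
  have h2 := hn (max n m) (le_max_left _ _)
  refine isHBlock_iff.2 ⟨_, IsBlockOn.mul ?_ h1⟩
  rw [Set.image_image]
  convert h2
  convert Set.image_id (D.ball (max n m)) with x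
  exact g.apply_symm_apply x

variable [ChartedSpace (EuclideanHalfSpace 2) O]

/-- The block mapping class group. -/
def blockGroup (H : Subgroup D.BlockMap) : Subgroup D.SurfaceMap where
  carrier := D.blockMappingClasses H
  one_mem' := ⟨1, isHBlock_iff.2 ⟨_, IsBlockOn.one H 0⟩, rfl⟩
  mul_mem' := by
    rintro _ _ ⟨f, hf, rfl⟩ ⟨g, hg, rfl⟩
    exact ⟨f * g, hf.mul hg, rfl⟩
  inv_mem' := by
    rintro _ ⟨f, hf, rfl⟩
    exact ⟨f⁻¹, hf.inv, rfl⟩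

end Connected

/-! ### Homeomorphisms supported on a subtree -/

/-- The family equal to `k` on the descendants of `v` and trivial elsewhere. -/
def subtreeFamily (v : List (Fin d)) (k : D.homeoBlock) : List (Fin d) → D.homeoBlock :=
  open Classical in fun w => if v <:+ w then k else 1

theorem subtreeFamily_append (v : List (Fin d)) (k : D.homeoBlock) (u : List (Fin d)) :
    subtreeFamily v k (u ++ v) = k := if_pos ⟨u, rfl⟩

theorem subtreeFamily_of_not {v : List (Fin d)} (k : D.homeoBlock) {w : List (Fin d)}
    (h : ¬ v <:+ w) : subtreeFamily v k w = 1 := if_neg h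

theorem act_subtreeFamily_of_not {v : List (Fin d)} (k : D.homeoBlock) {w : List (Fin d)}
    (h : ¬ v <:+ w) : act (subtreeFamily v k) w = w := by
  induction w with
  | nil => rfl
  | cons i w ih =>
    have h1 : ¬ v <:+ w := fun h' => h (h'.trans (List.suffix_cons i w))
    rw [act, subtreeFamily_of_not k h1, ih h1, map_one]
    rfl

theorem act_subtreeFamily_self (v : List (Fin d)) (k : D.homeoBlock) :
    act (subtreeFamily v k) v = v := by
  cases v with
  | nil => rfl
  | cons i w =>
    have h1 : ¬ i :: w <:+ w := fun h' => by
      have := h'.length_le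
      simp at this
    rw [act, subtreeFamily_of_not k h1, act_subtreeFamily_of_not k h1, map_one]
    rfl

theorem act_subtreeFamily_append (v : List (Fin d)) (k : D.homeoBlock) (u : List (Fin d)) :
    act (subtreeFamily v k) (u ++ v) = u.map (D.permHom k) ++ v := by
  induction u with
  | nil => exact act_subtreeFamily_self v k
  | cons i u ih =>
    rw [List.cons_append, act, subtreeFamily_append, ih]
    rfl

theorem suffix_act_subtreeFamily (v : List (Fin d)) (k : D.homeoBlock) (w : List (Fin d)) :
    v <:+ act (subtreeFamily v k) w ↔ v <:+ w := by
  constructor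
  · intro h
    by_contra h'
    rw [act_subtreeFamily_of_not k h'] at h
    exact h' h
  · rintro ⟨u, rfl⟩
    rw [act_subtreeFamily_append]
    exact ⟨_, rfl⟩

/-- The portrait of `l` preserves the set of descendants of `v`, so reading the first family at the
moved word changes nothing. -/
theorem portrait_subtreeFamily_mul (v : List (Fin d)) (k l : D.homeoBlock) :
    portrait (subtreeFamily v (k * l))
      = portrait (subtreeFamily v k) * portrait (subtreeFamily v l) := by
  rw [← portrait_mul]
  congr 1
  funext w
  by_cases h : v <:+ w
  · have h' := (suffix_act_subtreeFamily v l w).2 h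
    simp only [subtreeFamily, if_pos h, if_pos h']
  · have h' := mt (suffix_act_subtreeFamily v l w).1 h
    simp only [subtreeFamily, if_neg h, if_neg h', one_mul]

theorem actsOnSubtree_portrait (v : List (Fin d)) (k : D.homeoBlock) :
    ActsOnSubtree (portrait (subtreeFamily v k)) v v (QuotientGroup.mk k) := fun u =>
  ⟨k, rfl, fun y => by
    rw [portrait_inB, act_subtreeFamily_append, subtreeFamily_append]
    rfl⟩

theorem portrait_subtreeFamily_of_not {v : List (Fin d)} (k : D.homeoBlock) {w : List (Fin d)}
    (h : ¬ v <:+ w) (y : D.Block) :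
    portrait (subtreeFamily v k) (D.inB w y) = D.inB w y := by
  rw [portrait_inB, act_subtreeFamily_of_not k h, subtreeFamily_of_not k h]
  rfl

theorem portrait_subtreeFamily_of_mem_ball (v : List (Fin d)) (k : D.homeoBlock)
    {x : D.Surface} (hx : x ∈ D.ball v.length) : portrait (subtreeFamily v k) x = x := by
  rcases hx with ⟨x, rfl⟩ | hx
  · rfl
  · simp only [Set.mem_iUnion] at hx
    obtain ⟨w, hw, y, rfl⟩ := hx
    exact portrait_subtreeFamily_of_not k (fun h => absurd h.length_le (not_le.2 hw)) y

theorem image_ball_portrait_subtreeFamily (v : List (Fin d)) (k : D.homeoBlock) :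
    portrait (subtreeFamily v k) '' D.ball v.length = D.ball v.length := by
  rw [Set.image_congr fun x hx => portrait_subtreeFamily_of_mem_ball v k hx, Set.image_id']

theorem actsOnSubtree_portrait_of_ne {v v' : List (Fin d)} (k : D.homeoBlock)
    (hl : v.length = v'.length) (hv : v' ≠ v) :
    ActsOnSubtree (portrait (subtreeFamily v k)) v' v' 1 := by
  refine .of_eq fun u y => portrait_subtreeFamily_of_not k (fun h => ?_) y
  exact hv ((List.suffix_of_suffix_length_le (List.suffix_append u v') h hl.ge).eq_of_length
    hl.symm)

section

variable [ChartedSpace (EuclideanHalfSpace 2) O]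

theorem blockMappingClasses_mono {H H' : Subgroup D.BlockMap} (h : H ≤ H') :
    D.blockMappingClasses H ⊆ D.blockMappingClasses H' := by
  rintro _ ⟨f, ⟨Z, ℓ, h1, h2⟩, rfl⟩
  exact ⟨f, ⟨Z, ℓ, h1, fun v hv => h (h2 v hv)⟩, rfl⟩

variable (D) in
/-- The homomorphism that sends a mapping class of the block to the mapping class of the Cantor
surface that acts by it on the descendants of `v`. -/
def subtreeHom (v : List (Fin d)) : D.BlockMap →* D.SurfaceMap :=
  QuotientGroup.map _ _
    { toFun := fun k => D.surfaceHomeo (portrait (subtreeFamily v k)) fun _ => rfl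
      map_one' := by
        apply Subtype.ext
        change portrait (subtreeFamily v 1) = 1
        have h := portrait_subtreeFamily_mul (D := D) v 1 1
        rwa [mul_one, left_eq_mul] at h
      map_mul' := fun k l => Subtype.ext (portrait_subtreeFamily_mul v k l) }
    (fun k hk => by
      rw [Subgroup.mem_subgroupOf] at hk
      rw [Subgroup.mem_comap, Subgroup.mem_subgroupOf]
      refine isotopicToId_portrait boundary_subset_range_inO fun w => ?_
      unfold subtreeFamily
      split_ifs
      · exact hk
      · exact one_mem _)

theorem subtreeHom_mk (v : List (Fin d)) (k : D.homeoBlock) :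
    D.subtreeHom v (QuotientGroup.mk k) = portraitClass (subtreeFamily v k) := rfl

/-- For uniqueness: a homeomorphism with these labels is a portrait, since its action on words is
forced by `child_target`. Its values agree blockwise with the subtree family up to isotopy, and
`portraitClass_congr` applies. -/
theorem isFirstLabelClass_iff [T2Space O] [PreconnectedSpace O] [T2Space Y] [PreconnectedSpace Y]
    (hd : 0 < d) (h : D.BlockMap) (φ : D.SurfaceMap) :
    φ = D.subtreeHom [⟨0, hd⟩] h ↔ D.IsFirstLabelClass h φ := by
  have hval : ∀ i : Fin d, [i].map Fin.val = [0] ↔ i = ⟨0, hd⟩ := by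
    intro i
    simp [Fin.ext_iff]
  constructor
  · rintro rfl
    induction h using QuotientGroup.induction_on with
    | H k =>
      have hid : ∀ x ∈ D.O₂, portrait (subtreeFamily [⟨0, hd⟩] k) x = x := by
        intro x hx
        rw [O₂_eq_ball] at hx
        exact portrait_subtreeFamily_of_mem_ball _ k hx
      have himg := image_ball_portrait_subtreeFamily [⟨0, hd⟩] k
      rw [List.length_singleton, ← O₂_eq_ball] at himg
      have hs : D.IsSuited D.O₂ := by rw [O₂_eq_ball]; exact isSuited_ball 1
      have hacts : ∀ v, v.length = 1 → ActsOnSubtree (portrait (subtreeFamily [⟨0, hd⟩] k)) v v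
          (if v.map Fin.val = [0] then QuotientGroup.mk k else 1) := by
        intro v hv
        obtain ⟨i, rfl⟩ := List.length_eq_one_iff.1 hv
        by_cases hi : i = ⟨0, hd⟩
        · rw [if_pos ((hval i).2 hi), hi]
          exact actsOnSubtree_portrait _ k
        · rw [if_neg (mt (hval i).1 hi)]
          exact actsOnSubtree_portrait_of_ne k rfl fun h => hi (by simpa using h)
      refine ⟨_, rfl, hid, ⟨hs, by rw [← himg] at hs; exact hs, fun w hw => ?_⟩,
        fun v hv w hw => ?_⟩
      · obtain ⟨v, ⟨x, rfl⟩, hv⟩ := exists_isSuitedBoundary hw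
        rw [O₂_eq_ball, isSuitedBoundary_ball] at hv
        exact ⟨_, ((hacts v hv).append x).image_block⟩
      · rw [O₂_eq_ball, isSuitedBoundary_ball] at hv
        exact (hacts v hv).actsLike hw
  · rintro ⟨⟨f, hf⟩, rfl, hid, -, hℓ⟩
    induction h using QuotientGroup.induction_on with
    | H k =>
      -- The target of the root block is recorded because it starts the induction that determines
      -- the action on words.
      have h1 : ∀ w, ∃ (w' : List (Fin d)) (l : D.homeoBlock), (w = [] → w' = []) ∧
          (QuotientGroup.mk l : D.BlockMap) = QuotientGroup.mk (subtreeFamily [⟨0, hd⟩] k w) ∧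
          ∀ y, f (D.inB w y) = D.inB w' (l.1 y) := by
        intro w
        rcases List.eq_nil_or_concat' w with rfl | ⟨x, i, rfl⟩
        · refine ⟨[], 1, fun _ => rfl, ?_, fun y => hid _ (Or.inr ⟨y, rfl⟩)⟩
          rw [subtreeFamily_of_not]
          simp
        · obtain ⟨w', l, h1, h2⟩ := hℓ [i] (by rw [O₂_eq_ball, isSuitedBoundary_ball]; rfl)
            (x ++ [i]) ⟨x, rfl⟩
          refine ⟨w', l, fun h => by simp at h, ?_, h2⟩
          rw [h1]
          beta_reduce
          by_cases hi : i = ⟨0, hd⟩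
          · rw [if_pos ((hval i).2 hi), hi, subtreeFamily_append]
          · rw [if_neg (mt (hval i).1 hi), subtreeFamily_of_not]
            · rfl
            · rintro ⟨u, hu⟩
              exact hi (by simpa using (List.append_inj' hu rfl).2.symm)
      choose t κ ht hκ hft using h1
      have hact : ∀ w, t w = act κ w := by
        intro w
        induction w with
        | nil => exact ht [] rfl
        | cons i w ih => rw [child_target (hft w) (hft (i :: w)), ih]; rfl
      have hfp : f = portrait κ := by
        ext x
        induction x using surface_induction with
        | hO x => exact hid _ (Or.inl ⟨x, rfl⟩)
        | hB w y => rw [hft, hact]; rfl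
      rw [subtreeHom_mk, ← portraitClass_congr hκ]
      subst hfp
      rfl

end

end Datum

namespace Datum

variable {d : ℕ} {O Y : Type*} [TopologicalSpace O] [TopologicalSpace Y] {D : Datum d O Y}

/-! ### Generation -/

theorem isBlockOn_ball {H : Subgroup D.BlockMap} {f : D.Surface ≃ₜ D.Surface} {n : ℕ}
    (h1 : D.IsSuited (D.ball n)) (h2 : D.IsSuited (f '' D.ball n))
    (h : ∀ v : List (Fin d), v.length = n → ∃ v', ∃ h ∈ H, ActsOnSubtree f v v' h) :
    IsBlockOn H f (D.ball n) := by
  refine ⟨h1, h2, fun w hw => ?_⟩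
  obtain ⟨v, ⟨x, rfl⟩, hv⟩ := exists_isSuitedBoundary hw
  obtain ⟨v', ℓ, hℓ, hf⟩ := h v (isSuitedBoundary_ball.1 hv)
  exact ⟨_, ℓ, hℓ, hf.append x⟩

theorem portrait_subtreeFamily_of_forall_ne {v : List (Fin d)} (k : D.homeoBlock) {x : D.Surface}
    (h : ∀ u y, x ≠ D.inB (u ++ v) y) : portrait (subtreeFamily v k) x = x := by
  induction x using surface_induction with
  | hO x => rfl
  | hB w y =>
    refine portrait_subtreeFamily_of_not k (fun h' => ?_) y
    obtain ⟨u, rfl⟩ := h'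
    exact h u y rfl

variable (D) in
/-- There is a block homeomorphism with trivial labels that is the identity on `O₁` and carries
the subtree below the top of `v` rigidly to that below the top of `v'`. -/
def RigidMove (v v' : List (Fin d)) : Prop :=
  ∃ f : D.Surface ≃ₜ D.Surface, (∀ x, f (D.inO x) = D.inO x) ∧ D.IsHBlock ⊥ f ∧
    ∀ u y, f (D.inB (u ++ v) y) = D.inB (u ++ v') y

theorem RigidMove.symm {v v' : List (Fin d)} (h : D.RigidMove v v') : D.RigidMove v' v := by
  obtain ⟨f, h1, h2, h3⟩ := h
  refine ⟨f⁻¹, fun x => ?_, h2.inv, fun u y => ?_⟩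
  · exact (Homeomorph.symm_apply_eq f).2 (h1 x).symm
  · exact (Homeomorph.symm_apply_eq f).2 (h3 u y).symm

theorem RigidMove.append {v v' : List (Fin d)} (h : D.RigidMove v v') (x : List (Fin d)) :
    D.RigidMove (x ++ v) (x ++ v') := by
  obtain ⟨f, h1, h2, h3⟩ := h
  refine ⟨f, h1, h2, fun u y => ?_⟩
  rw [← List.append_assoc, h3, List.append_assoc]

/-- Each portrait is supported on one subtree, and `f` matches the two subtrees by the identity in
canonical coordinates. -/
theorem conj_portrait {v v' : List (Fin d)} {f : D.Surface ≃ₜ D.Surface}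
    (hf : ∀ u y, f (D.inB (u ++ v) y) = D.inB (u ++ v') y) (k : D.homeoBlock) :
    f * portrait (subtreeFamily v k) * f⁻¹ = portrait (subtreeFamily v' k) := by
  have hf' : ∀ u y, f.symm (D.inB (u ++ v') y) = D.inB (u ++ v) y := fun u y =>
    (Homeomorph.symm_apply_eq f).2 (hf u y).symm
  ext x
  change f (portrait _ (f.symm x)) = _
  by_cases h : ∃ u y, x = D.inB (u ++ v') y
  · obtain ⟨u, y, rfl⟩ := h
    rw [hf', portrait_inB, portrait_inB, act_subtreeFamily_append, act_subtreeFamily_append,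
      subtreeFamily_append, subtreeFamily_append, hf]
  · simp only [not_exists] at h
    rw [portrait_subtreeFamily_of_forall_ne k h, portrait_subtreeFamily_of_forall_ne,
      Homeomorph.apply_symm_apply]
    intro u y hx
    rw [Homeomorph.symm_apply_eq, hf] at hx
    exact h u y hx

theorem subtreeHom_mem_of_rigidMove [ChartedSpace (EuclideanHalfSpace 2) O] {G : Subgroup D.SurfaceMap}
    (hG : D.blockMappingClasses ⊥ ⊆ G) {v v' : List (Fin d)} (h : D.RigidMove v v')
    {k : D.BlockMap} (hk : D.subtreeHom v k ∈ G) : D.subtreeHom v' k ∈ G := by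
  obtain ⟨f, h1, h2, h3⟩ := h
  induction k using QuotientGroup.induction_on with
  | H k =>
    have hf : (QuotientGroup.mk (D.surfaceHomeo f h1) : D.SurfaceMap) ∈ G := hG ⟨_, h2, rfl⟩
    have := G.mul_mem (G.mul_mem hf hk) (G.inv_mem hf)
    convert this
    rw [subtreeHom_mk, subtreeHom_mk]
    unfold portraitClass
    rw [← QuotientGroup.mk_mul, ← QuotientGroup.mk_inv, ← QuotientGroup.mk_mul]
    exact congrArg _ (Subtype.ext (conj_portrait h3 k).symm)

/-- Composing on the right with the subtree element of the inverse label at one word of length `n`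
clears that label and leaves the others unchanged. After finitely many steps all labels are trivial.
-/
theorem mk_mem_of_isBlockOn_ball [ChartedSpace (EuclideanHalfSpace 2) O]
    {H : Subgroup D.BlockMap} {G : Subgroup D.SurfaceMap}
    (hG : D.blockMappingClasses ⊥ ⊆ G) {n : ℕ}
    (hn : ∀ v : List (Fin d), v.length = n → ∀ k ∈ H, D.subtreeHom v k ∈ G)
    (f : D.homeoSurface) (hf : IsBlockOn H f.1 (D.ball n)) :
    (QuotientGroup.mk f : D.SurfaceMap) ∈ G := by
  -- `T` contains the words of length `n` whose labels may still be nontrivial.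
  suffices key : ∀ (T : Finset (List (Fin d))) (f : D.homeoSurface),
      IsBlockOn H f.1 (D.ball n) →
      (∀ v, v.length = n → v ∉ T → ∃ v', ActsOnSubtree f.1 v v' 1) →
      (QuotientGroup.mk f : D.SurfaceMap) ∈ G from
    key (List.finite_length_eq (Fin d) n).toFinset f hf fun v hv hv' =>
      (hv' (by simpa using hv)).elim
  intro T
  induction T using Finset.induction_on with
  | empty =>
    intro f hf h
    refine hG ⟨f, isHBlock_iff.2 ⟨_, isBlockOn_ball hf.suited hf.suited_image fun v hv => ?_⟩, rfl⟩
    obtain ⟨v', hv'⟩ := h v hv (Finset.notMem_empty v)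
    exact ⟨v', 1, one_mem _, hv'⟩
  | insert v T hvT ih =>
    intro f hf h
    by_cases hv : v.length = n
    · subst hv
      obtain ⟨v', ℓ, hℓ, hfv⟩ := hf.acts v (by rw [block_subset_ball]; exact lt_irrefl _)
      obtain ⟨k, rfl⟩ := QuotientGroup.mk_surjective ℓ
      have hg : IsBlockOn H (portrait (subtreeFamily v k⁻¹)) (D.ball v.length) := by
        refine isBlockOn_ball hf.suited
          (by rw [image_ball_portrait_subtreeFamily]; exact hf.suited) fun w hw => ?_
        by_cases hwv : w = v
        · subst hwv
          exact ⟨_, _, H.inv_mem hℓ, actsOnSubtree_portrait _ _⟩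
        · exact ⟨_, _, H.one_mem, actsOnSubtree_portrait_of_ne _ hw.symm hwv⟩
      have hmul : IsBlockOn H (f * D.surfaceHomeo (portrait (subtreeFamily v k⁻¹))
          (portrait_inO _)).1 (D.ball v.length) :=
        IsBlockOn.mul (f := f.1) (g := portrait (subtreeFamily v k⁻¹)) (by rw [image_ball_portrait_subtreeFamily]; exact hf) hg
      have h1 := ih (f * D.surfaceHomeo (portrait (subtreeFamily v k⁻¹)) (portrait_inO _)) hmul (by
        intro w hw hwT
        by_cases hwv : w = v
        · subst hwv
          have := hfv.mul (actsOnSubtree_portrait w k⁻¹)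
          rw [← QuotientGroup.mk_mul, mul_inv_cancel] at this
          exact ⟨_, this⟩
        · obtain ⟨w', hw'⟩ := h w hw (by simp [hwv, hwT])
          have := hw'.mul (actsOnSubtree_portrait_of_ne k⁻¹ hw.symm hwv)
          rw [mul_one] at this
          exact ⟨_, this⟩)
      have h2 := hn v rfl _ hℓ
      have h3 := G.mul_mem h1 h2
      convert h3
      rw [QuotientGroup.mk_mul, mul_assoc, eq_comm, mul_eq_left]
      have h4 := map_mul (D.subtreeHom v) (QuotientGroup.mk k⁻¹) (QuotientGroup.mk k)
      rw [← QuotientGroup.mk_mul, inv_mul_cancel, QuotientGroup.mk_one, map_one] at h4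
      exact h4.symm
    · refine ih f hf fun w hw hwT => h w hw ?_
      rw [Finset.mem_insert, not_or]
      exact ⟨fun h => hv (h ▸ hw), hwT⟩

section Connected

variable [T2Space O] [PreconnectedSpace O] [T2Space Y] [PreconnectedSpace Y]

theorem RigidMove.refl (v : List (Fin d)) : D.RigidMove v v :=
  ⟨1, fun _ => rfl, isHBlock_iff.2 ⟨_, IsBlockOn.one _ 0⟩, fun _ _ => rfl⟩

theorem RigidMove.trans {v v' v'' : List (Fin d)} (h : D.RigidMove v v')
    (h' : D.RigidMove v' v'') : D.RigidMove v v'' := by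
  obtain ⟨f, h1, h2, h3⟩ := h
  obtain ⟨g, h1', h2', h3'⟩ := h'
  refine ⟨g * f, fun x => ?_, h2'.mul h2, fun u y => ?_⟩
  · change g (f _) = _
    rw [h1, h1']
  · change g (f _) = _
    rw [h3, h3']

/-- By induction `[0]` reaches `1 :: w`, and the level move leads on to `0 :: 0 :: w`. Sibling moves
then correct the first letter and, carrying it along, the second. -/
theorem rigidMove_of_generators (hd : 2 ≤ d)
    (hsib : ∀ (i j : Fin d) (w : List (Fin d)), D.RigidMove (i :: w) (j :: w))
    (hlevel : ∀ w : List (Fin d), D.RigidMove (⟨1, hd⟩ :: w)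
      (⟨0, by omega⟩ :: ⟨0, by omega⟩ :: w))
    (i : Fin d) (w : List (Fin d)) : D.RigidMove [⟨0, by omega⟩] (i :: w) := by
  induction w generalizing i with
  | nil => exact hsib _ _ _
  | cons j w ih =>
    refine ((ih ⟨1, hd⟩).trans (hlevel w)).trans ?_
    exact (hsib _ i _).trans ((hsib _ j w).append [i])

variable [ChartedSpace (EuclideanHalfSpace 2) O]

theorem closure_eq_blockMappingClasses (hd : 2 ≤ d) (H : Subgroup D.BlockMap)
    (hmove : ∀ (i : Fin d) (w : List (Fin d)), D.RigidMove [⟨0, by omega⟩] (i :: w)) :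
    (Subgroup.closure (Set.range ((D.subtreeHom [⟨0, by omega⟩]).comp H.subtype) ∪
      D.blockMappingClasses ⊥) : Set D.SurfaceMap) = D.blockMappingClasses H := by
  apply Set.Subset.antisymm
  · change Subgroup.closure _ ≤ blockGroup H
    rw [Subgroup.closure_le, Set.union_subset_iff]
    constructor
    · rintro _ ⟨⟨h, hh⟩, rfl⟩
      obtain ⟨f, hf, -, hf'⟩ := (isFirstLabelClass_iff (by omega) h _).1 rfl
      refine ⟨f, ⟨_, _, hf', fun v _ => ?_⟩, hf⟩
      split_ifs
      · exact hh
      · exact H.one_mem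
    · exact blockMappingClasses_mono bot_le
  · rintro _ ⟨f, hf, rfl⟩
    obtain ⟨n, hn⟩ := hf.exists_ball
    -- Level `n + 1` instead of `n` makes every word on the boundary nonempty, hence the target of a
    -- rigid move from `[0]`.
    refine mk_mem_of_isBlockOn_ball (H := H) (n := n + 1)
      (Set.subset_union_right.trans Subgroup.subset_closure) (fun v hv k hk => ?_) f
      (hn _ n.le_succ)
    obtain ⟨i, w, rfl⟩ := List.exists_cons_of_length_eq_add_one hv
    refine subtreeHom_mem_of_rigidMove
      (Set.subset_union_right.trans Subgroup.subset_closure) (hmove i w) ?_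
    exact Subgroup.subset_closure (Or.inl ⟨⟨k, hk⟩, rfl⟩)

end Connected

end Datum
/-! ### Twists of the plane -/

section Twist

variable {P : ℝ → ℝ}

theorem periodic_eq_of_exp_eq (hper : Function.Periodic P (2 * Real.pi)) {s t : ℝ}
    (h : Complex.exp (s * Complex.I) = Complex.exp (t * Complex.I)) : P s = P t := by
  obtain ⟨n, hn⟩ := Complex.exp_eq_exp_iff_exists_int.1 h
  have : s = t + n * (2 * Real.pi) := by
    have h1 : (s : ℂ) = t + n * (2 * Real.pi) := by
      apply mul_right_cancel₀ Complex.I_ne_zero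
      rw [hn]; ring
    exact_mod_cast h1
  rw [this]
  exact hper.int_mul n t

theorem continuousAt_periodic_arg (hP : Continuous P) (hper : Function.Periodic P (2 * Real.pi))
    {z : ℂ} (hz : z ≠ 0) : ContinuousAt (fun z => P (Complex.arg z)) z := by
  by_cases h : z ∈ Complex.slitPlane
  · exact hP.continuousAt.comp (Complex.continuousAt_arg h)
  · have h' : -z ∈ Complex.slitPlane := by
      rw [Complex.mem_slitPlane_iff] at h ⊢
      push Not at h
      left
      rw [Complex.neg_re, neg_pos]
      exact lt_of_le_of_ne h.1 fun h0 => hz (Complex.ext h0 h.2)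
    -- On the cut, `arg (-z) + π` is another choice of the angle that is continuous there;
    -- periodicity of `P` hides the change.
    have h1 : ContinuousAt (fun z => P (Complex.arg (-z) + Real.pi)) z := by
      have h2 : ContinuousAt (fun z : ℂ => Complex.arg (-z)) z :=
        ContinuousAt.comp (g := Complex.arg) (Complex.continuousAt_arg h') continuous_neg.continuousAt
      exact hP.continuousAt.comp (h2.add continuousAt_const)
    refine h1.congr ?_
    filter_upwards [isOpen_ne.mem_nhds hz] with x hx
    refine periodic_eq_of_exp_eq hper ?_
    push_cast
    rw [add_mul, Complex.exp_add, Complex.exp_pi_mul_I]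
    have h2 := Complex.norm_mul_exp_arg_mul_I x
    have h3 := Complex.norm_mul_exp_arg_mul_I (-x)
    rw [norm_neg] at h3
    have h4 : (‖x‖ : ℂ) ≠ 0 := by simpa using hx
    apply mul_left_cancel₀ h4
    linear_combination -h2 - h3

/-- The twist of the plane that rotates `z` by the angle `P (arg z)`, scaled by the profile `m`. -/
def twistFun (P m : ℝ → ℝ) (z : ℂ) : ℂ :=
  z * Complex.exp ((m ‖z‖ * P (Complex.arg z) : ℝ) * Complex.I)

theorem norm_twistFun (m : ℝ → ℝ) (z : ℂ) : ‖twistFun P m z‖ = ‖z‖ := by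
  rw [twistFun, norm_mul, Complex.norm_exp_ofReal_mul_I, mul_one]

theorem twistFun_polar (hper : Function.Periodic P (2 * Real.pi)) (m : ℝ → ℝ) {ρ : ℝ}
    (hρ : 0 ≤ ρ) (t : ℝ) :
    twistFun P m (ρ * Complex.exp (t * Complex.I))
      = ρ * Complex.exp ((t + m ρ * P t : ℝ) * Complex.I) := by
  rcases hρ.eq_or_lt with rfl | hρ
  · simp [twistFun]
  · have h1 : ‖(ρ * Complex.exp (t * Complex.I) : ℂ)‖ = ρ := by
      rw [norm_mul, Complex.norm_exp_ofReal_mul_I, mul_one, Complex.norm_real,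
        Real.norm_of_nonneg hρ.le]
    have h2 : P (Complex.arg (ρ * Complex.exp (t * Complex.I))) = P t := by
      refine periodic_eq_of_exp_eq hper ?_
      have h3 := Complex.norm_mul_exp_arg_mul_I (ρ * Complex.exp (t * Complex.I))
      rw [h1] at h3
      exact mul_left_cancel₀ (by exact_mod_cast hρ.ne') h3
    rw [twistFun, h1, h2, mul_assoc, ← Complex.exp_add]
    congr 2
    push_cast
    ring

theorem continuous_twistFun (hP : Continuous P) (hper : Function.Periodic P (2 * Real.pi))
    {m : ℝ → ℝ} (hm : Continuous m) : Continuous (twistFun P m) := by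
  rw [continuous_iff_continuousAt]
  intro z
  by_cases hz : z = 0
  · subst hz
    have h0 : twistFun P m 0 = 0 := by simp [twistFun]
    unfold ContinuousAt
    rw [h0]
    refine squeeze_zero_norm (fun z => (norm_twistFun m z).le) ?_
    simpa using (continuous_norm (E := ℂ)).tendsto 0
  · refine continuousAt_id.mul (Complex.continuous_exp.continuousAt.comp ?_)
    refine ContinuousAt.mul (Complex.continuous_ofReal.continuousAt.comp ?_) continuousAt_const
    exact (hm.comp continuous_norm).continuousAt.mul (continuousAt_periodic_arg hP hper hz)

/-- The map is a convex combination of the increasing maps `t` and `t + P t`. -/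
theorem strictMono_add_mul (hmono : StrictMono fun t => t + P t) {m : ℝ} (h0 : 0 ≤ m)
    (h1 : m ≤ 1) : StrictMono fun t => t + m * P t := by
  intro s t hst
  have h2 : s + P s < t + P t := hmono hst
  change s + m * P s < t + m * P t
  rcases h0.eq_or_lt with rfl | h0
  · simpa using hst
  · nlinarith [mul_lt_mul_of_pos_left h2 h0, mul_nonneg (sub_nonneg.2 h1) (sub_nonneg.2 hst.le)]

theorem bijective_twistFun (hP : Continuous P) (hper : Function.Periodic P (2 * Real.pi))
    (hmono : StrictMono fun t => t + P t) {m : ℝ → ℝ} (h0 : ∀ ρ, 0 ≤ m ρ) (h1 : ∀ ρ, m ρ ≤ 1) :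
    Function.Bijective (twistFun P m) := by
  constructor
  · intro z z' h
    have hn : ‖z‖ = ‖z'‖ := by rw [← norm_twistFun (P := P) m, h, norm_twistFun]
    rcases eq_or_ne z 0 with rfl | hz
    · rw [norm_zero] at hn
      exact (norm_eq_zero.1 hn.symm).symm
    have hz' : (‖z‖ : ℂ) ≠ 0 := by simpa using hz
    rw [← Complex.norm_mul_exp_arg_mul_I z, ← Complex.norm_mul_exp_arg_mul_I z',
      twistFun_polar hper m (norm_nonneg _), twistFun_polar hper m (norm_nonneg _), ← hn] at h
    obtain ⟨n, hn'⟩ := Complex.exp_eq_exp_iff_exists_int.1 (mul_left_cancel₀ hz' h)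
    have h2 : z.arg + m ‖z‖ * P z.arg
        = z'.arg + m ‖z‖ * P z'.arg + n * (2 * Real.pi) := by
      have h3 : ((z.arg + m ‖z‖ * P z.arg : ℝ) : ℂ)
          = (z'.arg + m ‖z‖ * P z'.arg + n * (2 * Real.pi) : ℝ) := by
        apply mul_right_cancel₀ Complex.I_ne_zero
        rw [hn']
        push_cast
        ring
      exact_mod_cast h3
    have h4 : z.arg = z'.arg + n * (2 * Real.pi) := by
      apply (strictMono_add_mul hmono (h0 ‖z‖) (h1 ‖z‖)).injective
      beta_reduce
      rw [hper.int_mul n]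
      linarith
    rw [← Complex.norm_mul_exp_arg_mul_I z, ← Complex.norm_mul_exp_arg_mul_I z', h4, ← hn]
    congr 1
    refine Complex.exp_eq_exp_iff_exists_int.2 ⟨n, ?_⟩
    push_cast
    ring
  · intro w
    -- A bound `C` for the periodic `P` confines the angular displacement, so the intermediate value
    -- theorem on an interval of radius `C` finds the preimage angle.
    obtain ⟨C, hC⟩ := isBounded_iff_forall_norm_le.1
      (hper.isBounded_of_continuous (by positivity) hP)
    have hC0 : 0 ≤ C := (norm_nonneg _).trans (hC _ ⟨0, rfl⟩)
    have hb : ∀ t, |m ‖w‖ * P t| ≤ C := fun t => by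
      rw [abs_mul, abs_of_nonneg (h0 _)]
      exact (mul_le_of_le_one_left (abs_nonneg _) (h1 _)).trans (hC _ ⟨t, rfl⟩)
    have hcont : Continuous fun t => t + m ‖w‖ * P t := by fun_prop
    have hiv := intermediate_value_Icc (a := w.arg - C) (b := w.arg + C) (by linarith)
      hcont.continuousOn
    obtain ⟨t, -, ht⟩ := hiv (⟨by linarith [(abs_le.1 (hb (w.arg - C))).2],
      by linarith [(abs_le.1 (hb (w.arg + C))).1]⟩ : w.arg ∈ Set.Icc _ _)
    refine ⟨‖w‖ * Complex.exp (t * Complex.I), ?_⟩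
    beta_reduce at ht
    rw [twistFun_polar hper m (norm_nonneg _), ht, Complex.norm_mul_exp_arg_mul_I]

/-- There is a homeomorphism of the plane that preserves the circles about `c`, is the identity
outside the disc of radius `b`, and acts inside the disc of radius `a` by `t ↦ t + P t` on the
angular coordinate. -/
theorem exists_twist (hP : Continuous P) (hper : Function.Periodic P (2 * Real.pi))
    (hmono : StrictMono fun t => t + P t) {a b : ℝ} (hab : a < b) (c : ℂ) :
    ∃ T : ℂ ≃ₜ ℂ, (∀ ρ t : ℝ, 0 ≤ ρ → ρ ≤ a → T (c + ρ * Complex.exp (t * Complex.I))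
        = c + ρ * Complex.exp ((t + P t : ℝ) * Complex.I)) ∧
      (∀ z, b ≤ ‖z - c‖ → T z = z) ∧ ∀ z, ‖T z - c‖ = ‖z - c‖ := by
  -- The profile is 1 up to radius `a`, 0 from radius `b` on, and linear between.
  let m : ℝ → ℝ := fun ρ => max 0 (min 1 ((b - ρ) / (b - a)))
  have hm : Continuous m := by fun_prop
  have hm0 : ∀ ρ, 0 ≤ m ρ := fun ρ => le_max_left _ _
  have hm1 : ∀ ρ, m ρ ≤ 1 := fun ρ => max_le zero_le_one (min_le_left _ _)
  have hma : ∀ ρ, ρ ≤ a → m ρ = 1 := fun ρ hρ => by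
    have : 1 ≤ (b - ρ) / (b - a) := by rw [one_le_div (by linarith)]; linarith
    simp only [m, min_eq_left this, max_eq_right zero_le_one]
  have hmb : ∀ ρ, b ≤ ρ → m ρ = 0 := fun ρ hρ => by
    have : (b - ρ) / (b - a) ≤ 0 := div_nonpos_of_nonpos_of_nonneg (by linarith) (by linarith)
    exact max_eq_left (min_le_of_right_le this)
  have hcont := continuous_twistFun hP hper hm
  -- Twists preserve the norm, hence are proper; a continuous closed bijection is a homeomorphism.
  have hproper : IsProperMap (twistFun P m) := by
    rw [isProperMap_iff_tendsto_cocompact]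
    refine ⟨hcont, ?_⟩
    rw [← Metric.cobounded_eq_cocompact, ← tendsto_norm_atTop_iff_cobounded]
    simp only [norm_twistFun]
    exact tendsto_norm_cobounded_atTop
  let T₀ : ℂ ≃ₜ ℂ := (Equiv.ofBijective _
    (bijective_twistFun hP hper hmono hm0 hm1)).toHomeomorphOfContinuousClosed hcont
    hproper.isClosedMap
  refine ⟨(Homeomorph.subRight c).trans (T₀.trans (Homeomorph.addLeft c)), ?_, ?_, ?_⟩
  · intro ρ t h0 h1
    change c + twistFun P m (c + _ - c) = _
    rw [add_sub_cancel_left, twistFun_polar hper m h0, hma ρ h1, one_mul]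
  · intro z hz
    change c + twistFun P m (z - c) = _
    rw [twistFun, hmb _ hz]
    simp
  · intro z
    change ‖c + twistFun P m (z - c) - c‖ = _
    rw [add_sub_cancel_left, norm_twistFun]

end Twist

/-- The half twist about `c`. -/
theorem exists_halfTwist {a b : ℝ} (hab : a < b) (c : ℂ) :
    ∃ T : ℂ ≃ₜ ℂ, (∀ z, ‖z - c‖ ≤ a → T z = c - (z - c)) ∧
      (∀ z, b ≤ ‖z - c‖ → T z = z) ∧ ∀ z, ‖T z - c‖ = ‖z - c‖ := by
  obtain ⟨T, h1, h2, h3⟩ := exists_twist (P := fun _ => Real.pi) continuous_const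
    (fun _ => rfl) (fun s t h => by simpa using h) hab c
  refine ⟨T, fun z hz => ?_, h2, h3⟩
  have h4 := h1 ‖z - c‖ (Complex.arg (z - c)) (norm_nonneg _) hz
  rw [Complex.norm_mul_exp_arg_mul_I, add_sub_cancel] at h4
  rw [h4]
  push_cast
  rw [add_mul, Complex.exp_add, Complex.exp_pi_mul_I, ← mul_assoc,
    Complex.norm_mul_exp_arg_mul_I]
  ring
-- Transplanting planar homeomorphisms to the block.
/-- A homeomorphism of the plane with bounded support induces a homeomorphism of any Hausdorff
space with a planar chart. -/
theorem exists_extend_homeo {X : Type*} [TopologicalSpace X] [T2Space X] {e : ℂ → X}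
    (he : Topology.IsOpenEmbedding e) (T : ℂ ≃ₜ ℂ) (c : ℂ) (R : ℝ)
    (hT : ∀ z, R ≤ ‖z - c‖ → T z = z) :
    ∃ T' : X ≃ₜ X, (∀ z, T' (e z) = e (T z)) ∧ ∀ x ∉ Set.range e, T' x = x := by
  have key : ∀ T : ℂ ≃ₜ ℂ, (∀ z, R ≤ ‖z - c‖ → T z = z) →
      Continuous (Function.extend e (fun z => e (T z)) id) := by
    intro T hT
    rw [continuous_iff_continuousAt]
    intro x
    by_cases hx : x ∈ Set.range e
    · obtain ⟨z, rfl⟩ := hx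
      rw [← he.continuousAt_iff]
      have : Function.extend e (fun z => e (T z)) id ∘ e = fun z => e (T z) :=
        funext fun z => he.injective.extend_apply _ _ _
      rw [this]
      exact (he.continuous.comp T.continuous).continuousAt
    -- In a Hausdorff space the compact image of the support is closed, so the extension is the
    -- identity near points outside the chart.
    · have hcl : IsClosed (e '' Metric.closedBall c R) :=
        ((isCompact_closedBall c R).image he.continuous).isClosed
      have hx' : x ∉ e '' Metric.closedBall c R := fun ⟨z, _, h⟩ => hx ⟨z, h⟩
      refine continuousAt_id.congr ?_
      filter_upwards [hcl.isOpen_compl.mem_nhds hx'] with y hy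
      by_cases hy' : y ∈ Set.range e
      · obtain ⟨z, rfl⟩ := hy'
        rw [he.injective.extend_apply, hT]
        · rfl
        · by_contra hz
          exact hy ⟨z, by rw [mem_closedBall_iff_norm]; exact (not_le.1 hz).le, rfl⟩
      · rw [Function.extend_apply' _ _ _ hy']
  have hinv : ∀ T T' : ℂ ≃ₜ ℂ, (∀ z, T' (T z) = z) →
      ∀ x, Function.extend e (fun z => e (T' z)) id (Function.extend e (fun z => e (T z)) id x)
        = x := by
    intro T T' h x
    by_cases hx : x ∈ Set.range e
    · obtain ⟨z, rfl⟩ := hx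
      rw [he.injective.extend_apply, he.injective.extend_apply, h]
    · rw [Function.extend_apply' _ _ x hx]
      exact Function.extend_apply' _ _ x hx
  refine ⟨⟨⟨_, _, hinv T T.symm T.symm_apply_apply, hinv T.symm T T.apply_symm_apply⟩, key T hT,
    key T.symm fun z hz => ?_⟩, fun z => ?_, fun x hx => ?_⟩
  · rw [Homeomorph.symm_apply_eq, hT z hz]
  · change Function.extend e (fun z => e (T z)) id (e z) = _
    exact he.injective.extend_apply _ _ _
  · change Function.extend e (fun z => e (T z)) id x = _
    exact Function.extend_apply' _ _ x hx

/-- The complement in the plane of the open discs of radius `1/4` about `0, …, d`. -/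
def planarBlock (d : ℕ) : Set ℂ := {z | ∀ i : Fin (d + 1), 1 / 4 ≤ ‖z - (i : ℕ)‖}

namespace Datum

variable {d : ℕ} {O Y : Type*} [TopologicalSpace O] [TopologicalSpace Y] (D : Datum d O Y)

theorem chartY_mem_Block {z : ℂ} : D.chartY z ∈ D.Block ↔ z ∈ planarBlock d := by
  refine forall_congr' fun i => ?_
  rw [D.isOpenEmbedding_chartY.injective.mem_set_image, mem_ball_iff_norm, not_lt]

/-- The chart of the block. -/
def chartB (z : ℂ) : D.Block :=
  open Classical in if h : D.chartY z ∈ D.Block then ⟨D.chartY z, h⟩ else D.basePoint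

variable {D}

theorem coe_chartB {z : ℂ} (hz : z ∈ planarBlock d) : (D.chartB z : Y) = D.chartY z := by
  rw [chartB, dif_pos (D.chartY_mem_Block.2 hz)]

variable (D) in
theorem circle_eq_chartB (i : Fin (d + 1)) (z : Circle) :
    D.circle i z = D.chartB ((i : ℕ) + z / 4) := by
  have h : (i : ℕ) + (z : ℂ) / 4 ∈ planarBlock d := D.chartY_mem_Block.1 (D.circle i z).2
  exact Subtype.ext (coe_chartB h).symm

theorem circle_mem_planarBlock (i : Fin (d + 1)) (z : Circle) :
    (i : ℕ) + (z : ℂ) / 4 ∈ planarBlock d := by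
  intro j
  by_cases h : i = j
  · subst h
    rw [add_sub_cancel_left, norm_div, Circle.norm_coe]
    norm_num
  · have h1 := one_le_norm_natCast_sub (i := i) (j := j) fun h' => h (Fin.ext h')
    have h2 : ((i : ℕ) : ℂ) - (j : ℕ) = ((i : ℕ) + (z : ℂ) / 4 - (j : ℕ)) - z / 4 := by ring
    have h3 := norm_sub_le ((i : ℕ) + (z : ℂ) / 4 - (j : ℕ)) (z / 4)
    rw [← h2, norm_div, Circle.norm_coe] at h3
    norm_num at h3
    linarith

theorem continuousOn_chartB : ContinuousOn D.chartB (planarBlock d) := by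
  rw [Topology.IsInducing.subtypeVal.continuousOn_iff]
  exact D.isOpenEmbedding_chartY.continuous.continuousOn.congr fun z hz => coe_chartB hz

theorem chartB_injOn : Set.InjOn D.chartB (planarBlock d) := by
  intro z hz z' hz' h
  apply D.isOpenEmbedding_chartY.injective
  rw [← coe_chartB hz, h, coe_chartB hz']

theorem exists_block_homeo [T2Space Y] (T : ℂ ≃ₜ ℂ) (c : ℂ) (R : ℝ)
    (hT : ∀ z, R ≤ ‖z - c‖ → T z = z) (hT' : ∀ z, T z ∈ planarBlock d ↔ z ∈ planarBlock d) :
    ∃ h : D.Block ≃ₜ D.Block, ∀ z ∈ planarBlock d, h (D.chartB z) = D.chartB (T z) := by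
  obtain ⟨g, hg, hg'⟩ := exists_extend_homeo D.isOpenEmbedding_chartY T c R hT
  refine ⟨g.subtype fun x => ?_, fun z hz => ?_⟩
  · by_cases hx : x ∈ Set.range D.chartY
    · obtain ⟨z, rfl⟩ := hx
      rw [hg]
      exact (D.chartY_mem_Block.trans (hT' z).symm).trans D.chartY_mem_Block.symm
    · rw [hg' x hx]
  · apply Subtype.ext
    change g (D.chartB z) = _
    rw [coe_chartB hz, hg, coe_chartB ((hT' z).2 hz)]

/-- The twist is supported in the disc of radius 1/2 about `i`, which meets no other hole. It
preserves distances to `i`, hence the block. -/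
theorem exists_collar_twist [T2Space Y] {P : ℝ → ℝ} (hP : Continuous P)
    (hper : Function.Periodic P (2 * Real.pi)) (hmono : StrictMono fun t => t + P t)
    (i : Fin (d + 1)) :
    ∃ h : D.Block ≃ₜ D.Block,
      (∀ t : ℝ, h (D.circle i (Circle.exp t)) = D.circle i (Circle.exp (t + P t))) ∧
      ∀ j, j ≠ i → ∀ z, h (D.circle j z) = D.circle j z := by
  obtain ⟨T, hT1, hT2, hT3⟩ := exists_twist hP hper hmono
    (by norm_num : (1 / 4 : ℝ) < 1 / 2) ((i : ℕ) : ℂ)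
  have hfree : ∀ z : ℂ, ‖z - (i : ℕ)‖ < 1 / 2 → (z ∈ planarBlock d ↔ 1 / 4 ≤ ‖z - (i : ℕ)‖) := by
    intro z hz
    refine ⟨fun h => h i, fun h j => ?_⟩
    by_cases hij : i = j
    · exact hij ▸ h
    · have h1 := one_le_norm_natCast_sub (i := i) (j := j) fun h' => hij (Fin.ext h')
      have h3 := norm_sub_le_norm_sub_add_norm_sub ((i : ℕ) : ℂ) z (j : ℕ)
      rw [norm_sub_rev _ z] at h3
      linarith
  obtain ⟨h, hh⟩ := exists_block_homeo (D := D) T _ _ hT2 (fun z => by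
    by_cases hz : 1 / 2 ≤ ‖z - (i : ℕ)‖
    · rw [hT2 z hz]
    · push Not at hz
      rw [hfree z hz, hfree (T z) (by rw [hT3]; exact hz), hT3])
  refine ⟨h, fun t => ?_, fun j hj z => ?_⟩
  · rw [circle_eq_chartB, hh _ (circle_mem_planarBlock _ _), circle_eq_chartB]
    have h1 := hT1 (1 / 4) t (by norm_num) le_rfl
    rw [Circle.coe_exp, Circle.coe_exp]
    have h2 : ∀ x : ℂ, x / 4 = ((1 / 4 : ℝ) : ℂ) * x := fun x => by push_cast; ring
    rw [h2, h2, h1]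
  · rw [circle_eq_chartB, hh _ (circle_mem_planarBlock _ _), hT2]
    have h1 := one_le_norm_natCast_sub (i := j) (j := i) fun h' => hj (Fin.ext h')
    have h2 : ((j : ℕ) : ℂ) - (i : ℕ) = ((j : ℕ) + (z : ℂ) / 4 - (i : ℕ)) - z / 4 := by ring
    have h3 := norm_sub_le ((j : ℕ) + (z : ℂ) / 4 - (i : ℕ)) (z / 4)
    rw [← h2, norm_div, Circle.norm_coe] at h3
    norm_num at h3
    linarith

end Datum

/-! ### Straightening the gluing maps. -/

theorem ReversesOrientation.lift_sub_two_pi {φ : Circle ≃ₜ Circle} {F : ℝ → ℝ}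
    (hF : Continuous F) (hanti : StrictAnti F) (hφ : ∀ t, φ (Circle.exp t) = Circle.exp (F t))
    (s : ℝ) : F (s - 2 * Real.pi) = F s + 2 * Real.pi := by
  have hpi := Real.pi_pos
  have h1 : Circle.exp (F (s - 2 * Real.pi)) = Circle.exp (F s) := by
    rw [← hφ, ← hφ, Circle.exp_sub_two_pi]
  obtain ⟨n, hn⟩ := Circle.exp_eq_exp.1 h1
  have h2 : F s < F (s - 2 * Real.pi) := hanti (by linarith)
  have hn0 : 0 < n := by
    by_contra h
    have : (n : ℝ) ≤ 0 := by exact_mod_cast not_lt.1 h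
    nlinarith
  have hn2 : n < 2 := by
    by_contra h
    -- If the lift gained two or more turns, it would pass `F s + 2π` strictly inside the period,
    -- contradicting injectivity of `φ`.
    have h3 : (2 : ℝ) ≤ n := by exact_mod_cast not_lt.1 h
    obtain ⟨t, ⟨ht1, ht2⟩, ht⟩ := intermediate_value_Icc' (a := s - 2 * Real.pi) (b := s)
      (by linarith) hF.continuousOn
      (⟨by linarith, by rw [hn]; nlinarith⟩ : F s + 2 * Real.pi ∈ Set.Icc _ _)
    have h4 : Circle.exp t = Circle.exp s := φ.injective (by
      rw [hφ, hφ, ht, Circle.exp_add_two_pi])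
    obtain ⟨m, hm⟩ := Circle.exp_eq_exp.1 h4
    have hts : t ≠ s := by rintro rfl; linarith
    have hts' : t ≠ s - 2 * Real.pi := by rintro rfl; rw [ht] at hn; nlinarith
    have h5 : (m : ℝ) < 0 := by
      by_contra h
      have : s < t ∨ t = s := by
        rcases (not_lt.1 h).eq_or_lt with h | h
        · right; rw [hm, ← h]; ring
        · left; rw [hm]; nlinarith
      rcases this with h | h
      · linarith
      · exact hts h
    have h6 : (-1 : ℝ) < m := by
      by_contra h
      have h7 : t ≤ s - 2 * Real.pi := by rw [hm]; nlinarith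
      exact hts' (le_antisymm h7 ht1)
    have h5' : m < 0 := by exact_mod_cast h5
    have h6' : -1 < m := by exact_mod_cast h6
    omega
  have : n = 1 := by omega
  rw [hn, this]
  push_cast
  ring

namespace Datum

variable {d : ℕ} {O Y : Type*} [TopologicalSpace O] [TopologicalSpace Y] {D : Datum d O Y}

/-- A homeomorphism of the block after which the gluing maps become complex conjugation. -/
theorem exists_straightening [T2Space Y] (D : Datum d O Y) : ∃ K : D.Block ≃ₜ D.Block,
    (∀ z, K (D.circle 0 z) = D.circle 0 z) ∧ ∀ i z, K (D.circle i.succ z) = D.μ i z⁻¹ := by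
  have key : ∀ S : Finset (Fin d), ∃ K : D.Block ≃ₜ D.Block,
      (∀ z, K (D.circle 0 z) = D.circle 0 z) ∧
      ∀ i z, K (D.circle i.succ z) = if i ∈ S then D.μ i z⁻¹ else D.circle i.succ z := by
    intro S
    induction S using Finset.induction_on with
    | empty => exact ⟨1, fun _ => rfl, fun _ _ => rfl⟩
    | insert a S ha ih =>
      obtain ⟨K, hK0, hK⟩ := ih
      obtain ⟨F, hF, hanti, hφ⟩ := D.reversesOrientation_glue a
      -- The angle of `glue a` at the inverse of `exp t` is `F (-t)`, which increases with `t`. Its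
      -- displacement `F (-t) - t` is periodic because `F` has degree -1.
      obtain ⟨L, hL, hL'⟩ := exists_collar_twist (D := D) (P := fun t => F (-t) - t)
        ((hF.comp continuous_neg).sub continuous_id) (fun t => by
          have := ReversesOrientation.lift_sub_two_pi hF hanti hφ (-t)
          beta_reduce
          rw [neg_add', this]
          ring) (fun s t hst => by
          have := hanti (neg_lt_neg hst)
          simpa using this) a.succ
      refine ⟨L.trans K, fun z => ?_, fun i z => ?_⟩
      · change K (L _) = _
        rw [hL' 0 (Fin.succ_ne_zero a).symm, hK0]
      · change K (L _) = _
        by_cases hi : i = a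
        · subst hi
          rw [if_pos (Finset.mem_insert_self _ _)]
          obtain ⟨t, rfl⟩ := Circle.exp_surjective z
          rw [hL, hK, if_neg ha, ← Circle.exp_neg, μ, hφ]
          congr 2
          ring
        · rw [hL' i.succ (fun h => hi (Fin.succ_injective _ h)), hK]
          simp [hi]
  obtain ⟨K, h1, h2⟩ := key Finset.univ
  exact ⟨K, h1, fun i z => by rw [h2, if_pos (Finset.mem_univ _)]⟩

end Datum

namespace Datum

variable {d : ℕ} {O Y : Type*} [TopologicalSpace O] [TopologicalSpace Y] {D : Datum d O Y}

/-! ### Permuting the lower boundary circles of a block -/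

theorem circle_exp_eq_chartB (i : Fin (d + 1)) (t : ℝ) :
    D.circle i (Circle.exp t) = D.chartB ((i : ℕ) + Complex.exp (t * Complex.I) / 4) := by
  rw [circle_eq_chartB, Circle.coe_exp]

/-- A half twist about the midpoint of two consecutive centres. Their holes lie within 3/4 of it,
while the other centres are at distance at least 3/2, so a support of radius 7/8 misses their holes.
-/
theorem exists_rotating_swap [T2Space Y] (a b : Fin (d + 1)) (hab : (b : ℕ) = a + 1) :
    ∃ h : D.Block ≃ₜ D.Block,
      (∀ t : ℝ, h (D.circle a (Circle.exp t)) = D.circle b (Circle.exp (t + Real.pi))) ∧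
      (∀ t : ℝ, h (D.circle b (Circle.exp t)) = D.circle a (Circle.exp (t + Real.pi))) ∧
      ∀ j, j ≠ a → j ≠ b → ∀ z, h (D.circle j z) = D.circle j z := by
  obtain ⟨T, hT1, hT2, hT3⟩ := exists_halfTwist (by norm_num : (3 / 4 : ℝ) < 7 / 8)
    ((a : ℕ) + 1 / 2 : ℂ)
  set c : ℂ := (a : ℕ) + 1 / 2 with hc
  have hba : ((b : ℕ) : ℂ) = (a : ℕ) + 1 := by rw [hab]; push_cast; rfl
  have hhalf : ‖(1 / 2 : ℂ)‖ = 1 / 2 := by norm_num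
  have hca : ∀ z : ℂ, ‖z - c‖ ≤ ‖z - (a : ℕ)‖ + 1 / 2 ∧ ‖z - c‖ ≤ ‖z - (b : ℕ)‖ + 1 / 2 := by
    intro z
    have h1 := norm_sub_le (z - (a : ℕ)) (1 / 2)
    have h2 := norm_add_le (z - (b : ℕ)) (1 / 2)
    rw [hhalf] at h1 h2
    have e1 : z - (a : ℕ) - 1 / 2 = z - c := by rw [hc]; ring
    have e2 : z - (b : ℕ) + 1 / 2 = z - c := by rw [hc, hba]; ring
    rw [e1] at h1
    rw [e2] at h2
    exact ⟨h1, h2⟩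
  have hfar : ∀ j : Fin (d + 1), j ≠ a → j ≠ b → ∀ z : ℂ, 3 / 2 ≤ ‖z - c‖ + ‖z - (j : ℕ)‖ := by
    intro j hja hjb z
    have h1 : (3 / 2 : ℝ) ≤ ‖(c - (j : ℕ) : ℂ)‖ := by
      have h4 : c - (j : ℕ) = (((a : ℕ) + 1 / 2 - (j : ℕ) : ℝ) : ℂ) := by rw [hc]; push_cast; ring
      rw [h4, Complex.norm_real, Real.norm_eq_abs, le_abs]
      have hja' : (j : ℕ) ≠ a := fun h => hja (Fin.ext h)
      have hjb' : (j : ℕ) ≠ b := fun h => hjb (Fin.ext h)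
      rcases lt_or_gt_of_ne hja' with h | h
      · left
        have : ((j : ℕ) : ℝ) + 1 ≤ (a : ℕ) := by exact_mod_cast h
        linarith
      · right
        have : ((a : ℕ) : ℝ) + 2 ≤ (j : ℕ) := by
          have : (a : ℕ) + 2 ≤ j := by omega
          exact_mod_cast this
        linarith
    have h2 := norm_sub_le_norm_sub_add_norm_sub c z (j : ℕ)
    rw [norm_sub_rev c z] at h2
    linarith
  obtain ⟨h, hh⟩ := exists_block_homeo (D := D) T c _ hT2 (by
    intro z
    rcases le_or_gt (7 / 8) ‖z - c‖ with hz | hz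
    · rw [hT2 z hz]
    have hothers : ∀ w : ℂ, ‖w - c‖ < 7 / 8 → ∀ j : Fin (d + 1), j ≠ a → j ≠ b →
        1 / 4 ≤ ‖w - (j : ℕ)‖ := fun w hw j hja hjb => by
      have := hfar j hja hjb w
      linarith
    have hiff : ∀ w : ℂ, ‖w - c‖ < 7 / 8 → (w ∈ planarBlock d ↔
        1 / 4 ≤ ‖w - (a : ℕ)‖ ∧ 1 / 4 ≤ ‖w - (b : ℕ)‖) := by
      refine fun w hw => ⟨fun h => ⟨h a, h b⟩, fun h j => ?_⟩
      by_cases hja : j = a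
      · exact hja ▸ h.1
      by_cases hjb : j = b
      · exact hjb ▸ h.2
      exact hothers w hw j hja hjb
    rw [hiff z hz, hiff (T z) (by rw [hT3]; exact hz)]
    rcases le_or_gt ‖z - c‖ (3 / 4) with hz' | hz'
    · rw [hT1 z hz']
      have e1 : c - (z - c) - (a : ℕ) = -(z - (b : ℕ)) := by rw [hc, hba]; ring
      have e2 : c - (z - c) - (b : ℕ) = -(z - (a : ℕ)) := by rw [hc, hba]; ring
      rw [e1, e2, norm_neg, norm_neg, and_comm]
    · have h1 := hca z
      have h2 := hca (T z)
      rw [hT3] at h2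
      constructor
      · intro _; constructor <;> linarith
      · intro _; constructor <;> linarith)
  have hexp : ∀ t : ℝ, Complex.exp ((t + Real.pi : ℝ) * Complex.I)
      = -Complex.exp (t * Complex.I) := by
    intro t
    push_cast
    rw [add_mul, Complex.exp_add, Complex.exp_pi_mul_I]
    ring
  have hn : ∀ t : ℝ, ‖Complex.exp (t * Complex.I) / 4‖ = 1 / 4 := fun t => by
    rw [norm_div, Complex.norm_exp_ofReal_mul_I]; norm_num
  refine ⟨h, fun t => ?_, fun t => ?_, fun j hja hjb z => ?_⟩
  · have hm := circle_mem_planarBlock a (Circle.exp t)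
    rw [Circle.coe_exp] at hm
    rw [circle_exp_eq_chartB, hh _ hm, hT1, circle_exp_eq_chartB, hexp, hc, hba]
    · congr 1; ring
    · have h1 := (hca ((a : ℕ) + Complex.exp (t * Complex.I) / 4)).1
      rw [add_sub_cancel_left, hn] at h1
      linarith
  · have hm := circle_mem_planarBlock b (Circle.exp t)
    rw [Circle.coe_exp] at hm
    rw [circle_exp_eq_chartB, hh _ hm, hT1, circle_exp_eq_chartB, hexp, hc, hba]
    · congr 1; ring
    · have h1 := (hca ((b : ℕ) + Complex.exp (t * Complex.I) / 4)).2
      rw [add_sub_cancel_left, hn] at h1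
      linarith
  · rw [circle_eq_chartB, hh _ (circle_mem_planarBlock _ _), hT2]
    have h1 := hfar j hja hjb ((j : ℕ) + (z : ℂ) / 4)
    rw [add_sub_cancel_left, norm_div, Circle.norm_coe] at h1
    norm_num at h1
    linarith

theorem exists_half_collar_twist [T2Space Y] (i : Fin (d + 1)) :
    ∃ h : D.Block ≃ₜ D.Block,
      (∀ t : ℝ, h (D.circle i (Circle.exp t)) = D.circle i (Circle.exp (t + Real.pi))) ∧
      ∀ j, j ≠ i → ∀ z, h (D.circle j z) = D.circle j z :=
  exists_collar_twist (P := fun _ => Real.pi) continuous_const (fun _ => rfl)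
    (fun s t h => by simpa using h) i

/-- The half twist also rotates the two circles by `π`; a further collar twist by `π` at each
restores the parametrization. -/
theorem exists_circle_swap [T2Space Y] (a b : Fin (d + 1)) (hab : (b : ℕ) = a + 1) :
    ∃ h : D.Block ≃ₜ D.Block, ∀ j z, h (D.circle j z) = D.circle (Equiv.swap a b j) z := by
  have hne : a ≠ b := fun h => by rw [h] at hab; omega
  obtain ⟨h, h1, h2, h3⟩ := exists_rotating_swap (D := D) a b hab
  obtain ⟨p, p1, p2⟩ := exists_half_collar_twist (D := D) a
  obtain ⟨q, q1, q2⟩ := exists_half_collar_twist (D := D) b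
  refine ⟨h.trans (p.trans q), fun j z => ?_⟩
  change q (p (h _)) = _
  have e : ∀ t : ℝ, Circle.exp (t + Real.pi + Real.pi) = Circle.exp t := fun t => by
    rw [add_assoc, ← two_mul, Circle.exp_add_two_pi]
  by_cases hja : j = a
  · subst hja
    obtain ⟨t, rfl⟩ := Circle.exp_surjective z
    rw [h1, p2 b hne.symm, q1, e, Equiv.swap_apply_left]
  by_cases hjb : j = b
  · subst hjb
    obtain ⟨t, rfl⟩ := Circle.exp_surjective z
    rw [h2, p1, q2 a hne, e, Equiv.swap_apply_right]
  rw [h3 j hja hjb, p2 j hja, q2 j hjb, Equiv.swap_apply_of_ne_of_ne hja hjb]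

/-- Conjugation by the straightening turns compatibility with the standard circle coordinates into
compatibility with the `μ_i`; the two inversions cancel. -/
theorem exists_homeoBlock_perm_apply [T2Space Y] (a b : Fin d) (hab : (b : ℕ) = a + 1) :
    ∃ k : D.homeoBlock, D.permHom k a = b := by
  obtain ⟨h, hh⟩ := exists_circle_swap (D := D) a.succ b.succ (by simp [hab])
  obtain ⟨K, hK0, hK⟩ := exists_straightening D
  have hK0' : ∀ z, K.symm (D.circle 0 z) = D.circle 0 z := fun z =>
    (Homeomorph.symm_apply_eq K).2 (hK0 z).symm
  have hK' : ∀ i z, K.symm (D.μ i z) = D.circle i.succ z⁻¹ := fun i z =>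
    (Homeomorph.symm_apply_eq K).2 (by rw [hK, inv_inv])
  have hμ : ∀ i z, K (h (K.symm (D.μ i z))) = D.μ (Equiv.swap a b i) z := fun i z => by
    rw [hK', hh, ← (Fin.succ_injective d).map_swap, hK, inv_inv]
  refine ⟨⟨K.symm.trans (h.trans K), fun z => ?_, Equiv.swap a b, hμ⟩,
    permHom_apply_eq (z := 1) (z' := 1) ?_⟩
  · change K (h (K.symm _)) = _
    rw [hK0', hh, Equiv.swap_apply_of_ne_of_ne (Fin.succ_ne_zero a).symm (Fin.succ_ne_zero b).symm,
      hK0]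
  · change K (h (K.symm _)) = _
    rw [hμ, Equiv.swap_apply_left]

/-! ### Rigid moves between siblings. -/

theorem image_ball_portrait (κ : List (Fin d) → D.homeoBlock) (n : ℕ) :
    portrait κ '' D.ball n = D.ball n := by
  have key : ∀ x, portrait κ x ∈ D.ball n ↔ x ∈ D.ball n := by
    have h1 : ∀ κ : List (Fin d) → D.homeoBlock, ∀ x ∈ D.ball n, portrait κ x ∈ D.ball n := by
      rintro κ _ (⟨x, rfl⟩ | hx)
      · exact Or.inl ⟨x, rfl⟩
      · simp only [Set.mem_iUnion] at hx
        obtain ⟨w, hw, y, rfl⟩ := hx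
        rw [portrait_inB]
        exact block_subset_ball.2 (by rw [length_act]; exact hw) ⟨_, rfl⟩
    refine fun x => ⟨fun h => ?_, h1 κ x⟩
    -- The inverse of a portrait is a portrait, so the converse is the same statement for this
    -- family.
    have h2 := h1 (fun w => (κ (actInv κ w))⁻¹) _ h
    convert h2
    have h3 : portrait (fun w => (κ (actInv κ w))⁻¹) * portrait κ = 1 := by
      rw [← portrait_mul]
      ext x
      induction x using surface_induction with
      | hO x => rfl
      | hB w y => simp [actInv_act, act_one]
    exact (DFunLike.congr_fun h3 x).symm
  ext x
  constructor
  · rintro ⟨y, hy, rfl⟩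
    exact (key y).2 hy
  · intro hx
    exact ⟨(portrait κ).symm x, (key _).1 (by rwa [Homeomorph.apply_symm_apply]),
      Homeomorph.apply_symm_apply _ _⟩

section Connected

variable [T2Space O] [PreconnectedSpace O] [T2Space Y] [PreconnectedSpace Y]

theorem isHBlock_portrait {κ : List (Fin d) → D.homeoBlock} {n : ℕ}
    (hκ : ∀ w, n ≤ w.length → κ w = 1) : D.IsHBlock ⊥ (portrait κ) := by
  refine isHBlock_iff.2 ⟨D.ball n, isBlockOn_ball (isSuited_ball n)
    (by rw [image_ball_portrait]; exact isSuited_ball n) fun v hv => ?_⟩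
  refine ⟨act κ v, 1, one_mem _, .of_eq fun u y => ?_⟩
  have h1 : act κ (u ++ v) = u ++ act κ v := by
    induction u with
    | nil => rfl
    | cons i u ih =>
      rw [List.cons_append, act, ih, hκ _ (by simp [hv]), map_one]
      rfl
  rw [portrait_inB, h1, hκ _ (by simp [hv])]
  rfl

/-- Acting by `k` on the block of `w` alone permutes the subtrees below it without acting inside
them. -/
theorem rigidMove_of_perm (k : D.homeoBlock) (i : Fin d) (w : List (Fin d)) :
    D.RigidMove (i :: w) (D.permHom k i :: w) := by
  classical
  let κ : List (Fin d) → D.homeoBlock := fun v => if v = w then k else 1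
  have hκ : ∀ v, v.length ≠ w.length → κ v = 1 := fun v hv => if_neg fun h => hv (congrArg List.length h)
  have hact : ∀ v : List (Fin d), v.length ≤ w.length → act κ v = v := by
    intro v hv
    induction v with
    | nil => rfl
    | cons j v ih =>
      have hv' : v.length < w.length := hv
      rw [act, ih hv'.le, hκ v hv'.ne, map_one]
      rfl
  refine ⟨portrait κ, portrait_inO κ, isHBlock_portrait (n := w.length + 1)
    fun v hv => hκ v (by omega), fun u y => ?_⟩
  have h1 : act κ (u ++ i :: w) = u ++ D.permHom k i :: w := by
    induction u with
    | nil => simp [act, hact, κ]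
    | cons j u ih =>
      rw [List.cons_append, act, ih, hκ _ (by simp; omega), map_one]
      rfl
  rw [portrait_inB, h1, hκ _ (by simp; omega)]
  rfl

theorem rigidMove_siblings (i j : Fin d) (w : List (Fin d)) : D.RigidMove (i :: w) (j :: w) := by
  have key : ∀ n (j : Fin d), (j : ℕ) = n → ∀ i : Fin d, (i : ℕ) ≤ n →
      D.RigidMove (i :: w) (j :: w) := by
    intro n
    induction n with
    | zero =>
      intro j hj i hi
      have : i = j := Fin.ext (by omega)
      rw [this]
      exact .refl _
    | succ n ih =>
      intro j hj i hi
      rcases Nat.le_succ_iff.1 hi with hi | hi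
      · obtain ⟨k, hk⟩ := exists_homeoBlock_perm_apply (D := D) ⟨n, by omega⟩ j hj
        refine (ih ⟨n, by omega⟩ rfl i hi).trans ?_
        have hmove := rigidMove_of_perm k ⟨n, by omega⟩ w
        rwa [hk] at hmove
      · have : i = j := Fin.ext (by omega)
        rw [this]
        exact .refl _
  rcases le_total (i : ℕ) j with h | h
  · exact key _ j rfl i h
  · exact (key _ i rfl j h).symm

end Connected

end Datum
/-! ### Coordinates around two adjacent blocks -/

/-- The Cayley transform. -/
def cayley (p : ℂ) : ℂ := (p - 1) / (p + 1)

/-- The inverse of the Cayley transform. -/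
def cayleyInv (s : ℂ) : ℂ := (1 + s) / (1 - s)

/-- The preimage of the disc of radius `7/10` under the Cayley transform. -/
def cayleyDisc : Set ℂ := {p | ‖p - 1‖ ≤ 7 / 10 * ‖p + 1‖}

/-- The disc of radius `7/10` with the images of two boundary circles removed. -/
def twoHoledDisc : Set ℂ :=
  {s | ‖s‖ ≤ 7 / 10 ∧ ‖1 - s‖ ≤ ‖5 * s - 3‖ ∧ ‖1 + s‖ ≤ ‖5 * s + 3‖}

theorem norm_sq_eq (z : ℂ) : ‖z‖ ^ 2 = z.re ^ 2 + z.im ^ 2 := by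
  rw [← Complex.normSq_eq_norm_sq, Complex.normSq_apply]; ring

theorem norm_le_norm_iff {z w : ℂ} :
    ‖z‖ ≤ ‖w‖ ↔ z.re ^ 2 + z.im ^ 2 ≤ w.re ^ 2 + w.im ^ 2 := by
  rw [← norm_sq_eq, ← norm_sq_eq, sq_le_sq₀ (norm_nonneg _) (norm_nonneg _)]

theorem le_norm_iff {z : ℂ} {r : ℝ} (hr : 0 ≤ r) : r ≤ ‖z‖ ↔ r ^ 2 ≤ z.re ^ 2 + z.im ^ 2 := by
  rw [← norm_sq_eq, sq_le_sq₀ hr (norm_nonneg _)]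

theorem norm_le_iff {z : ℂ} {r : ℝ} (hr : 0 ≤ r) : ‖z‖ ≤ r ↔ z.re ^ 2 + z.im ^ 2 ≤ r ^ 2 := by
  rw [← norm_sq_eq, sq_le_sq₀ (norm_nonneg _) hr]

/-- Squaring exhibits a round disc with real diameter from 3/17 to 17/3. It encloses the circle `‖p
- 4‖ = 1` but stays in `Re p > 0` and `‖p‖ ≤ 6`, away from the remaining holes except the one about
0. -/
theorem mem_cayleyDisc_iff {p : ℂ} :
    p ∈ cayleyDisc ↔ 51 * (p.re ^ 2 + p.im ^ 2) + 51 ≤ 298 * p.re := by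
  have : (7 / 10 * ‖p + 1‖ : ℝ) = ‖(7 / 10 : ℂ) * (p + 1)‖ := by
    rw [norm_mul]; norm_num
  change ‖p - 1‖ ≤ 7 / 10 * ‖p + 1‖ ↔ _
  rw [← sq_le_sq₀ (norm_nonneg _) (by positivity), mul_pow, norm_sq_eq, norm_sq_eq]
  simp only [Complex.sub_re, Complex.sub_im, Complex.add_re, Complex.add_im, Complex.one_re,
    Complex.one_im]
  constructor <;> intro h <;> nlinarith

theorem add_one_ne_zero_of_mem_cayleyDisc {p : ℂ} (hp : p ∈ cayleyDisc) : p + 1 ≠ 0 := by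
  intro h
  have h1 : p = -1 := by linear_combination h
  rw [h1, mem_cayleyDisc_iff] at hp
  norm_num at hp

theorem re_pos_of_mem_cayleyDisc {p : ℂ} (hp : p ∈ cayleyDisc) : 0 < p.re := by
  rw [mem_cayleyDisc_iff] at hp
  nlinarith [sq_nonneg p.re, sq_nonneg p.im]

theorem norm_le_six_of_mem_cayleyDisc {p : ℂ} (hp : p ∈ cayleyDisc) : ‖p‖ ≤ 6 := by
  rw [mem_cayleyDisc_iff] at hp
  rw [norm_le_iff (by norm_num)]
  nlinarith [sq_nonneg (p.re - 6), sq_nonneg p.re, sq_nonneg p.im]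

theorem isClosed_cayleyDisc : IsClosed cayleyDisc :=
  isClosed_le (by fun_prop) (by fun_prop)

theorem norm_cayley_le {p : ℂ} (hp : p ∈ cayleyDisc) : ‖cayley p‖ ≤ 7 / 10 := by
  rw [cayley, norm_div, div_le_iff₀ (norm_pos_iff.2 (add_one_ne_zero_of_mem_cayleyDisc hp))]
  exact hp

theorem one_sub_ne_zero {s : ℂ} (hs : ‖s‖ ≤ 7 / 10) : 1 - s ≠ 0 := by
  intro h
  have h1 : s = 1 := by linear_combination -h
  rw [h1, norm_one] at hs
  norm_num at hs

theorem cayleyInv_cayley {p : ℂ} (hp : p + 1 ≠ 0) : cayleyInv (cayley p) = p := by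
  have h1 : 1 + (p - 1) / (p + 1) = 2 * p / (p + 1) := by field_simp; ring
  have h2 : 1 - (p - 1) / (p + 1) = 2 / (p + 1) := by field_simp; ring
  rw [cayleyInv, cayley, h1, h2]
  field_simp

theorem cayley_cayleyInv {s : ℂ} (hs : 1 - s ≠ 0) : cayley (cayleyInv s) = s := by
  have h1 : (1 + s) / (1 - s) - 1 = 2 * s / (1 - s) := by field_simp; ring
  have h2 : (1 + s) / (1 - s) + 1 = 2 / (1 - s) := by field_simp; ring
  rw [cayleyInv, cayley, h1, h2]
  field_simp

theorem norm_one_add_le_of_re_nonneg {s : ℂ} (hs : 0 ≤ s.re) : ‖1 + s‖ ≤ ‖5 * s + 3‖ := by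
  rw [norm_le_norm_iff]
  simp only [Complex.add_re, Complex.add_im, Complex.mul_re, Complex.mul_im, Complex.one_re,
    Complex.one_im, Complex.re_ofNat, Complex.im_ofNat]
  nlinarith [sq_nonneg s.re, sq_nonneg s.im]

theorem cayley_re_nonneg {p : ℂ} (hp : 1 ≤ ‖p‖) : 0 ≤ (cayley p).re := by
  rw [le_norm_iff zero_le_one] at hp
  rw [cayley, Complex.div_re, ← add_div]
  refine div_nonneg ?_ (Complex.normSq_nonneg _)
  simp only [Complex.sub_re, Complex.sub_im, Complex.add_re, Complex.add_im, Complex.one_re,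
    Complex.one_im]
  nlinarith

/-- With `s = cayley p` one has `p - 4 = (5s - 3) / (1 - s)`, which gives the condition at one hole.
The other hole lies in the left half plane, while `‖p‖ ≥ 1` forces `Re s ≥ 0`. -/
theorem cayley_mem {p : ℂ} (hp : p ∈ cayleyDisc) (h1 : 1 ≤ ‖p‖) (h4 : 1 ≤ ‖p - 4‖) :
    cayley p ∈ twoHoledDisc := by
  have h0 := add_one_ne_zero_of_mem_cayleyDisc hp
  refine ⟨norm_cayley_le hp, ?_, norm_one_add_le_of_re_nonneg (cayley_re_nonneg h1)⟩
  have e1 : 1 - cayley p = 2 / (p + 1) := by rw [cayley]; field_simp; ring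
  have e2 : 5 * cayley p - 3 = 2 / (p + 1) * (p - 4) := by rw [cayley]; field_simp; ring
  rw [e1, e2, norm_mul]
  exact le_mul_of_one_le_right (norm_nonneg _) h4

theorem cayleyInv_mem {s : ℂ} (hs : s ∈ twoHoledDisc) (hre : 0 ≤ s.re) :
    cayleyInv s ∈ cayleyDisc ∧ 1 ≤ ‖cayleyInv s‖ ∧ 1 ≤ ‖cayleyInv s - 4‖ := by
  obtain ⟨h1, h2, -⟩ := hs
  have h0 := one_sub_ne_zero h1
  have h0' : 0 < ‖1 - s‖ := norm_pos_iff.2 h0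
  refine ⟨?_, ?_, ?_⟩
  · have e1 : cayleyInv s - 1 = 2 / (1 - s) * s := by rw [cayleyInv]; field_simp; ring
    have e2 : cayleyInv s + 1 = 2 / (1 - s) := by rw [cayleyInv]; field_simp; ring
    change ‖_‖ ≤ _ * ‖_‖
    rw [e1, e2, norm_mul, mul_comm]
    exact mul_le_mul_of_nonneg_right h1 (norm_nonneg _)
  · rw [cayleyInv, norm_div, one_le_div h0', norm_le_norm_iff]
    simp only [Complex.add_re, Complex.add_im, Complex.sub_re, Complex.sub_im, Complex.one_re,
      Complex.one_im]
    nlinarith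
  · have e1 : cayleyInv s - 4 = (5 * s - 3) / (1 - s) := by rw [cayleyInv]; field_simp; ring
    rw [e1, norm_div, one_le_div h0']
    exact h2

theorem neg_mem_twoHoledDisc {s : ℂ} : -s ∈ twoHoledDisc ↔ s ∈ twoHoledDisc := by
  have h : ∀ s ∈ twoHoledDisc, -s ∈ twoHoledDisc := by
    rintro s ⟨h1, h2, h3⟩
    refine ⟨by rwa [norm_neg], ?_, ?_⟩
    · have e1 : 1 - -s = 1 + s := by ring
      have e2 : 5 * -s - 3 = -(5 * s + 3) := by ring
      rw [e1, e2, norm_neg]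
      exact h3
    · have e1 : 1 + -s = 1 - s := by ring
      have e2 : 5 * -s + 3 = -(5 * s - 3) := by ring
      rw [e1, e2, norm_neg]
      exact h2
  exact ⟨fun hs => neg_neg s ▸ h _ hs, h s⟩

/-- The right hole has real diameter from 1/2 to 2/3. With `r = ‖s‖`, its condition is `24 r² - 28
Re s + 8 ≥ 0`, and `Re s ≤ r` bounds the left side below by `4 (2r - 1)(3r - 2)`. -/
theorem mem_twoHoledDisc_of_norm {s : ℂ} (h1 : 2 / 3 ≤ ‖s‖) (h2 : ‖s‖ ≤ 7 / 10) :
    s ∈ twoHoledDisc := by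
  have hre := abs_le.1 (Complex.abs_re_le_norm s)
  have hsq := norm_sq_eq s
  have hquad : 0 ≤ (2 * ‖s‖ - 1) * (3 * ‖s‖ - 2) := by
    apply mul_nonneg <;> linarith
  refine ⟨h2, ?_, ?_⟩
  · rw [norm_le_norm_iff]
    simp only [Complex.sub_re, Complex.sub_im, Complex.mul_re,
      Complex.mul_im, Complex.one_re, Complex.one_im, Complex.re_ofNat, Complex.im_ofNat]
    nlinarith
  · rw [norm_le_norm_iff]
    simp only [Complex.add_re, Complex.add_im, Complex.mul_re,
      Complex.mul_im, Complex.one_re, Complex.one_im, Complex.re_ofNat, Complex.im_ofNat]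
    nlinarith

/-- A homeomorphism of the plane that rotates a large disc inside the disc of radius `7/10` by a
half turn and is the identity outside. -/
structure IsHalfTurn (T : ℂ ≃ₜ ℂ) : Prop where
  inner : ∀ s, ‖s‖ ≤ 68 / 100 → T s = -s
  outer : ∀ s, 7 / 10 ≤ ‖s‖ → T s = s
  norm : ∀ s, ‖T s‖ = ‖s‖

theorem exists_isHalfTurn : ∃ T : ℂ ≃ₜ ℂ, IsHalfTurn T := by
  obtain ⟨T, h1, h2, h3⟩ := exists_halfTwist (by norm_num : (68 / 100 : ℝ) < 7 / 10) 0
  simp only [sub_zero, zero_sub] at h1 h2 h3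
  exact ⟨T, h1, h2, h3⟩

theorem IsHalfTurn.symm {T : ℂ ≃ₜ ℂ} (hT : IsHalfTurn T) : IsHalfTurn T.symm := by
  refine ⟨fun s hs => ?_, fun s hs => ?_, fun s => ?_⟩
  · rw [Homeomorph.symm_apply_eq, hT.inner _ (by rwa [norm_neg]), neg_neg]
  · rw [Homeomorph.symm_apply_eq, hT.outer s hs]
  · rw [← hT.norm, Homeomorph.apply_symm_apply]

theorem IsHalfTurn.mem {T : ℂ ≃ₜ ℂ} (hT : IsHalfTurn T) {s : ℂ} (hs : s ∈ twoHoledDisc) :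
    T s ∈ twoHoledDisc := by
  rcases le_or_gt ‖s‖ (68 / 100) with h | h
  · rw [hT.inner s h]
    exact neg_mem_twoHoledDisc.2 hs
  · refine mem_twoHoledDisc_of_norm ?_ ?_
    · rw [hT.norm]; linarith
    · rw [hT.norm]; exact hs.1

/-- The boundary of the right hole reaches only radius 2/3, so it lies in the region of radius
68/100 where the turn is exactly `s ↦ -s`. -/
theorem four_add_mem_cayleyDisc (v : Circle) :
    (4 + v : ℂ) ∈ cayleyDisc ∧ ‖cayley (4 + v)‖ ≤ 68 / 100 := by
  have hv := norm_sq_eq v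
  rw [Circle.norm_coe] at hv
  have hre := abs_le.1 (Complex.abs_re_le_norm v)
  rw [Circle.norm_coe] at hre
  have h1 : (4 + v : ℂ) ∈ cayleyDisc := by
    rw [mem_cayleyDisc_iff]
    simp only [Complex.add_re, Complex.add_im, Complex.re_ofNat, Complex.im_ofNat]
    nlinarith
  refine ⟨h1, ?_⟩
  rw [cayley, norm_div, div_le_iff₀ (norm_pos_iff.2 (add_one_ne_zero_of_mem_cayleyDisc h1)),
    ← sq_le_sq₀ (norm_nonneg _) (by positivity), mul_pow, norm_sq_eq, norm_sq_eq]
  simp only [Complex.sub_re, Complex.sub_im, Complex.add_re, Complex.add_im, Complex.one_re,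
    Complex.one_im, Complex.re_ofNat, Complex.im_ofNat]
  nlinarith

/-- The holes about 1 and 2 are excluded by hypothesis, the one about 0 by `Re p > 0`, and those
about 3 and beyond by `‖p‖ ≤ 6`. -/
theorem parent_mem_planarBlock {d : ℕ} {p : ℂ} (hp : p ∈ cayleyDisc) (h1 : 1 ≤ ‖p‖)
    (h4 : 1 ≤ ‖p - 4‖) : 1 + p / 4 ∈ planarBlock d := by
  rintro ⟨i, hi⟩
  have h6 := norm_le_six_of_mem_cayleyDisc hp
  have hre := re_pos_of_mem_cayleyDisc hp
  match i, hi with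
  | 0, _ =>
    refine le_trans ?_ (Complex.re_le_norm _)
    simp
    linarith
  | 1, _ =>
    have : 1 + p / 4 - ((1 : ℕ) : ℂ) = p / 4 := by push_cast; ring
    rw [this, norm_div]
    norm_num
    linarith
  | 2, _ =>
    have : 1 + p / 4 - ((2 : ℕ) : ℂ) = (p - 4) / 4 := by push_cast; ring
    rw [this, norm_div]
    norm_num
    linarith
  | i + 3, _ =>
    have h2 : ((i + 2 : ℕ) : ℂ) = p / 4 - (1 + p / 4 - ((i + 3 : ℕ) : ℂ)) := by push_cast; ring
    have h3 := norm_sub_le (p / 4) (1 + p / 4 - ((i + 3 : ℕ) : ℂ))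
    rw [← h2, Complex.norm_natCast, norm_div] at h3
    norm_num at h3 ⊢
    linarith

theorem child_mem_planarBlock {d : ℕ} {q : ℂ} (hq : q ∈ cayleyDisc) (h1 : 1 ≤ ‖q‖)
    (h4 : 1 ≤ ‖q - 4‖) : q / 4 ∈ planarBlock d := by
  rintro ⟨i, hi⟩
  have h6 := norm_le_six_of_mem_cayleyDisc hq
  match i, hi with
  | 0, _ =>
    simp
    linarith
  | 1, _ =>
    have : q / 4 - ((1 : ℕ) : ℂ) = (q - 4) / 4 := by push_cast; ring
    rw [this, norm_div]
    norm_num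
    linarith
  | i + 2, _ =>
    have h2 : ((i + 2 : ℕ) : ℂ) = q / 4 - (q / 4 - ((i + 2 : ℕ) : ℂ)) := by ring
    have h3 := norm_sub_le (q / 4) (q / 4 - ((i + 2 : ℕ) : ℂ))
    rw [← h2, Complex.norm_natCast, norm_div] at h3
    norm_num at h3 ⊢
    linarith

theorem norm_of_parent_mem {d : ℕ} (hd : 2 ≤ d) {p : ℂ} (hp : 1 + p / 4 ∈ planarBlock d) :
    1 ≤ ‖p‖ ∧ 1 ≤ ‖p - 4‖ := by
  have h1 := hp ⟨1, by omega⟩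
  have h2 := hp ⟨2, by omega⟩
  have e1 : 1 + p / 4 - ((1 : ℕ) : ℂ) = p / 4 := by push_cast; ring
  have e2 : 1 + p / 4 - ((2 : ℕ) : ℂ) = (p - 4) / 4 := by push_cast; ring
  rw [e1, norm_div] at h1
  rw [e2, norm_div] at h2
  norm_num at h1 h2
  constructor <;> linarith

theorem norm_of_child_mem {d : ℕ} (hd : 2 ≤ d) {q : ℂ} (hq : q / 4 ∈ planarBlock d) :
    1 ≤ ‖q‖ ∧ 1 ≤ ‖q - 4‖ := by
  have h1 := hq ⟨0, by omega⟩
  have h2 := hq ⟨1, by omega⟩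
  have e1 : q / 4 - ((0 : ℕ) : ℂ) = q / 4 := by push_cast; ring
  have e2 : q / 4 - ((1 : ℕ) : ℂ) = (q - 4) / 4 := by push_cast; ring
  rw [e1, norm_div] at h1
  rw [e2, norm_div] at h2
  norm_num at h1 h2
  constructor <;> linarith

/-! ### Maps on the block prescribed in its chart. -/

namespace Datum

variable {d : ℕ} {O Y : Type*} [TopologicalSpace O] [TopologicalSpace Y] {D : Datum d O Y}

/-- The map on the block equal to `G` in the chart and to `f` outside the chart. -/
def glueChart {X : Type*} (G : ℂ → X) (f : D.Block → X) (y : D.Block) : X :=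
  open Classical in if h : ∃ z ∈ planarBlock d, D.chartB z = y then G h.choose else f y

theorem glueChart_chartB {X : Type*} (G : ℂ → X) (f : D.Block → X) {z : ℂ}
    (hz : z ∈ planarBlock d) : glueChart G f (D.chartB z) = G z := by
  have h : ∃ z' ∈ planarBlock d, D.chartB z' = D.chartB z := ⟨z, hz, rfl⟩
  rw [glueChart, dif_pos h, chartB_injOn h.choose_spec.1 hz h.choose_spec.2]

theorem glueChart_of_not {X : Type*} (G : ℂ → X) (f : D.Block → X) {y : D.Block}
    (hy : ¬ ∃ z ∈ planarBlock d, D.chartB z = y) : glueChart G f y = f y := dif_neg hy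

theorem exists_chartB_eq {y : D.Block} {z : ℂ} (h : D.chartY z = y) :
    z ∈ planarBlock d ∧ D.chartB z = y := by
  have hz : z ∈ planarBlock d := D.chartY_mem_Block.1 (h ▸ y.2)
  exact ⟨hz, Subtype.ext ((coe_chartB hz).trans h)⟩

theorem continuous_glueChart [T2Space Y] {X : Type*} [TopologicalSpace X] {G : ℂ → X}
    {f : D.Block → X} (hG : ContinuousOn G (planarBlock d)) (hf : Continuous f) {C : Set ℂ}
    (hC : IsCompact C) (hGf : ∀ z ∈ planarBlock d, z ∉ C → G z = f (D.chartB z)) :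
    Continuous (glueChart G f) := by
  rw [continuous_iff_continuousAt]
  intro y
  by_cases hy : ∃ z ∈ planarBlock d, D.chartB z = y
  · have hopen : IsOpen {y : D.Block | (y : Y) ∈ Set.range D.chartY} :=
      D.isOpenEmbedding_chartY.isOpen_range.preimage continuous_subtype_val
    obtain ⟨z, hz, rfl⟩ := hy
    let e := D.isOpenEmbedding_chartY.toOpenPartialHomeomorph D.chartY
    have he : ContinuousAt e.symm (D.chartB z : Y) := by
      refine e.continuousAt_symm ?_
      rw [coe_chartB hz]
      exact ⟨z, Set.mem_univ z, rfl⟩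
    have hes : ∀ z, e.symm (D.chartY z) = z := fun z => e.left_inv (Set.mem_univ z)
    have hmem : {y : D.Block | (y : Y) ∈ Set.range D.chartY} ∈ nhds (D.chartB z) := by
      refine hopen.mem_nhds ?_
      change (D.chartB z : Y) ∈ Set.range D.chartY
      rw [coe_chartB hz]
      exact ⟨z, rfl⟩
    have h1 : Filter.Tendsto (fun y : D.Block => e.symm (y : Y)) (nhds (D.chartB z))
        (nhdsWithin z (planarBlock d)) := by
      refine tendsto_nhdsWithin_iff.2 ⟨?_, ?_⟩
      · have := he.tendsto.comp (continuous_subtype_val.tendsto (D.chartB z))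
        rwa [coe_chartB hz, hes] at this
      · filter_upwards [hmem] with y hy
        obtain ⟨z', hz'⟩ := hy
        rw [← hz', hes]
        exact (exists_chartB_eq hz').1
    have h2 := (hG z hz).tendsto.comp h1
    unfold ContinuousAt
    rw [glueChart_chartB G f hz]
    refine h2.congr' ?_
    filter_upwards [hmem] with y hy
    obtain ⟨z', hz'⟩ := hy
    obtain ⟨h3, rfl⟩ := exists_chartB_eq hz'
    rw [glueChart_chartB G f h3, Function.comp, coe_chartB h3, hes]
  · refine hf.continuousAt.congr ?_
    have hcl : IsClosed (D.chartY '' C) := (hC.image D.isOpenEmbedding_chartY.continuous).isClosed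
    have hy' : (y : Y) ∉ D.chartY '' C := fun ⟨z, _, h⟩ => hy ⟨z, exists_chartB_eq h⟩
    filter_upwards [(hcl.isOpen_compl.preimage continuous_subtype_val).mem_nhds hy'] with x hx
    by_cases hx' : ∃ z ∈ planarBlock d, D.chartB z = x
    · obtain ⟨z, hz, rfl⟩ := hx'
      rw [glueChart_chartB G f hz, hGf z hz]
      intro hzC
      exact hx ⟨z, hzC, (coe_chartB hz).symm⟩
    · rw [glueChart_of_not _ _ hx']

end Datum
theorem cayley_re_pos {p : ℂ} (hp : 1 < ‖p‖) : 0 < (cayley p).re := by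
  have h1 : p + 1 ≠ 0 := fun h => by
    have : p = -1 := by linear_combination h
    rw [this, norm_neg, norm_one] at hp
    exact lt_irrefl _ hp
  have h2 : 1 < p.re ^ 2 + p.im ^ 2 := by rw [← norm_sq_eq]; nlinarith
  rw [cayley, Complex.div_re, ← add_div]
  refine div_pos ?_ (Complex.normSq_pos.2 h1)
  simp only [Complex.sub_re, Complex.sub_im, Complex.add_re, Complex.add_im, Complex.one_re,
    Complex.one_im]
  nlinarith

theorem isClosed_twoHoledDisc : IsClosed twoHoledDisc :=
  (isClosed_le continuous_norm continuous_const).inter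
    ((isClosed_le (f := fun s : ℂ => ‖1 - s‖) (g := fun s => ‖5 * s - 3‖) (by fun_prop)
      (by fun_prop)).inter
    (isClosed_le (f := fun s : ℂ => ‖1 + s‖) (g := fun s => ‖5 * s + 3‖) (by fun_prop)
      (by fun_prop)))

theorem isClosed_planarBlock (d : ℕ) : IsClosed (planarBlock d) := by
  have : planarBlock d = ⋂ i : Fin (d + 1), {z : ℂ | 1 / 4 ≤ ‖z - (i : ℕ)‖} := by
    ext; simp [planarBlock]
  rw [this]
  exact isClosed_iInter fun i => isClosed_le (by fun_prop) (by fun_prop)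

theorem isCompact_cayleyDisc : IsCompact cayleyDisc :=
  Metric.isCompact_of_isClosed_isBounded isClosed_cayleyDisc
    (isBounded_iff_forall_norm_le.2 ⟨6, fun _ h => norm_le_six_of_mem_cayleyDisc h⟩)

theorem continuousOn_cayleyInv : ContinuousOn cayleyInv {s | ‖s‖ ≤ 7 / 10} :=
  ContinuousOn.div (by fun_prop) (by fun_prop) fun _ hs => one_sub_ne_zero hs

theorem continuousOn_cayley : ContinuousOn cayley cayleyDisc :=
  ContinuousOn.div (by fun_prop) (by fun_prop) fun _ hs => add_one_ne_zero_of_mem_cayleyDisc hs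

theorem inv_mem_cayleyDisc {z : Circle} :
    ((z⁻¹ : Circle) : ℂ) ∈ cayleyDisc ↔ (z : ℂ) ∈ cayleyDisc := by
  have hz := norm_sq_eq z
  rw [Circle.norm_coe] at hz
  rw [mem_cayleyDisc_iff, mem_cayleyDisc_iff, Circle.coe_inv_eq_conj]
  simp only [Complex.conj_re, Complex.conj_im, neg_sq]

/-- After straightening, parent and child are glued by inversion of the unit circle; so `cayley p`
and `-cayley q` agree along the seam. -/
theorem cayley_inv (z : Circle) : cayley (z⁻¹ : Circle) = -cayley z := by
  have h0 : (z : ℂ) ≠ 0 := Circle.coe_ne_zero z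
  rw [Circle.coe_inv, cayley, cayley]
  by_cases h : (z : ℂ) + 1 = 0
  · have : (z : ℂ) = -1 := by linear_combination h
    rw [this]
    norm_num
  · have h1 : (z : ℂ)⁻¹ - 1 = (z : ℂ)⁻¹ * (1 - z) := by field_simp
    have h2 : (z : ℂ)⁻¹ + 1 = (z : ℂ)⁻¹ * (z + 1) := by field_simp; ring
    rw [h1, h2, mul_div_mul_left _ _ (inv_ne_zero h0), ← neg_sub, neg_div]

/-- The half of the two-holed disc that lies in one of the two blocks. -/
def overlap : Set ℂ := {p | p ∈ cayleyDisc ∧ 1 ≤ ‖p‖ ∧ 1 ≤ ‖p - 4‖}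

theorem cayley_or_neg_cayley {s : ℂ} (hs : s ∈ twoHoledDisc) :
    (∃ p ∈ overlap, s = cayley p) ∨ ∃ q ∈ overlap, s = -cayley q := by
  rcases le_total 0 s.re with h | h
  · exact Or.inl ⟨_, cayleyInv_mem hs h, (cayley_cayleyInv (one_sub_ne_zero hs.1)).symm⟩
  · have hs' := neg_mem_twoHoledDisc.2 hs
    refine Or.inr ⟨_, cayleyInv_mem hs' (by simpa using h), ?_⟩
    rw [cayley_cayleyInv (one_sub_ne_zero hs'.1), neg_neg]

/-! ### Exchange of two subtrees of words. -/

/-- The exchange of the words `b :: w` and `a :: a :: w` and of their descendants. -/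
def wordSwap {d : ℕ} (a b : Fin d) (w : List (Fin d)) : List (Fin d) → List (Fin d)
  | [] => []
  | i :: x => if i = b ∧ x = w then a :: a :: w else
      if i = a ∧ x = a :: w then b :: w else i :: wordSwap a b w x

section WordSwap

variable {d : ℕ} {a b : Fin d} {w : List (Fin d)}

theorem wordSwap_cons {i : Fin d} {x : List (Fin d)} (h1 : x ≠ w) (h2 : x ≠ a :: w) :
    wordSwap a b w (i :: x) = i :: wordSwap a b w x := by
  rw [wordSwap, if_neg fun h => h1 h.2, if_neg fun h => h2 h.2]

theorem wordSwap_of_length_le {x : List (Fin d)} (h : x.length ≤ w.length) :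
    wordSwap a b w x = x := by
  induction x with
  | nil => rfl
  | cons i x ih =>
    simp only [List.length_cons] at h
    rw [wordSwap_cons, ih (by omega)]
    · rintro rfl; omega
    · rintro rfl; simp at h

theorem wordSwap_cons_self {i : Fin d} (hi : i ≠ b) : wordSwap a b w (i :: w) = i :: w := by
  rw [wordSwap, if_neg fun h => hi h.1, if_neg fun h => (List.cons_ne_self _ _ h.2.symm),
    wordSwap_of_length_le le_rfl]

theorem wordSwap_right : wordSwap a b w (b :: w) = a :: a :: w := by
  rw [wordSwap, if_pos ⟨rfl, rfl⟩]

theorem wordSwap_left : wordSwap a b w (a :: a :: w) = b :: w := by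
  rw [wordSwap, if_neg fun h => (List.cons_ne_self _ _ h.2), if_pos ⟨rfl, rfl⟩]

theorem wordSwap_cons_cons {i : Fin d} (hab : a ≠ b) (hi : i ≠ a) :
    wordSwap a b w (i :: a :: w) = i :: a :: w := by
  rw [wordSwap, if_neg fun h => (List.cons_ne_self _ _ h.2), if_neg fun h => hi h.1,
    wordSwap_cons_self hab]

theorem wordSwap_wordSwap (hab : a ≠ b) (x : List (Fin d)) :
    wordSwap a b w (wordSwap a b w x) = x := by
  induction x with
  | nil => rfl
  | cons i x ih =>
    by_cases h1 : x = w
    · subst h1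
      by_cases hi : i = b
      · subst hi; rw [wordSwap_right, wordSwap_left]
      · rw [wordSwap_cons_self hi, wordSwap_cons_self hi]
    by_cases h2 : x = a :: w
    · subst h2
      by_cases hi : i = a
      · subst hi; rw [wordSwap_left, wordSwap_right]
      · rw [wordSwap_cons_cons hab hi, wordSwap_cons_cons hab hi]
    rw [wordSwap_cons h1 h2, wordSwap_cons, ih]
    · intro h
      rw [h, wordSwap_of_length_le le_rfl] at ih
      exact h1 ih.symm
    · intro h
      rw [h, wordSwap_cons_self hab] at ih
      exact h2 ih.symm

theorem wordSwap_ne (hab : a ≠ b) {x : List (Fin d)} (h1 : x ≠ w) (h2 : x ≠ a :: w) :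
    wordSwap a b w x ≠ w ∧ wordSwap a b w x ≠ a :: w := by
  have h := wordSwap_wordSwap (w := w) hab x
  constructor
  · intro h'
    rw [h', wordSwap_of_length_le le_rfl] at h
    exact h1 h.symm
  · intro h'
    rw [h', wordSwap_cons_self hab] at h
    exact h2 h.symm

/-- A letter is altered only when attached to `w` or `a :: w`; attached to `x` or a descendant of
it, letters are copied. -/
theorem wordSwap_append (u : List (Fin d)) {x : List (Fin d)} (h1 : w.length ≤ x.length)
    (h2 : x ≠ w) (h3 : x ≠ a :: w) :
    wordSwap a b w (u ++ x) = u ++ wordSwap a b w x := by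
  have hx : w.length < x.length ∨ w.length = x.length := by omega
  induction u with
  | nil => rfl
  | cons i u ih =>
    by_cases hw : u ++ x = w ∨ u ++ x = a :: w
    · rcases hw with hw | hw
      · have := congrArg List.length hw
        rw [List.length_append] at this
        have hu : u = [] := List.length_eq_zero_iff.1 (by omega)
        subst hu
        exact (h2 hw).elim
      · cases u with
        | nil => exact (h3 hw).elim
        | cons j u =>
          rw [List.cons_append, List.cons.injEq] at hw
          have := congrArg List.length hw.2
          rw [List.length_append] at this
          have hu : u = [] := List.length_eq_zero_iff.1 (by omega)
          subst hu
          exact (h2 hw.2).elim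
    · push Not at hw
      rw [List.cons_append, wordSwap_cons hw.1 hw.2, ih, List.cons_append]

end WordSwap

/-! ### The half turn across two adjacent blocks. -/

namespace Datum

variable {d : ℕ} {O Y : Type*} [TopologicalSpace O] [TopologicalSpace Y] {D : Datum d O Y}

/-- Points of the block `w`, in a coordinate about its first lower boundary circle. -/
def parentPt (K : D.Block ≃ₜ D.Block) (w : List (Fin d)) (p : ℂ) : D.Surface :=
  D.inB w (K (D.chartB (1 + p / 4)))

/-- Points of the block `v`, in a coordinate about its top boundary circle. -/
def childPt (K : D.Block ≃ₜ D.Block) (v : List (Fin d)) (q : ℂ) : D.Surface :=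
  D.inB v (K (D.chartB (q / 4)))

/-- Points of the disc that consists of parts of the block `w` and of its first child. -/
def discPt (K : D.Block ≃ₜ D.Block) (a : Fin d) (w : List (Fin d)) (s : ℂ) : D.Surface :=
  open Classical in if 0 ≤ s.re then parentPt K w (cayleyInv s)
    else childPt K (a :: w) (cayleyInv (-s))

/-- The half turn of the disc, in the coordinate of the block `w`. -/
def parentMap (K : D.Block ≃ₜ D.Block) (a : Fin d) (w : List (Fin d)) (T : ℂ → ℂ) (p : ℂ) :
    D.Surface :=
  open Classical in if p ∈ cayleyDisc then discPt K a w (T (cayley p)) else parentPt K w p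

/-- The half turn of the disc, in the coordinate of the first child of the block `w`. -/
def childMap (K : D.Block ≃ₜ D.Block) (a : Fin d) (w : List (Fin d)) (T : ℂ → ℂ) (q : ℂ) :
    D.Surface :=
  open Classical in if q ∈ cayleyDisc then discPt K a w (T (-cayley q)) else childPt K (a :: w) q

/-- The half turn of the disc, extended to all blocks. -/
def swapPiece (K : D.Block ≃ₜ D.Block) (a b : Fin d) (w : List (Fin d)) (T : ℂ → ℂ)
    (v : List (Fin d)) (y : D.Block) : D.Surface :=
  open Classical in
  if v = w then glueChart (fun z => parentMap K a w T (4 * (z - 1))) (fun y => D.inB w (K y))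
    (K.symm y)
  else if v = a :: w then
    glueChart (fun z => childMap K a w T (4 * z)) (fun y => D.inB (a :: w) (K y)) (K.symm y)
  else D.inB (wordSwap a b w v) y

section Swap

variable {K : D.Block ≃ₜ D.Block} {a b : Fin d} {w : List (Fin d)}

theorem parentPt_circle (hK : ∀ i z, K (D.circle i.succ z) = D.μ i z⁻¹) (ha : (a : ℕ) = 0)
    (z : Circle) : parentPt K w z = D.inB w (D.μ a z⁻¹) := by
  rw [← hK, circle_eq_chartB, parentPt]
  simp [ha]

theorem childPt_circle (hK0 : ∀ z, K (D.circle 0 z) = D.circle 0 z) (v : List (Fin d))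
    (z : Circle) : childPt K v z = D.inB v (D.circle 0 z) := by
  conv_rhs => rw [← hK0, circle_eq_chartB]
  rw [childPt]
  simp

theorem parentPt_eq_childPt (hK0 : ∀ z, K (D.circle 0 z) = D.circle 0 z)
    (hK : ∀ i z, K (D.circle i.succ z) = D.μ i z⁻¹) (ha : (a : ℕ) = 0) (z : Circle) :
    parentPt K w (z⁻¹ : Circle) = childPt K (a :: w) z := by
  rw [parentPt_circle hK ha, childPt_circle hK0, inB_μ, inv_inv]

theorem discPt_cayley {p : ℂ} (hp : p ∈ cayleyDisc) (h1 : 1 ≤ ‖p‖) :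
    discPt K a w (cayley p) = parentPt K w p := by
  rw [discPt, if_pos (cayley_re_nonneg h1), cayleyInv_cayley (add_one_ne_zero_of_mem_cayleyDisc hp)]

/-- Only the seam `‖q‖ = 1` needs an argument: there the disc point is defined through the parent,
and `cayley_inv` translates between the coordinates. -/
theorem discPt_neg_cayley (hK0 : ∀ z, K (D.circle 0 z) = D.circle 0 z)
    (hK : ∀ i z, K (D.circle i.succ z) = D.μ i z⁻¹) (ha : (a : ℕ) = 0) {q : ℂ}
    (hq : q ∈ cayleyDisc) (h1 : 1 ≤ ‖q‖) :
    discPt K a w (-cayley q) = childPt K (a :: w) q := by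
  rcases h1.eq_or_lt with h1 | h1
  · let z : Circle := ⟨q, mem_sphere_zero_iff_norm.2 h1.symm⟩
    have hz : q = z := rfl
    rw [hz] at hq ⊢
    rw [← cayley_inv, discPt_cayley (inv_mem_cayleyDisc.2 hq) (Circle.norm_coe _).ge,
      parentPt_eq_childPt hK0 hK ha]
  · have h2 := cayley_re_pos h1
    rw [discPt, if_neg (by simpa using h2), neg_neg,
      cayleyInv_cayley (add_one_ne_zero_of_mem_cayleyDisc hq)]

theorem continuousOn_parentPt : ContinuousOn (parentPt K w) {p | 1 + p / 4 ∈ planarBlock d} :=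
  ((D.continuous_inB w).comp K.continuous).comp_continuousOn
    (continuousOn_chartB.comp (Continuous.continuousOn (by fun_prop)) fun _ h => h)

theorem continuousOn_childPt : ContinuousOn (childPt K w) {q | q / 4 ∈ planarBlock d} :=
  ((D.continuous_inB w).comp K.continuous).comp_continuousOn
    (continuousOn_chartB.comp (Continuous.continuousOn (by fun_prop)) fun _ h => h)

theorem continuousOn_discPt (hK0 : ∀ z, K (D.circle 0 z) = D.circle 0 z)
    (hK : ∀ i z, K (D.circle i.succ z) = D.μ i z⁻¹) (ha : (a : ℕ) = 0) :
    ContinuousOn (discPt K a w) twoHoledDisc := by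
  have hunion : twoHoledDisc = (twoHoledDisc ∩ {s | 0 ≤ s.re}) ∪ (twoHoledDisc ∩ {s | s.re ≤ 0}) := by
    rw [← Set.inter_union_distrib_left]
    exact (Set.inter_eq_left.2 fun s _ => le_total 0 s.re).symm
  rw [hunion]
  refine ContinuousOn.union_of_isClosed ?_ ?_
    (isClosed_twoHoledDisc.inter (isClosed_le continuous_const Complex.continuous_re))
    (isClosed_twoHoledDisc.inter (isClosed_le Complex.continuous_re continuous_const))
  · refine ContinuousOn.congr (f := fun s => parentPt K w (cayleyInv s)) ?_
      fun s hs => if_pos hs.2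
    refine continuousOn_parentPt.comp (continuousOn_cayleyInv.mono fun s hs => hs.1.1) ?_
    intro s hs
    obtain ⟨h1, h2, h3⟩ := cayleyInv_mem hs.1 hs.2
    exact parent_mem_planarBlock h1 h2 h3
  · have hmem : ∀ s ∈ twoHoledDisc ∩ {s | s.re ≤ 0}, cayleyInv (-s) ∈ cayleyDisc ∧
        1 ≤ ‖cayleyInv (-s)‖ ∧ 1 ≤ ‖cayleyInv (-s) - 4‖ := fun s hs =>
      cayleyInv_mem (neg_mem_twoHoledDisc.2 hs.1) (by simpa using hs.2)
    refine ContinuousOn.congr (f := fun s => childPt K (a :: w) (cayleyInv (-s))) ?_ ?_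
    · refine continuousOn_childPt.comp (continuousOn_cayleyInv.comp continuous_neg.continuousOn
        fun s hs => (neg_mem_twoHoledDisc.2 hs.1).1) ?_
      intro s hs
      obtain ⟨h1, h2, h3⟩ := hmem s hs
      exact child_mem_planarBlock h1 h2 h3
    · intro s hs
      obtain ⟨h1, h2, h3⟩ := hmem s hs
      beta_reduce
      rw [← discPt_neg_cayley hK0 hK ha h1 h2,
        cayley_cayleyInv (one_sub_ne_zero (neg_mem_twoHoledDisc.2 hs.1).1), neg_neg]

/-- Pasting along two closed sets. Their overlap is where the Cayley transform has norm 7/10; the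
half turn is the identity there, which later supplies the agreement. -/
theorem continuousOn_ite_cayleyDisc {X : Type*} [TopologicalSpace X] {S : Set ℂ}
    (hS : IsClosed S) {f g h : ℂ → X} (hf : ContinuousOn f (S ∩ cayleyDisc))
    (hg : ContinuousOn g S) (h1 : ∀ p ∈ S, p ∈ cayleyDisc → h p = f p)
    (h2 : ∀ p ∈ S, p ∉ cayleyDisc → h p = g p)
    (h3 : ∀ p ∈ S, ‖p - 1‖ = 7 / 10 * ‖p + 1‖ → f p = g p) : ContinuousOn h S := by
  have hunion : S = (S ∩ cayleyDisc) ∪ (S ∩ {p | 7 / 10 * ‖p + 1‖ ≤ ‖p - 1‖}) := by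
    rw [← Set.inter_union_distrib_left]
    exact (Set.inter_eq_left.2 fun p _ => le_total ‖p - 1‖ (7 / 10 * ‖p + 1‖)).symm
  rw [hunion]
  refine ContinuousOn.union_of_isClosed (hf.congr fun p hp => h1 p hp.1 hp.2)
    ((hg.mono Set.inter_subset_left).congr fun p hp => ?_) (hS.inter isClosed_cayleyDisc)
    (hS.inter (isClosed_le (by fun_prop) (by fun_prop)))
  by_cases hpd : p ∈ cayleyDisc
  · rw [h1 p hp.1 hpd, h3 p hp.1 (le_antisymm hpd hp.2)]
  · exact h2 p hp.1 hpd

theorem norm_cayley_eq {p : ℂ} (hp : p ∈ cayleyDisc) (h : ‖p - 1‖ = 7 / 10 * ‖p + 1‖) :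
    ‖cayley p‖ = 7 / 10 := by
  rw [cayley, norm_div, h, mul_div_assoc,
    div_self (norm_ne_zero_iff.2 (add_one_ne_zero_of_mem_cayleyDisc hp)), mul_one]

theorem continuousOn_parentMap (hd : 2 ≤ d) (hK0 : ∀ z, K (D.circle 0 z) = D.circle 0 z)
    (hK : ∀ i z, K (D.circle i.succ z) = D.μ i z⁻¹) (ha : (a : ℕ) = 0) {T : ℂ ≃ₜ ℂ}
    (hT : IsHalfTurn T) :
    ContinuousOn (parentMap K a w T) {p | 1 + p / 4 ∈ planarBlock d} := by
  refine continuousOn_ite_cayleyDisc ((isClosed_planarBlock d).preimage (by fun_prop))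
    (f := fun p => discPt K a w (T (cayley p))) ?_ continuousOn_parentPt
    (fun p _ hp => if_pos hp) (fun p _ hp => if_neg hp) ?_
  · refine (continuousOn_discPt hK0 hK ha).comp (T.continuous.comp_continuousOn
      (continuousOn_cayley.mono Set.inter_subset_right)) fun p hp => ?_
    obtain ⟨h1, h2⟩ := norm_of_parent_mem hd hp.1
    exact hT.mem (cayley_mem hp.2 h1 h2)
  · intro p hp hpe
    rw [hT.outer _ (norm_cayley_eq hpe.le hpe).ge]
    exact discPt_cayley hpe.le (norm_of_parent_mem hd hp).1

theorem continuousOn_childMap (hd : 2 ≤ d) (hK0 : ∀ z, K (D.circle 0 z) = D.circle 0 z)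
    (hK : ∀ i z, K (D.circle i.succ z) = D.μ i z⁻¹) (ha : (a : ℕ) = 0) {T : ℂ ≃ₜ ℂ}
    (hT : IsHalfTurn T) :
    ContinuousOn (childMap K a w T) {q | q / 4 ∈ planarBlock d} := by
  refine continuousOn_ite_cayleyDisc ((isClosed_planarBlock d).preimage (by fun_prop))
    (f := fun p => discPt K a w (T (-cayley p))) ?_ continuousOn_childPt
    (fun p _ hp => if_pos hp) (fun p _ hp => if_neg hp) ?_
  · refine (continuousOn_discPt hK0 hK ha).comp (T.continuous.comp_continuousOn
      (continuousOn_cayley.mono Set.inter_subset_right).neg) fun p hp => ?_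
    obtain ⟨h1, h2⟩ := norm_of_child_mem hd hp.1
    exact hT.mem (neg_mem_twoHoledDisc.2 (cayley_mem hp.2 h1 h2))
  · intro p hp hpe
    rw [hT.outer _ (by rw [norm_neg, norm_cayley_eq hpe.le hpe])]
    exact discPt_neg_cayley hK0 hK ha hpe.le (norm_of_child_mem hd hp).1

theorem continuous_swapPiece [T2Space Y] (hd : 2 ≤ d)
    (hK0 : ∀ z, K (D.circle 0 z) = D.circle 0 z)
    (hK : ∀ i z, K (D.circle i.succ z) = D.μ i z⁻¹) (ha : (a : ℕ) = 0) {T : ℂ ≃ₜ ℂ}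
    (hT : IsHalfTurn T) (v : List (Fin d)) : Continuous (swapPiece K a b w T v) := by
  have e1 : ∀ z : ℂ, 1 + 4 * (z - 1) / 4 = z := fun z => by ring
  have e2 : ∀ z : ℂ, 4 * z / 4 = z := fun z => by ring
  unfold swapPiece
  split_ifs
  · refine Continuous.comp (g := glueChart _ _) ?_ K.symm.continuous
    refine continuous_glueChart (C := (fun p => 1 + p / 4) '' cayleyDisc) ?_
      ((D.continuous_inB w).comp K.continuous)
      (isCompact_cayleyDisc.image (by fun_prop)) fun z hz hzC => ?_
    · refine (continuousOn_parentMap hd hK0 hK ha hT).comp (by fun_prop) fun z hz => ?_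
      change 1 + 4 * (z - 1) / 4 ∈ planarBlock d
      rwa [e1]
    · rw [parentMap, if_neg, parentPt, e1]
      exact fun h => hzC ⟨_, h, e1 z⟩
  · refine Continuous.comp (g := glueChart _ _) ?_ K.symm.continuous
    refine continuous_glueChart (C := (fun p => p / 4) '' cayleyDisc) ?_
      ((D.continuous_inB _).comp K.continuous)
      (isCompact_cayleyDisc.image (by fun_prop)) fun z hz hzC => ?_
    · refine (continuousOn_childMap hd hK0 hK ha hT).comp (by fun_prop) fun z hz => ?_
      change 4 * z / 4 ∈ planarBlock d
      rwa [e2]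
    · rw [childMap, if_neg, childPt, e2]
      exact fun h => hzC ⟨_, h, e2 z⟩
  · exact D.continuous_inB _

theorem parentMap_of_mem (T : ℂ → ℂ) {p : ℂ} (hp : p ∈ cayleyDisc) :
    parentMap K a w T p = discPt K a w (T (cayley p)) := if_pos hp

theorem parentMap_of_not_mem (T : ℂ → ℂ) {p : ℂ} (hp : p ∉ cayleyDisc) :
    parentMap K a w T p = parentPt K w p := if_neg hp

theorem childMap_of_mem (T : ℂ → ℂ) {q : ℂ} (hq : q ∈ cayleyDisc) :
    childMap K a w T q = discPt K a w (T (-cayley q)) := if_pos hq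

theorem childMap_of_not_mem (T : ℂ → ℂ) {q : ℂ} (hq : q ∉ cayleyDisc) :
    childMap K a w T q = childPt K (a :: w) q := if_neg hq

theorem swapPiece_parent (T : ℂ → ℂ) {p : ℂ} (hp : 1 + p / 4 ∈ planarBlock d) :
    swapPiece K a b w T w (K (D.chartB (1 + p / 4))) = parentMap K a w T p := by
  rw [swapPiece, if_pos rfl, Homeomorph.symm_apply_apply, glueChart_chartB _ _ hp]
  congr 1
  ring

theorem swapPiece_child (T : ℂ → ℂ) {q : ℂ} (hq : q / 4 ∈ planarBlock d) :
    swapPiece K a b w T (a :: w) (K (D.chartB (q / 4))) = childMap K a w T q := by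
  rw [swapPiece, if_neg (List.cons_ne_self _ _), if_pos rfl, Homeomorph.symm_apply_apply,
    glueChart_chartB _ _ hq]
  congr 1
  ring

theorem swapPiece_of_not {v : List (Fin d)} (hv : v = w ∨ v = a :: w) {y : D.Block}
    (hy : ¬ ∃ z ∈ planarBlock d, D.chartB z = K.symm y) (T : ℂ → ℂ) :
    swapPiece K a b w T v y = D.inB v y := by
  rcases hv with rfl | rfl
  · rw [swapPiece, if_pos rfl, glueChart_of_not _ _ hy, Homeomorph.apply_symm_apply]
  · rw [swapPiece, if_neg (List.cons_ne_self _ _), if_pos rfl, glueChart_of_not _ _ hy,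
      Homeomorph.apply_symm_apply]

theorem swapPiece_of_ne {v : List (Fin d)} (h1 : v ≠ w) (h2 : v ≠ a :: w) (T : ℂ → ℂ)
    (y : D.Block) : swapPiece K a b w T v y = D.inB (wordSwap a b w v) y := by
  rw [swapPiece, if_neg h1, if_neg h2]

/-- The lower circle `b_{i+1}` has centre `4i` in the parent coordinate and `4(i+1)` in the child
coordinate; the parameter is inverted by the straightening. -/
theorem succ_circle_eq {i : Fin d} {v : List (Fin d)} (hK : ∀ i z, K (D.circle i.succ z) = D.μ i z⁻¹)
    (z : Circle) :
    (1 + (4 * (i : ℕ) + ((z⁻¹ : Circle) : ℂ)) / 4 ∈ planarBlock d ∧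
      D.μ i z = K (D.chartB (1 + (4 * (i : ℕ) + ((z⁻¹ : Circle) : ℂ)) / 4)) ∧
      parentPt K v (4 * (i : ℕ) + ((z⁻¹ : Circle) : ℂ)) = D.inB v (D.μ i z)) ∧
    ((4 * ((i : ℕ) + 1) + ((z⁻¹ : Circle) : ℂ)) / 4 ∈ planarBlock d ∧
      D.μ i z = K (D.chartB ((4 * ((i : ℕ) + 1) + ((z⁻¹ : Circle) : ℂ)) / 4)) ∧
      childPt K v (4 * ((i : ℕ) + 1) + ((z⁻¹ : Circle) : ℂ)) = D.inB v (D.μ i z)) := by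
  have h1 := circle_mem_planarBlock i.succ z⁻¹
  have h2 : D.μ i z = K (D.chartB ((i.succ : ℕ) + ((z⁻¹ : Circle) : ℂ) / 4)) := by
    rw [← circle_eq_chartB, hK, inv_inv]
  have e1 : 1 + (4 * (i : ℕ) + ((z⁻¹ : Circle) : ℂ)) / 4
      = (i.succ : ℕ) + ((z⁻¹ : Circle) : ℂ) / 4 := by
    rw [Fin.val_succ]; push_cast; ring
  have e2 : (4 * ((i : ℕ) + 1) + ((z⁻¹ : Circle) : ℂ)) / 4
      = (i.succ : ℕ) + ((z⁻¹ : Circle) : ℂ) / 4 := by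
    rw [Fin.val_succ]; push_cast; ring
  rw [parentPt, childPt, e1, e2, ← h2]
  exact ⟨⟨h1, rfl, rfl⟩, h1, rfl, rfl⟩

theorem not_mem_cayleyDisc_of_two_le {n : ℕ} (hn : 2 ≤ n) (z : Circle) :
    (4 * n + z : ℂ) ∉ cayleyDisc := by
  intro h
  have h1 := norm_le_six_of_mem_cayleyDisc h
  have h2 := norm_sub_le (4 * n + z : ℂ) z
  rw [add_sub_cancel_right, Circle.norm_coe, norm_mul, Complex.norm_natCast] at h2
  norm_num at h2
  have h3 : (2 : ℝ) ≤ n := by exact_mod_cast hn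
  linarith

theorem swapPiece_root {T : ℂ → ℂ} (hK0 : ∀ z, K (D.circle 0 z) = D.circle 0 z) (z : Circle) :
    swapPiece K a b w T w (D.circle 0 z) = D.inB w (D.circle 0 z) := by
  have h1 := circle_mem_planarBlock (d := d) 0 z
  have e1 : ((0 : Fin (d + 1)) : ℕ) + (z : ℂ) / 4 = 1 + (z - 4 : ℂ) / 4 := by simp; ring
  have h2 : D.circle 0 z = K (D.chartB (1 + (z - 4 : ℂ) / 4)) := by
    rw [← e1, ← circle_eq_chartB, hK0]
  rw [e1] at h1
  rw [h2, swapPiece_parent T h1, parentMap_of_not_mem]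
  · rfl
  · intro h
    have := re_pos_of_mem_cayleyDisc h
    have hre := Complex.re_le_norm z
    rw [Circle.norm_coe] at hre
    simp at this
    linarith

/-- Along the seam both formulas are the same turn of the disc. At the two holes the turn exchanges
`p = 4 + u` with `q = 4 + u`, so parametrizations are preserved and the subtrees hanging there are
exchanged rigidly. All other circles lie outside the disc, where only words change. -/
theorem swapPiece_glue (hd : 2 ≤ d) (hK0 : ∀ z, K (D.circle 0 z) = D.circle 0 z)
    (hK : ∀ i z, K (D.circle i.succ z) = D.μ i z⁻¹) (ha : (a : ℕ) = 0) (hb : (b : ℕ) = 1)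
    {T : ℂ ≃ₜ ℂ} (hT : IsHalfTurn T) (v : List (Fin d)) (i : Fin d) (z : Circle) :
    swapPiece K a b w T v (D.μ i z) = swapPiece K a b w T (i :: v) (D.circle 0 z) := by
  have hab : a ≠ b := fun h => by rw [h, hb] at ha; omega
  obtain ⟨hA1, hA2, hA3⟩ := (succ_circle_eq (i := i) (v := w) hK z).1
  obtain ⟨hB1, hB2, hB3⟩ := (succ_circle_eq (i := i) (v := a :: w) hK z).2
  by_cases hv : v = w
  · subst hv
    rw [hA2, swapPiece_parent T hA1]
    by_cases hia : i = a
    · subst hia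
      have hc : D.circle 0 z = K (D.chartB ((z : ℂ) / 4)) := by
        conv_lhs => rw [← hK0, circle_eq_chartB]
        simp
      have hz : (z : ℂ) / 4 ∈ planarBlock d := by simpa using circle_mem_planarBlock (d := d) 0 z
      have e : 4 * ((i : ℕ) : ℂ) + (z⁻¹ : Circle) = (z⁻¹ : Circle) := by
        rw [ha, Nat.cast_zero, mul_zero, zero_add]
      rw [hc, swapPiece_child T hz, e]
      by_cases hm : (z : ℂ) ∈ cayleyDisc
      · rw [parentMap_of_mem T (inv_mem_cayleyDisc.2 hm), childMap_of_mem T hm, cayley_inv]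
      · rw [parentMap_of_not_mem T (mt inv_mem_cayleyDisc.1 hm), childMap_of_not_mem T hm,
          parentPt_eq_childPt hK0 hK ha]
    have hne : i :: v ≠ a :: v := by simpa using hia
    rw [swapPiece_of_ne (List.cons_ne_self _ _) hne]
    by_cases hib : i = b
    · subst hib
      obtain ⟨h1, h2⟩ := four_add_mem_cayleyDisc z⁻¹
      obtain ⟨hC1, hC2, hC3⟩ := (succ_circle_eq (i := a) (v := a :: v) hK z).2
      have e1 : 4 * ((i : ℕ) : ℂ) + (z⁻¹ : Circle) = 4 + (z⁻¹ : Circle) := by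
        rw [hb, Nat.cast_one, mul_one]
      have e2 : 4 * (((a : ℕ) : ℂ) + 1) + (z⁻¹ : Circle) = 4 + (z⁻¹ : Circle) := by
        rw [ha, Nat.cast_zero, zero_add, mul_one]
      rw [e2] at hC1 hC3
      rw [wordSwap_right, ← inB_μ, ← hC3, e1, parentMap_of_mem T h1, hT.inner _ h2]
      exact discPt_neg_cayley hK0 hK ha h1 (norm_of_child_mem hd hC1).1
    · have hi2 : 2 ≤ (i : ℕ) := by
        have h1 : (i : ℕ) ≠ 0 := fun h => hia (Fin.ext (h.trans ha.symm))
        have h2 : (i : ℕ) ≠ 1 := fun h => hib (Fin.ext (h.trans hb.symm))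
        omega
      rw [wordSwap_cons_self hib, ← inB_μ, ← hA3,
        parentMap_of_not_mem T (not_mem_cayleyDisc_of_two_le hi2 _)]
  by_cases hv' : v = a :: w
  · subst hv'
    have hne1 : i :: a :: w ≠ w := fun h => by
      have := congrArg List.length h
      simp at this
      omega
    rw [hB2, swapPiece_child T hB1, swapPiece_of_ne hne1 (fun h =>
      List.cons_ne_self _ _ (List.cons.inj h).2)]
    by_cases hia : i = a
    · subst hia
      obtain ⟨h1, h2⟩ := four_add_mem_cayleyDisc z⁻¹
      obtain ⟨hC1, hC2, hC3⟩ := (succ_circle_eq (i := b) (v := w) hK z).1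
      have e1 : 4 * ((b : ℕ) : ℂ) + (z⁻¹ : Circle) = 4 + (z⁻¹ : Circle) := by
        rw [hb, Nat.cast_one, mul_one]
      have e2 : 4 * (((i : ℕ) : ℂ) + 1) + (z⁻¹ : Circle) = 4 + (z⁻¹ : Circle) := by
        rw [ha, Nat.cast_zero, zero_add, mul_one]
      rw [e1] at hC1 hC3
      rw [wordSwap_left, ← inB_μ, ← hC3, e2, childMap_of_mem T h1,
        hT.inner _ (by rwa [norm_neg]), neg_neg]
      exact discPt_cayley h1 (norm_of_parent_mem hd hC1).1
    · have hi2 : 2 ≤ (i : ℕ) + 1 := by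
        have h1 : (i : ℕ) ≠ 0 := fun h => hia (Fin.ext (h.trans ha.symm))
        omega
      have hn := not_mem_cayleyDisc_of_two_le hi2 z⁻¹
      rw [Nat.cast_add, Nat.cast_one] at hn
      rw [wordSwap_cons_cons hab hia, ← inB_μ, ← hB3, childMap_of_not_mem T hn]
  · rw [swapPiece_of_ne hv hv']
    by_cases hiv : i :: v = w
    · have hlen : v.length ≤ w.length := by rw [← hiv]; simp
      rw [hiv, swapPiece_root hK0, wordSwap_of_length_le hlen, inB_μ, hiv]
    · rw [swapPiece_of_ne hiv (fun h => hv (List.cons.inj h).2), wordSwap_cons hv hv', inB_μ]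

theorem swapPiece_nil {T : ℂ → ℂ} (hK0 : ∀ z, K (D.circle 0 z) = D.circle 0 z) (z : Circle) :
    D.inB [] (D.circle 0 z) = swapPiece K a b w T [] (D.circle 0 z) := by
  by_cases h : w = []
  · subst h
    rw [swapPiece_root hK0]
  · rw [swapPiece_of_ne (fun h' => h h'.symm) (by simp)]
    rfl

end Swap

end Datum

namespace Datum

variable {d : ℕ} {O Y : Type*} [TopologicalSpace O] [TopologicalSpace Y] {D : Datum d O Y}

section Swap

variable {K : D.Block ≃ₜ D.Block} {a b : Fin d} {w : List (Fin d)}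

/-- Each point of the two-holed disc has a parent or a child coordinate, and in both the map is `T`
in the variable `s`. This reduces composition on the surface to composition in the plane. -/
theorem apply_discPt (hK0 : ∀ z, K (D.circle 0 z) = D.circle 0 z)
    (hK : ∀ i z, K (D.circle i.succ z) = D.μ i z⁻¹) (ha : (a : ℕ) = 0) {T : ℂ → ℂ}
    {g : D.Surface → D.Surface} (hg : ∀ v y, g (D.inB v y) = swapPiece K a b w T v y) {s : ℂ}
    (hs : s ∈ twoHoledDisc) : g (discPt K a w s) = discPt K a w (T s) := by
  rcases cayley_or_neg_cayley hs with ⟨p, ⟨h1, h2, h3⟩, rfl⟩ | ⟨q, ⟨h1, h2, h3⟩, rfl⟩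
  · rw [discPt_cayley h1 h2, parentPt, hg, swapPiece_parent T (parent_mem_planarBlock h1 h2 h3),
      parentMap_of_mem T h1]
  · rw [discPt_neg_cayley hK0 hK ha h1 h2, childPt, hg,
      swapPiece_child T (child_mem_planarBlock h1 h2 h3), childMap_of_mem T h1]

theorem apply_swapPiece (hd : 2 ≤ d) (hK0 : ∀ z, K (D.circle 0 z) = D.circle 0 z)
    (hK : ∀ i z, K (D.circle i.succ z) = D.μ i z⁻¹) (ha : (a : ℕ) = 0) (hb : (b : ℕ) = 1)
    {T T' : ℂ ≃ₜ ℂ} (hT : IsHalfTurn T) (hTT' : ∀ s, T' (T s) = s)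
    {g : D.Surface → D.Surface} (hg : ∀ v y, g (D.inB v y) = swapPiece K a b w T' v y)
    (v : List (Fin d)) (y : D.Block) : g (swapPiece K a b w T v y) = D.inB v y := by
  have hab : a ≠ b := fun h => by rw [h, hb] at ha; omega
  by_cases hv : v = w ∨ v = a :: w
  · by_cases hy : ∃ z ∈ planarBlock d, D.chartB z = K.symm y
    · obtain ⟨z, hz, hzy⟩ := hy
      have hy' : y = K (D.chartB z) := by rw [hzy, Homeomorph.apply_symm_apply]
      subst hy'
      rcases hv with rfl | rfl
      · obtain ⟨p, rfl⟩ : ∃ p, z = 1 + p / 4 := ⟨4 * (z - 1), by ring⟩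
        obtain ⟨h1, h2⟩ := norm_of_parent_mem hd hz
        rw [swapPiece_parent _ hz]
        by_cases hp : p ∈ cayleyDisc
        · have h3 := cayley_mem hp h1 h2
          rw [parentMap_of_mem _ hp, apply_discPt hK0 hK ha hg (hT.mem h3), hTT',
            discPt_cayley hp h1]
          rfl
        · rw [parentMap_of_not_mem _ hp, parentPt, hg, swapPiece_parent _ hz,
            parentMap_of_not_mem _ hp]
          rfl
      · obtain ⟨q, rfl⟩ : ∃ q, z = q / 4 := ⟨4 * z, by ring⟩
        obtain ⟨h1, h2⟩ := norm_of_child_mem hd hz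
        rw [swapPiece_child _ hz]
        by_cases hq : q ∈ cayleyDisc
        · have h3 := neg_mem_twoHoledDisc.2 (cayley_mem hq h1 h2)
          rw [childMap_of_mem _ hq, apply_discPt hK0 hK ha hg (hT.mem h3), hTT',
            discPt_neg_cayley hK0 hK ha hq h1]
          rfl
        · rw [childMap_of_not_mem _ hq, childPt, hg, swapPiece_child _ hz,
            childMap_of_not_mem _ hq]
          rfl
    · rw [swapPiece_of_not hv hy, hg, swapPiece_of_not hv hy]
  · push Not at hv
    obtain ⟨h1, h2⟩ := wordSwap_ne hab hv.1 hv.2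
    rw [swapPiece_of_ne hv.1 hv.2, hg, swapPiece_of_ne h1 h2, wordSwap_wordSwap hab]

theorem exists_swap_homeo [T2Space Y] (hd : 2 ≤ d) (hK0 : ∀ z, K (D.circle 0 z) = D.circle 0 z)
    (hK : ∀ i z, K (D.circle i.succ z) = D.μ i z⁻¹) (ha : (a : ℕ) = 0) (hb : (b : ℕ) = 1)
    (w : List (Fin d)) {T : ℂ ≃ₜ ℂ} (hT : IsHalfTurn T) :
    ∃ f : D.Surface ≃ₜ D.Surface, (∀ x, f (D.inO x) = D.inO x) ∧
      (∀ v y, f (D.inB v y) = swapPiece K a b w T v y) ∧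
      ∀ v y, f.symm (D.inB v y) = swapPiece K a b w T.symm v y :=
  ⟨homeoOfBlocks (swapPiece K a b w T) (swapPiece K a b w T.symm)
    (continuous_swapPiece hd hK0 hK ha hT) (continuous_swapPiece hd hK0 hK ha hT.symm)
    (swapPiece_nil hK0) (swapPiece_glue hd hK0 hK ha hb hT) (swapPiece_nil hK0)
    (swapPiece_glue hd hK0 hK ha hb hT.symm)
    (apply_swapPiece hd hK0 hK ha hb hT T.symm_apply_apply fun _ _ => rfl)
    (apply_swapPiece hd hK0 hK ha hb hT.symm T.apply_symm_apply fun _ _ => rfl),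
    fun _ => rfl, fun _ _ => rfl, fun _ _ => rfl⟩

theorem swapPiece_mem_union (T : ℂ → ℂ) {v : List (Fin d)} (hv : v = w ∨ v = a :: w)
    (y : D.Block) : swapPiece K a b w T v y ∈ D.union {w, a :: w} := by
  have hw : ∀ y, D.inB w y ∈ D.union {w, a :: w} := fun y =>
    block_subset_union.2 (Or.inl rfl) (inB_mem_block w y)
  have hc : ∀ y, D.inB (a :: w) y ∈ D.union {w, a :: w} := fun y =>
    block_subset_union.2 (Or.inr rfl) (inB_mem_block _ y)
  have hdisc : ∀ s, discPt K a w s ∈ D.union {w, a :: w} := by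
    intro s
    unfold discPt
    split_ifs
    · exact hw _
    · exact hc _
  unfold swapPiece glueChart parentMap childMap
  rcases hv with rfl | rfl
  · rw [if_pos rfl]
    beta_reduce
    split_ifs
    · exact hdisc _
    · exact hw _
    · exact hw _
  · rw [if_neg (List.cons_ne_self _ _), if_pos rfl]
    beta_reduce
    split_ifs
    · exact hdisc _
    · exact hc _
    · exact hc _

theorem rigidMove_levels [T2Space O] [PreconnectedSpace O] [T2Space Y] [PreconnectedSpace Y]
    (hd : 2 ≤ d) (ha : (a : ℕ) = 0) (hb : (b : ℕ) = 1) (w : List (Fin d)) :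
    D.RigidMove (b :: w) (a :: a :: w) := by
  have hab : a ≠ b := fun h => by rw [h, hb] at ha; omega
  obtain ⟨K, hK0, hK⟩ := exists_straightening D
  obtain ⟨T, hT⟩ := exists_isHalfTurn
  obtain ⟨f, hfO, hf, hf'⟩ := exists_swap_homeo hd hK0 hK ha hb w hT
  have hfO' : ∀ x, f.symm (D.inO x) = D.inO x := fun x =>
    (Homeomorph.symm_apply_eq f).2 (hfO x).symm
  have hne : ∀ {v : List (Fin d)}, w.length + 2 ≤ v.length → v ≠ w ∧ v ≠ a :: w := by
    intro v hv
    constructor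
    · rintro rfl; omega
    · rintro rfl; simp at hv
  have hbw : b :: w ≠ w ∧ b :: w ≠ a :: w :=
    ⟨List.cons_ne_self _ _, fun h => hab (List.cons.inj h).1.symm⟩
  -- The turned blocks have levels `|w|` and `|w| + 1`, so from level `|w| + 2` on every block is
  -- merely relabeled.
  refine ⟨f, hfO, isHBlock_iff.2 ⟨D.ball (w.length + 2),
    isBlockOn_ball (isSuited_ball _) ?_ fun v hv => ?_⟩, fun u y => ?_⟩
  -- The half turn keeps points of the two turned blocks inside their union, and `wordSwap` fixes
  -- both words; every other block goes to its exchanged block.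
  · have himg : f '' D.ball (w.length + 2)
        = D.union (wordSwap a b w '' {v | v.length < w.length + 2}) := by
      have hfix : ∀ v, v = w ∨ v = a :: w →
          v.length < w.length + 2 ∧ wordSwap a b w v = v := by
        rintro v (rfl | rfl)
        · exact ⟨by omega, wordSwap_of_length_le le_rfl⟩
        · exact ⟨by simp, wordSwap_cons_self hab⟩
      have hsub : D.union {w, a :: w} ⊆
          D.union (wordSwap a b w '' {v | v.length < w.length + 2}) :=
        by
        refine union_mono fun v hv => ?_
        obtain ⟨h1, h2⟩ := hfix v hv
        exact ⟨v, h1, h2⟩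
      have hsub' : D.union {w, a :: w} ⊆ D.ball (w.length + 2) :=
        union_mono fun v hv => (hfix v hv).1
      ext x
      constructor
      · rintro ⟨_, ⟨x, rfl⟩ | hx, rfl⟩
        · rw [hfO]
          exact Or.inl ⟨x, rfl⟩
        · simp only [Set.mem_iUnion] at hx
          obtain ⟨v, hv, y, rfl⟩ := hx
          rw [hf]
          by_cases hv' : v = w ∨ v = a :: w
          · exact hsub (swapPiece_mem_union T hv' y)
          · push Not at hv'
            rw [swapPiece_of_ne hv'.1 hv'.2]
            exact block_subset_union.2 (Set.mem_image_of_mem _ hv) (inB_mem_block _ y)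
      · intro hx
        refine ⟨f.symm x, ?_, f.apply_symm_apply x⟩
        rcases hx with ⟨x, rfl⟩ | hx
        · rw [hfO']
          exact Or.inl ⟨x, rfl⟩
        · simp only [Set.mem_iUnion] at hx
          obtain ⟨_, ⟨v, hv, rfl⟩, y, rfl⟩ := hx
          rw [hf']
          by_cases hv' : v = w ∨ v = a :: w
          · rw [(hfix v hv').2]
            exact hsub' (swapPiece_mem_union T.symm hv' y)
          · push Not at hv'
            obtain ⟨h1, h2⟩ := wordSwap_ne hab hv'.1 hv'.2
            rw [swapPiece_of_ne h1 h2, wordSwap_wordSwap hab]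
            exact block_subset_ball.2 hv ⟨y, rfl⟩
    have hconn := (isSuited_ball (D := D) (w.length + 2)).1.image f f.continuous.continuousOn
    rw [himg] at hconn ⊢
    exact isSuited_union ((List.finite_length_lt _ _).image _) hconn
  · refine ⟨wordSwap a b w v, 1, one_mem _, .of_eq fun u y => ?_⟩
    obtain ⟨h1, h2⟩ := hne (v := u ++ v) (by rw [List.length_append]; omega)
    obtain ⟨h3, h4⟩ := hne hv.ge
    rw [hf, swapPiece_of_ne h1 h2, wordSwap_append u (by omega) h3 h4]
  · have h1 : u ++ b :: w ≠ w := fun h => by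
      have := congrArg List.length h
      simp at this
      omega
    have h2 : u ++ b :: w ≠ a :: w := fun h => by
      have := congrArg List.length h
      simp at this
      subst this
      exact hbw.2 h
    rw [hf, swapPiece_of_ne h1 h2, wordSwap_append u (by simp) hbw.1 hbw.2, wordSwap_right]

end Swap

end Datum

end CantorSurface

end

/-! ### The theorem. -/

theorem proposition7p2 {d : ℕ} (hd : 2 ≤ d) {O Y : Type*}
    [TopologicalSpace O] [T2Space O] [CompactSpace O] [ConnectedSpace O]
    [ChartedSpace (EuclideanHalfSpace 2) O] [TopologicalSpace Y]
    (hY : Nonempty (Y ≃ₜ Metric.sphere (0 : EuclideanSpace ℝ (Fin 3)) 1) ∨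
      Nonempty (Y ≃ₜ Circle × Circle))
    (D : CantorSurface.Datum d O Y) (H : Subgroup D.BlockMap) :
    ∃ ι : H →* D.SurfaceMap,
      (∀ (h : H) (φ : D.SurfaceMap), φ = ι h ↔ D.IsFirstLabelClass (h : D.BlockMap) φ) ∧
      (Subgroup.closure (Set.range ι ∪ D.blockMappingClasses ⊥) : Set D.SurfaceMap) =
        D.blockMappingClasses H := by
  have hY' : T2Space Y ∧ PreconnectedSpace Y := by
    rcases hY with ⟨⟨e⟩⟩ | ⟨⟨e⟩⟩
    · have hconn : IsConnected (Metric.sphere (0 : EuclideanSpace ℝ (Fin 3)) 1) :=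
        isConnected_sphere (by
          rw [← Module.finrank_eq_rank, finrank_euclideanSpace_fin]
          norm_num) 0 zero_le_one
      have := isConnected_iff_connectedSpace.1 hconn
      exact ⟨e.symm.t2Space, (Function.Surjective.connectedSpace e.symm.surjective
        e.symm.continuous).toPreconnectedSpace⟩
    · exact ⟨e.symm.t2Space, (Function.Surjective.connectedSpace e.symm.surjective
        e.symm.continuous).toPreconnectedSpace⟩
  obtain ⟨_, _⟩ := hY'
  refine ⟨(D.subtreeHom [⟨0, by omega⟩]).comp H.subtype, fun h φ =>
    CantorSurface.Datum.isFirstLabelClass_iff (by omega) h φ, ?_⟩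
  refine CantorSurface.Datum.closure_eq_blockMappingClasses hd H fun i w => ?_
  exact CantorSurface.Datum.rigidMove_of_generators hd
    CantorSurface.Datum.rigidMove_siblings
    (fun w => CantorSurface.Datum.rigidMove_levels hd rfl rfl w) i w
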